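/- **Setting.** Let $X_1$ be a real random variable with $\mathbb E[X_1^2]<\infty$, and for all $n\ge1$ let $$X_{2n}=a_nX_n+\varepsilon_{2n},\qquad X_{2n+1}=b_nX_n+\varepsilon_{2n+1},$$ where $(a_n,b_n)_{n\ge1}$ and $(\varepsilon_{2n},\varepsilon_{2n+1})_{n\ge1}$ are two i.i.d. sequences of random vectors of $\mathbb R^2$, independent of each other. Put $\mathbb G_n=\{2^n,\dots,2^{n+1}-1\}$, $\mathbb T_n=\bigcup_{k=0}^n\mathbb G_k$ (so $|\mathbb T_{n-1}|=2^n-1$, $\mathbb T_{-1}=\emptyset$) and $\mathcal F_n=\sigma(X_k,\,k\in\mathbb T_n)$. Assume that there are constants $a,b,c,d$ such that a.s., for all $n\ge0$ and $k\in\mathbb G_n$, $\mathbb E[a_k|\mathcal F_n]=a$, $\mathbb E[b_k|\mathcal F_n]=b$, $\mathbb E[\varepsilon_{2k}|\mathcal F_n]=c$, $\mathbb E[\varepsilon_{2k+1}|\mathcal F_n]=d$. **Hypotheses.** All the (conditional) moments below that are not of order $\alpha$ are moments of variables with the corresponding integrability. - (H.1) For all $k\ge1$, $\mathbb E[a_k^2]<1$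 and $\mathbb E[b_k^2]<1$. - (H.2) For all $n\ge0$ and $k\in\mathbb G_n$, a.s. $\mathrm{Var}[a_k|\mathcal F_n]=\sigma_a^2\ge0$, $\mathrm{Var}[b_k|\mathcal F_n]=\sigma_b^2\ge0$, $\mathrm{Var}[\varepsilon_{2k}|\mathcal F_n]=\sigma_c^2>0$, $\mathrm{Var}[\varepsilon_{2k+1}|\mathcal F_n]=\sigma_d^2>0$. - (H.3) For all $n\ge0$: if $k,l\in\mathbb G_{n+1}$ and $\lfloor k/2\rfloor\ne\lfloor l/2\rfloor$, then $\varepsilon_k$ and $\varepsilon_l$ are conditionally independent given $\mathcal F_n$; if $k,l\in\mathbb G_n$ and $k\neq l$, then $(a_k,b_k)$ and $(a_l,b_l)$ are conditionally independent given $\mathcal F_n$. There are constants $\rho_{ab},\rho_{cd}$ with $\rho_{cd}^2<\sigma_c^2\sigma_d^2$ and $\rho_{ab}^2\le\sigma_a^2\sigma_b^2$ such that, for all $n\geq 0$ and $k\in\mathbb G_n$, a.s. $\mathbb E[(\varepsilon_{2k}-c)(\varepsilon_{2k+1}-d)|\mathcal F_n]=\rho_{cd}$ and $\mathbb E[(a_k-a)(b_k-b)|\mathcal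 F_n]=\rho_{ab}$. - (H.4) There are $\mu_a^4\ge\sigma_a^4$, $\mu_b^4\ge\sigma_b^4$, $\mu_c^4>\sigma_c^4$, $\mu_d^4>\sigma_d^4$, $\nu_{ab}^2\ge\rho_{ab}^2$, $\nu_{cd}^2>\rho_{cd}^2$ such that, for all $n\ge0$ and $k\in\mathbb G_n$, a.s. $\mathbb E[(a_k-a)^4|\mathcal F_n]=\mu_a^4$, $\mathbb E[(b_k-b)^4|\mathcal F_n]=\mu_b^4$, $\mathbb E[(\varepsilon_{2k}-c)^4|\mathcal F_n]=\mu_c^4$, $\mathbb E[(\varepsilon_{2k+1}-d)^4|\mathcal F_n]=\mu_d^4$, $\mathbb E[(a_k-a)^2(b_k-b)^2|\mathcal F_n]=\nu_{ab}^2$, $\mathbb E[(\varepsilon_{2k}-c)^2(\varepsilon_{2k+1}-d)^2|\mathcal F_n]=\nu_{cd}^2$. Moreover, for all $k\ge1$, $\mathbb E[\varepsilon_{2k}^4]>\mathbb E[\varepsilon_{2k}^2]^2$ and $\mathbb E[\varepsilon_{2k+1}^4]>\mathbb E[\varepsilon_{2k+1}^2]^2$. - (H.5) There is $\alpha>4$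 such that, a.s., the suprema over $n\ge0$ and $k\in\mathbb G_n$ of $\mathbb E[|a_k-a|^\alpha|\mathcal F_n]$, $\mathbb E[|b_k-b|^\alpha|\mathcal F_n]$, $\mathbb E[|\varepsilon_{2k}-c|^\alpha|\mathcal F_n]$ and $\mathbb E[|\varepsilon_{2k+1}-d|^\alpha|\mathcal F_n]$ are finite. **Estimators.** Let $c_k=1+X_k^2$, $d_k=c_k^2$, $\Phi_k=(X_k,1)^t$, $\chi_k=(X_{2k},X_{2k+1})^t$, $\psi_k=(X_k^2,1)^t$, $$S_n=\sum_{k\in\mathbb T_n}\frac1{c_k}\Phi_k\Phi_k^t,\qquad Q_n=\sum_{k\in\mathbb T_n}\frac1{d_k}\psi_k\psi_k^t ,$$ where the identity matrix $I_2$ is added to $S_n$ or $Q_n$ whenever the sum is singular. The WLS estimator of $\theta=\begin{pmatrix}a&b\\c&d\end{pmatrix}$ is $$\hat\theta_n=\begin{pmatrix}\hat a_n&\hat b_n\\ \hat c_n&\hat d_n\end{pmatrix}=S_{n-1}^{-1}\sum_{k\in\mathbb T_{n-1}}\frac1{c_k}\Phi_k\chi_k^t\qquad(\hat\theta_0=0).$$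 For $k\in\mathbb G_n$ let $\hat V_{2k}=X_{2k}-\hat a_nX_k-\hat c_n$, $\hat V_{2k+1}=X_{2k+1}-\hat b_nX_k-\hat d_n$, and let $V_{2k}=X_{2k}-\mathbb E[X_{2k}|\mathcal F_n]$, $V_{2k+1}=X_{2k+1}-\mathbb E[X_{2k+1}|\mathcal F_n]$ be the true residuals. Put $$\hat\eta_n=Q_{n-1}^{-1}\sum_{k\in\mathbb T_{n-1}}\frac{\hat V_{2k}^2}{d_k}\psi_k,\quad \hat\zeta_n=Q_{n-1}^{-1}\sum_{k\in\mathbb T_{n-1}}\frac{\hat V_{2k+1}^2}{d_k}\psi_k,\quad \hat\nu_n=Q_{n-1}^{-1}\sum_{k\in\mathbb T_{n-1}}\frac{\hat V_{2k}\hat V_{2k+1}}{d_k}\psi_k,$$ and let $\eta_n,\zeta_n,\nu_n$ be the oracle estimators given by the same formulas with $V$ in place of $\hat V$. **Theorem.** Under (H.1)–(H.5), almost surely, as $n\to\infty$, $$\hat\eta_n\to\eta=\begin{pmatrix}\sigma_a^2\\\sigma_c^2\end{pmatrix},\qquad \hat\zeta_n\to\zeta=\begin{pmatrix}\sigma_b^2\\\sigma_d^2\end{pmatrix},\qquad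 \hat\nu_n\to\nu=\begin{pmatrix}\rho_{ab}\\\rho_{cd}\end{pmatrix},$$ and $$\|\hat\eta_n-\eta_n\|=O\Big(\frac n{|\mathbb T_{n-1}|}\Big),\quad \|\hat\zeta_n-\zeta_n\|=O\Big(\frac n{|\mathbb T_{n-1}|}\Big),\quad \|\hat\nu_n-\nu_n\|=O\Big(\frac n{|\mathbb T_{n-1}|}\Big)\quad\text{a.s.}$$ -/

import Mathlib

open MeasureTheory ProbabilityTheory Filter Topology Asymptotics
open scoped ENNReal Matrix

namespace RCBAR

noncomputable section

/-! ## The binary tree -/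

/-- The `n`-th generation `𝔾_n = {2^n, …, 2^(n+1) - 1}`. -/
def generation (n : ℕ) : Finset ℕ := Finset.Ico (2 ^ n) (2 ^ (n + 1))

/-- The tree `𝔾_0 ∪ … ∪ 𝔾_(n-1)` made of the first `n` generations, usually written `𝕋_(n-1)`.
It is empty for `n = 0`. -/
def treeBefore (n : ℕ) : Finset ℕ := (Finset.range n).biUnion generation

/-- The generation to which the individual `k ≥ 1` belongs. -/
def genOf (k : ℕ) : ℕ := Nat.log 2 k

/-! ## Weighted least squares, as functions of an observed trajectory `x` -/

/-- The weight `c_k = 1 + x_k²`. -/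
def wc (x : ℕ → ℝ) (k : ℕ) : ℝ := 1 + x k ^ 2

/-- The weight `d_k = c_k² = (1 + x_k²)²`. -/
def wd (x : ℕ → ℝ) (k : ℕ) : ℝ := wc x k ^ 2

/-- `Φ_k = (x_k, 1)`. -/
def Phi (x : ℕ → ℝ) (k : ℕ) : Fin 2 → ℝ := ![x k, 1]

/-- `χ_k = (x_(2k), x_(2k+1))`. -/
def chi (x : ℕ → ℝ) (k : ℕ) : Fin 2 → ℝ := ![x (2 * k), x (2 * k + 1)]

/-- `ψ_k = (x_k², 1)`. -/
def psi (x : ℕ → ℝ) (k : ℕ) : Fin 2 → ℝ := ![x k ^ 2, 1]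

open Classical in
/-- A Gram matrix is kept when it is invertible; otherwise the identity is added to it. -/
def regularize (A : Matrix (Fin 2) (Fin 2) ℝ) : Matrix (Fin 2) (Fin 2) ℝ :=
  if IsUnit A.det then A else A + 1

/-- The matrix `S_(n-1) = ∑_{k ∈ 𝕋_(n-1)} c_k⁻¹ Φ_k Φ_kᵗ`. -/
def gramS (x : ℕ → ℝ) (n : ℕ) : Matrix (Fin 2) (Fin 2) ℝ :=
  regularize (∑ k ∈ treeBefore n, (1 / wc x k) • Matrix.vecMulVec (Phi x k) (Phi x k))

/-- The matrix `Q_(n-1) = ∑_{k ∈ 𝕋_(n-1)} d_k⁻¹ ψ_k ψ_kᵗ`. -/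
def gramQ (x : ℕ → ℝ) (n : ℕ) : Matrix (Fin 2) (Fin 2) ℝ :=
  regularize (∑ k ∈ treeBefore n, (1 / wd x k) • Matrix.vecMulVec (psi x k) (psi x k))

/-- The WLS estimator `θ̂_n = S_(n-1)⁻¹ ∑_{k ∈ 𝕋_(n-1)} c_k⁻¹ Φ_k χ_kᵗ` of the matrix
`θ = !![a, b; c, d]`; its entries are `!![â_n, b̂_n; ĉ_n, d̂_n]`. -/
def thetaHat (x : ℕ → ℝ) (n : ℕ) : Matrix (Fin 2) (Fin 2) ℝ :=
  (gramS x n)⁻¹ * ∑ k ∈ treeBefore n, (1 / wc x k) • Matrix.vecMulVec (Phi x k) (chi x k)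

/-- `V̂_(2k) = x_(2k) - â_n x_k - ĉ_n` for `k ∈ 𝔾_n`. -/
def VhatEven (x : ℕ → ℝ) (k : ℕ) : ℝ :=
  x (2 * k) - thetaHat x (genOf k) 0 0 * x k - thetaHat x (genOf k) 1 0

/-- `V̂_(2k+1) = x_(2k+1) - b̂_n x_k - d̂_n` for `k ∈ 𝔾_n`. -/
def VhatOdd (x : ℕ → ℝ) (k : ℕ) : ℝ :=
  x (2 * k + 1) - thetaHat x (genOf k) 0 1 * x k - thetaHat x (genOf k) 1 1

/-- `Q_(n-1)⁻¹ ∑_{k ∈ 𝕋_(n-1)} d_k⁻¹ r_k ψ_k`, the second-stage WLS estimator built from the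
responses `r_k`. -/
def wlsSecond (x r : ℕ → ℝ) (n : ℕ) : Fin 2 → ℝ :=
  (gramQ x n)⁻¹ *ᵥ ∑ k ∈ treeBefore n, (1 / wd x k * r k) • psi x k

/-- The estimator `η̂_n` of `(σ_a², σ_c²)`. -/
def etaHat (x : ℕ → ℝ) (n : ℕ) : Fin 2 → ℝ :=
  wlsSecond x (fun k => VhatEven x k ^ 2) n

/-- The estimator `ζ̂_n` of `(σ_b², σ_d²)`. -/
def zetaHat (x : ℕ → ℝ) (n : ℕ) : Fin 2 → ℝ :=
  wlsSecond x (fun k => VhatOdd x k ^ 2) n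

/-- The estimator `ν̂_n` of `(ρ_ab, ρ_cd)`. -/
def nuHat (x : ℕ → ℝ) (n : ℕ) : Fin 2 → ℝ :=
  wlsSecond x (fun k => VhatEven x k * VhatOdd x k) n

/-! ## The process -/

variable {Ω : Type*}

/-- The trajectory of the process at the outcome `ω`. -/
def traj (X : ℕ → Ω → ℝ) (ω : Ω) : ℕ → ℝ := fun k => X k ω

/-- The natural filtration `ℱ_n = σ(X_k, k ∈ 𝕋_n)`. -/
abbrev natFilt (X : ℕ → Ω → ℝ) (n : ℕ) : MeasurableSpace Ω :=
  ⨆ k ∈ treeBefore (n + 1), MeasurableSpace.comap (X k) inferInstance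

variable [MeasurableSpace Ω]

/-- `V_(2k) = X_(2k) - 𝔼[X_(2k) | ℱ_n]` for `k ∈ 𝔾_n`. -/
def VEven (P : Measure Ω) (X : ℕ → Ω → ℝ) (k : ℕ) : Ω → ℝ :=
  fun ω => X (2 * k) ω - (P[X (2 * k) | natFilt X (genOf k)]) ω

/-- `V_(2k+1) = X_(2k+1) - 𝔼[X_(2k+1) | ℱ_n]` for `k ∈ 𝔾_n`. -/
def VOdd (P : Measure Ω) (X : ℕ → Ω → ℝ) (k : ℕ) : Ω → ℝ :=
  fun ω => X (2 * k + 1) ω - (P[X (2 * k + 1) | natFilt X (genOf k)]) ω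

/-- The oracle `η_n`, built from the true residuals. -/
def etaOracle (P : Measure Ω) (X : ℕ → Ω → ℝ) (n : ℕ) (ω : Ω) : Fin 2 → ℝ :=
  wlsSecond (traj X ω) (fun k => VEven P X k ω ^ 2) n

/-- The oracle `ζ_n`, built from the true residuals. -/
def zetaOracle (P : Measure Ω) (X : ℕ → Ω → ℝ) (n : ℕ) (ω : Ω) : Fin 2 → ℝ :=
  wlsSecond (traj X ω) (fun k => VOdd P X k ω ^ 2) n

/-- The oracle `ν_n`, built from the true residuals. -/
def nuOracle (P : Measure Ω) (X : ℕ → Ω → ℝ) (n : ℕ) (ω : Ω) : Fin 2 → ℝ :=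
  wlsSecond (traj X ω) (fun k => VEven P X k ω * VOdd P X k ω) n

/-- `f` and `g` are conditionally independent given `m`. On standard Borel spaces this is
`ProbabilityTheory.CondIndepFun`, see
`ProbabilityTheory.condIndepFun_iff_condExp_inter_preimage_eq_mul`. -/
def CondIndepGiven {β γ : Type*} [MeasurableSpace β] [MeasurableSpace γ]
    (P : Measure Ω) (m : MeasurableSpace Ω) (f : Ω → β) (g : Ω → γ) : Prop :=
  ∀ (s : Set β) (t : Set γ), MeasurableSet s → MeasurableSet t →
    P⟦f ⁻¹' s ∩ g ⁻¹' t | m⟧ =ᵐ[P] fun ω => (P⟦f ⁻¹' s | m⟧) ω * (P⟦g ⁻¹' t | m⟧) ω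

/-- The first-order random coefficient bifurcating autoregressive process. Only the indices
`k ≥ 1` of `X`, `a`, `b` and `k ≥ 2` of `ε` matter. -/
structure IsRCBAR (P : Measure Ω) (X a b ε : ℕ → Ω → ℝ) : Prop where
  measurable_X : ∀ k, 1 ≤ k → Measurable (X k)
  measurable_a : ∀ k, 1 ≤ k → Measurable (a k)
  measurable_b : ∀ k, 1 ≤ k → Measurable (b k)
  measurable_ε : ∀ k, 2 ≤ k → Measurable (ε k)
  even : ∀ k, 1 ≤ k → ∀ ω, X (2 * k) ω = a k ω * X k ω + ε (2 * k) ω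
  odd : ∀ k, 1 ≤ k → ∀ ω, X (2 * k + 1) ω = b k ω * X k ω + ε (2 * k + 1) ω
  /-- `𝔼[X_1²] < ∞` -/
  ancestor : MemLp (X 1) 2 P
  /-- `(a_k, b_k)_{k ≥ 1}` is i.i.d. -/
  coef_indep : iIndepFun (fun (i : ℕ) ω => (a (i + 1) ω, b (i + 1) ω)) P
  coef_ident : ∀ k, 1 ≤ k →
    IdentDistrib (fun ω => (a k ω, b k ω)) (fun ω => (a 1 ω, b 1 ω)) P P
  /-- `(ε_(2k), ε_(2k+1))_{k ≥ 1}` is i.i.d. -/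
  noise_indep :
    iIndepFun (fun (i : ℕ) ω => (ε (2 * (i + 1)) ω, ε (2 * (i + 1) + 1) ω)) P
  noise_ident : ∀ k, 1 ≤ k →
    IdentDistrib (fun ω => (ε (2 * k) ω, ε (2 * k + 1) ω)) (fun ω => (ε 2 ω, ε 3 ω)) P P
  /-- the two sequences are independent -/
  coef_noise_indep :
    IndepFun (fun ω (i : ℕ) => (a (i + 1) ω, b (i + 1) ω))
      (fun ω (i : ℕ) => (ε (2 * (i + 1)) ω, ε (2 * (i + 1) + 1) ω)) P

/-- The conditional means given the past are the constants `a₀`, `b₀`, `c₀`, `d₀`. -/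
structure CondMeans (P : Measure Ω) (X a b ε : ℕ → Ω → ℝ) (a₀ b₀ c₀ d₀ : ℝ) : Prop where
  integrable_a : ∀ k, 1 ≤ k → Integrable (a k) P
  integrable_b : ∀ k, 1 ≤ k → Integrable (b k) P
  integrable_ε : ∀ k, 2 ≤ k → Integrable (ε k) P
  mean_a : ∀ n, ∀ k ∈ generation n, P[a k | natFilt X n] =ᵐ[P] fun _ => a₀
  mean_b : ∀ n, ∀ k ∈ generation n, P[b k | natFilt X n] =ᵐ[P] fun _ => b₀
  mean_c : ∀ n, ∀ k ∈ generation n, P[ε (2 * k) | natFilt X n] =ᵐ[P] fun _ => c₀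
  mean_d : ∀ n, ∀ k ∈ generation n, P[ε (2 * k + 1) | natFilt X n] =ᵐ[P] fun _ => d₀

/-- (H.1) -/
structure H1 (P : Measure Ω) (a b : ℕ → Ω → ℝ) : Prop where
  memLp_a : ∀ k, 1 ≤ k → MemLp (a k) 2 P
  memLp_b : ∀ k, 1 ≤ k → MemLp (b k) 2 P
  sq_a : ∀ k, 1 ≤ k → ∫ ω, a k ω ^ 2 ∂P < 1
  sq_b : ∀ k, 1 ≤ k → ∫ ω, b k ω ^ 2 ∂P < 1

/-- (H.2), with `σa, σb, σc, σd` the standard deviations. -/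
structure H2 (P : Measure Ω) (X a b ε : ℕ → Ω → ℝ) (σa σb σc σd : ℝ) : Prop where
  memLp_ε : ∀ k, 2 ≤ k → MemLp (ε k) 2 P
  var_a : ∀ n, ∀ k ∈ generation n, Var[a k; P | natFilt X n] =ᵐ[P] fun _ => σa ^ 2
  var_b : ∀ n, ∀ k ∈ generation n, Var[b k; P | natFilt X n] =ᵐ[P] fun _ => σb ^ 2
  var_c : ∀ n, ∀ k ∈ generation n,
    Var[ε (2 * k); P | natFilt X n] =ᵐ[P] fun _ => σc ^ 2
  var_d : ∀ n, ∀ k ∈ generation n,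
    Var[ε (2 * k + 1); P | natFilt X n] =ᵐ[P] fun _ => σd ^ 2
  pos_c : 0 < σc ^ 2
  pos_d : 0 < σd ^ 2

/-- (H.3) -/
structure H3 (P : Measure Ω) (X a b ε : ℕ → Ω → ℝ) (a₀ b₀ c₀ d₀ σa σb σc σd ρab ρcd : ℝ) :
    Prop where
  condIndep_ε : ∀ n, ∀ k ∈ generation (n + 1), ∀ l ∈ generation (n + 1), k / 2 ≠ l / 2 →
    CondIndepGiven P (natFilt X n) (ε k) (ε l)
  condIndep_ab : ∀ n, ∀ k ∈ generation n, ∀ l ∈ generation n, k ≠ l →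
    CondIndepGiven P (natFilt X n) (fun ω => (a k ω, b k ω)) (fun ω => (a l ω, b l ω))
  rho_cd_lt : ρcd ^ 2 < σc ^ 2 * σd ^ 2
  rho_ab_le : ρab ^ 2 ≤ σa ^ 2 * σb ^ 2
  cov_cd : ∀ n, ∀ k ∈ generation n,
    P[fun ω => (ε (2 * k) ω - c₀) * (ε (2 * k + 1) ω - d₀) | natFilt X n] =ᵐ[P] fun _ => ρcd
  cov_ab : ∀ n, ∀ k ∈ generation n,
    P[fun ω => (a k ω - a₀) * (b k ω - b₀) | natFilt X n] =ᵐ[P] fun _ => ρab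

/-- (H.4); `νab` and `νcd` enter through their squares, the mixed fourth-order moments. -/
structure H4 (P : Measure Ω) (X a b ε : ℕ → Ω → ℝ) (a₀ b₀ c₀ d₀ σa σb σc σd ρab ρcd : ℝ) :
    Prop where
  memLp_a : ∀ k, 1 ≤ k → MemLp (a k) 4 P
  memLp_b : ∀ k, 1 ≤ k → MemLp (b k) 4 P
  memLp_ε : ∀ k, 2 ≤ k → MemLp (ε k) 4 P
  fourth_a : ∃ μa : ℝ, σa ^ 4 ≤ μa ^ 4 ∧ ∀ n, ∀ k ∈ generation n,
    P[fun ω => (a k ω - a₀) ^ 4 | natFilt X n] =ᵐ[P] fun _ => μa ^ 4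
  fourth_b : ∃ μb : ℝ, σb ^ 4 ≤ μb ^ 4 ∧ ∀ n, ∀ k ∈ generation n,
    P[fun ω => (b k ω - b₀) ^ 4 | natFilt X n] =ᵐ[P] fun _ => μb ^ 4
  fourth_c : ∃ μc : ℝ, σc ^ 4 < μc ^ 4 ∧ ∀ n, ∀ k ∈ generation n,
    P[fun ω => (ε (2 * k) ω - c₀) ^ 4 | natFilt X n] =ᵐ[P] fun _ => μc ^ 4
  fourth_d : ∃ μd : ℝ, σd ^ 4 < μd ^ 4 ∧ ∀ n, ∀ k ∈ generation n,
    P[fun ω => (ε (2 * k + 1) ω - d₀) ^ 4 | natFilt X n] =ᵐ[P] fun _ => μd ^ 4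
  nondeg_even : ∀ k, 1 ≤ k →
    (∫ ω, ε (2 * k) ω ^ 2 ∂P) ^ 2 < ∫ ω, ε (2 * k) ω ^ 4 ∂P
  nondeg_odd : ∀ k, 1 ≤ k →
    (∫ ω, ε (2 * k + 1) ω ^ 2 ∂P) ^ 2 < ∫ ω, ε (2 * k + 1) ω ^ 4 ∂P
  mixed_ab : ∃ νab : ℝ, ρab ^ 2 ≤ νab ^ 2 ∧ ∀ n, ∀ k ∈ generation n,
    P[fun ω => (a k ω - a₀) ^ 2 * (b k ω - b₀) ^ 2 | natFilt X n] =ᵐ[P] fun _ => νab ^ 2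
  mixed_cd : ∃ νcd : ℝ, ρcd ^ 2 < νcd ^ 2 ∧ ∀ n, ∀ k ∈ generation n,
    P[fun ω => (ε (2 * k) ω - c₀) ^ 2 * (ε (2 * k + 1) ω - d₀) ^ 2 | natFilt X n]
      =ᵐ[P] fun _ => νcd ^ 2

/-- (H.5); the conditional expectations are those of `[0, ∞]`-valued variables. -/
def H5 (P : Measure Ω) (X a b ε : ℕ → Ω → ℝ) (a₀ b₀ c₀ d₀ : ℝ) : Prop :=
  ∃ α : ℝ, 4 < α ∧
    (∀ᵐ ω ∂P, ⨆ n, ⨆ k ∈ generation n,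
      (P⁻[fun ω' => ENNReal.ofReal (|a k ω' - a₀| ^ α) | natFilt X n]) ω < ∞) ∧
    (∀ᵐ ω ∂P, ⨆ n, ⨆ k ∈ generation n,
      (P⁻[fun ω' => ENNReal.ofReal (|b k ω' - b₀| ^ α) | natFilt X n]) ω < ∞) ∧
    (∀ᵐ ω ∂P, ⨆ n, ⨆ k ∈ generation n,
      (P⁻[fun ω' => ENNReal.ofReal (|ε (2 * k) ω' - c₀| ^ α) | natFilt X n]) ω < ∞) ∧
    (∀ᵐ ω ∂P, ⨆ n, ⨆ k ∈ generation n,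
      (P⁻[fun ω' => ENNReal.ofReal (|ε (2 * k + 1) ω' - d₀| ^ α) | natFilt X n]) ω < ∞)

/-- `u_n = 𝒪(n / |𝕋_(n-1)|)` in the Euclidean norm. -/
def HasTreeRate (u : ℕ → Fin 2 → ℝ) : Prop :=
  (fun n => ‖WithLp.toLp 2 (u n)‖) =O[atTop]
    fun n : ℕ => (n : ℝ) / ((treeBefore n).card : ℝ)

end

end RCBAR

namespace RCBAR

/-! ## Almost sure summability and square-integrable martingale differences -/

section Innovations

variable {Ω : Type*} [mΩ : MeasurableSpace Ω] {P : Measure Ω}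

/-! The pairs of coefficients and noises are i.i.d. innovations `U k`, and the tree is explored one
individual at a time, so generation sums of predictable weights times centred functions of `U k` are
martingale sums. The ancestor is not assumed independent of the innovations. But a trajectory is
affine in its starting point, `X k = flow k + X 1 * slope k`, and every almost sure statement is
proved on one event valid for all real starting points, into which the random value `X 1 ω` is then
inserted.

Three probabilistic facts suffice. (1) If `D l` is the sum over generation `l` of `wt p (x k) * φ (U
k)` with `φ` centred, then `∑_{l<n} D l ^ 2 / 2 ^ l = O(n)`. From the start `0` this is a martingale
estimate (`IsInnovation.ae_sum_sq_le`); it passes to all starts by an `L²` bound on the derivative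
in the start, which is small because slopes decay geometrically in mean square
(`IsContractive.ae_sum_sq_path_le`). (2) Generation averages of `|x k|` stay bounded
(`IsContractive.ae_sum_abs_path_le`). (3) A bounded Lipschitz `q` summed over generation `n + 1`
equals its transfer summed over generation `n`, up to `o(2 ^ n)`
(`IsContractive.ae_transfer_tendsto`). The transfer of the Gram form, applied twice, is strictly
positive; with (2) and (3) the Gram matrices are at least of order `2 ^ n`
(`IsNondegenerate.ae_gramForm_ge`).

The rest is deterministic. By (1) the first-stage errors `δ l` satisfy `∑_{l<n} 2 ^ l * δ l ^ 2 =
O(n)`. Replacing true residuals by estimated ones costs terms `2 ^ l * δ l ^ 2` and `|δ l| * |D l|`,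
hence `O(n)` over the tree. Division by a Gram matrix of order `2 ^ n` gives the rate. Consistency
follows because products of true residuals, minus their conditional means `β 0 * x ^ 2 + β 1`, again
obey (1). -/

theorem ae_summable_of_summable_integral {Z : ℕ → Ω → ℝ} (h0 : ∀ n ω, 0 ≤ Z n ω)
    (hint : ∀ n, Integrable (Z n) P) (hs : Summable fun n => ∫ ω, Z n ω ∂P) :
    ∀ᵐ ω ∂P, Summable fun n => Z n ω := by
  have h1 : ∫⁻ ω, ∑' n, ENNReal.ofReal (Z n ω) ∂P ≠ ∞ := by
    rw [lintegral_tsum fun n => (hint n).1.aemeasurable.ennreal_ofReal]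
    simp_rw [← ofReal_integral_eq_lintegral_ofReal (hint _) (ae_of_all _ (h0 _))]
    exact hs.tsum_ofReal_ne_top
  have h2 := ae_lt_top' (AEMeasurable.tsum
    fun n => (hint n).1.aemeasurable.ennreal_ofReal) h1
  filter_upwards [h2] with ω hω
  have := ENNReal.summable_toReal hω.ne
  simpa [ENNReal.toReal_ofReal (h0 _ _)] using this

theorem ae_tendsto_zero_of_summable_sq {W : ℕ → Ω → ℝ}
    (hL : ∀ n, MemLp (W n) 2 P) (hs : Summable fun n => ∫ ω, W n ω ^ 2 ∂P) :
    ∀ᵐ ω ∂P, Tendsto (fun n => W n ω) atTop (𝓝 0) := by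
  filter_upwards [ae_summable_of_summable_integral (fun n ω => sq_nonneg (W n ω))
    (fun n => (hL n).integrable_sq) hs] with ω hω
  have h := hω.tendsto_atTop_zero
  rw [tendsto_zero_iff_abs_tendsto_zero]
  have h2 := h.sqrt
  simpa [Real.sqrt_sq_eq_abs, Function.comp_def] using h2

/-- `U_k`, `k ≥ 1`, are identically distributed, and `U_k` is independent of the past `ℋ_k` which
contains the `U_j`, `1 ≤ j < k`. -/
structure IsInnovation {E : Type*} [mE : MeasurableSpace E] (P : Measure Ω)
    (ℋ : ℕ → MeasurableSpace Ω) (U : ℕ → Ω → E) : Prop where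
  mono : Monotone ℋ
  le : ∀ k, ℋ k ≤ mΩ
  meas : ∀ k, 1 ≤ k → Measurable[ℋ (k + 1)] (U k)
  indep : ∀ k, 1 ≤ k → Indep (ℋ k) (mE.comap (U k)) P
  ident : ∀ k, 1 ≤ k → IdentDistrib (U k) (U 1) P P

/-- Square-integrable martingale differences, indexed by `k ≥ 1`. -/
structure IsMartingaleDiff (P : Measure Ω) (ℋ : ℕ → MeasurableSpace Ω) (ζ : ℕ → Ω → ℝ) :
    Prop where
  meas : ∀ k, 1 ≤ k → Measurable[ℋ (k + 1)] (ζ k)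
  memLp : ∀ k, 1 ≤ k → MemLp (ζ k) 2 P
  orth : ∀ k, 1 ≤ k → ∀ G : Ω → ℝ, Measurable[ℋ k] G → MemLp G 2 P →
    ∫ ω, G ω * ζ k ω ∂P = 0

/-- Peeling off the largest index `k`, the remaining sum is measurable with respect to `ℋ k`, so
`orth` removes the cross term. -/
theorem IsMartingaleDiff.integral_sq_sum {ℋ : ℕ → MeasurableSpace Ω} {ζ : ℕ → Ω → ℝ}
    (hm : Monotone ℋ) (hζ : IsMartingaleDiff P ℋ ζ) (s : Finset ℕ)
    (hs : ∀ k ∈ s, 1 ≤ k) :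
    ∫ ω, (∑ k ∈ s, ζ k ω) ^ 2 ∂P = ∑ k ∈ s, ∫ ω, ζ k ω ^ 2 ∂P := by
  induction s using Finset.induction_on_max with
  | empty => simp
  | insert k s hk ih =>
    have hks : k ∉ s := fun h => lt_irrefl _ (hk k h)
    have hs' : ∀ j ∈ s, 1 ≤ j := fun j hj => hs j (Finset.mem_insert_of_mem hj)
    have hk1 : 1 ≤ k := hs k (Finset.mem_insert_self _ _)
    have hS : MemLp (fun ω => ∑ j ∈ s, ζ j ω) 2 P :=
      memLp_finsetSum _ fun j hj => hζ.memLp j (hs' j hj)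
    have hSm : Measurable[ℋ k] fun ω => ∑ j ∈ s, ζ j ω :=
      Finset.measurable_fun_sum _ fun j hj =>
        (hζ.meas j (hs' j hj)).mono (hm (hk j hj)) le_rfl
    have hz := hζ.memLp k hk1
    have hi : Integrable (fun ω => (∑ j ∈ s, ζ j ω) * ζ k ω) P := hS.integrable_mul hz
    rw [Finset.sum_insert hks, ← ih hs']
    have e : ∀ ω, (∑ j ∈ insert k s, ζ j ω) ^ 2
        = ζ k ω ^ 2 + (2 * ((∑ j ∈ s, ζ j ω) * ζ k ω) + (∑ j ∈ s, ζ j ω) ^ 2) := fun ω => by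
      rw [Finset.sum_insert hks]; ring
    simp_rw [e]
    have hadd : Integrable
        (fun ω => 2 * ((∑ j ∈ s, ζ j ω) * ζ k ω) + (∑ j ∈ s, ζ j ω) ^ 2) P :=
      (hi.const_mul 2).add hS.integrable_sq
    rw [integral_add hz.integrable_sq hadd,
      integral_add (hi.const_mul 2) hS.integrable_sq, integral_const_mul,
      hζ.orth k hk1 _ hSm hS]
    ring

theorem IsMartingaleDiff.memLp_sum {ℋ : ℕ → MeasurableSpace Ω} {ζ : ℕ → Ω → ℝ}
    (hζ : IsMartingaleDiff P ℋ ζ) (s : Finset ℕ) (hs : ∀ k ∈ s, 1 ≤ k) :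
    MemLp (fun ω => ∑ k ∈ s, ζ k ω) 2 P :=
  memLp_finsetSum _ fun j hj => hζ.memLp j (hs j hj)

variable {E : Type*} [MeasurableSpace E] {ℋ : ℕ → MeasurableSpace Ω} {U : ℕ → Ω → E}

theorem IsInnovation.measurable (hU : IsInnovation P ℋ U) {k : ℕ} (hk : 1 ≤ k) :
    Measurable (U k) :=
  (hU.meas k hk).mono (hU.le _) le_rfl

theorem IsInnovation.indepFun (hU : IsInnovation P ℋ U) {k : ℕ} (hk : 1 ≤ k)
    {F : Type*} [MeasurableSpace F] {G : Ω → F} (hG : Measurable[ℋ k] G) :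
    IndepFun G (U k) P := by
  rw [IndepFun_iff_Indep]
  exact indep_of_indep_of_le_left (hU.indep k hk) hG.comap_le

theorem IsInnovation.integral_mul (hU : IsInnovation P ℋ U) {k : ℕ} (hk : 1 ≤ k)
    {G : Ω → ℝ} (hG : Measurable[ℋ k] G) {φ : E → ℝ} (hφ : Measurable φ) :
    ∫ ω, G ω * φ (U k ω) ∂P = (∫ ω, G ω ∂P) * ∫ ω, φ (U 1 ω) ∂P := by
  have h := (hU.indepFun hk hG).comp measurable_id hφ
  have h2 := h.integral_fun_mul_eq_mul_integral
    (hG.mono (hU.le _) le_rfl).aestronglyMeasurable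
    (hφ.comp (hU.measurable hk)).aestronglyMeasurable
  simp only [Function.comp_apply, id] at h2
  rw [h2]
  congr 1
  exact ((hU.ident k hk).comp hφ).integral_eq

theorem IsInnovation.integrable_mul (hU : IsInnovation P ℋ U) {k : ℕ} (hk : 1 ≤ k)
    {G : Ω → ℝ} (hG : Measurable[ℋ k] G) (hGi : Integrable G P) {φ : E → ℝ} (hφ : Measurable φ)
    (hφi : Integrable (fun ω => φ (U 1 ω)) P) :
    Integrable (fun ω => G ω * φ (U k ω)) P := by
  have h := (hU.indepFun hk hG).comp measurable_id hφ
  exact h.integrable_mul hGi (((hU.ident k hk).comp hφ).integrable_iff.2 hφi)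

theorem IsInnovation.memLp_mul (hU : IsInnovation P ℋ U) {k : ℕ} (hk : 1 ≤ k)
    {G : Ω → ℝ} (hG : Measurable[ℋ k] G) (hGi : MemLp G 2 P) {φ : E → ℝ} (hφ : Measurable φ)
    (hφi : MemLp (fun ω => φ (U 1 ω)) 2 P) :
    MemLp (fun ω => G ω * φ (U k ω)) 2 P := by
  rw [memLp_two_iff_integrable_sq]
  · simp_rw [mul_pow]
    exact hU.integrable_mul hk (hG.pow_const 2) hGi.integrable_sq (hφ.pow_const 2)
      hφi.integrable_sq
  · exact ((hG.mono (hU.le _) le_rfl).mul (hφ.comp (hU.measurable hk))).aestronglyMeasurable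

theorem IsInnovation.integral_sq_mul (hU : IsInnovation P ℋ U) {k : ℕ} (hk : 1 ≤ k)
    {G : Ω → ℝ} (hG : Measurable[ℋ k] G) {φ : E → ℝ} (hφ : Measurable φ) :
    ∫ ω, (G ω * φ (U k ω)) ^ 2 ∂P = (∫ ω, G ω ^ 2 ∂P) * ∫ ω, φ (U 1 ω) ^ 2 ∂P := by
  simp_rw [mul_pow]
  exact hU.integral_mul hk (hG.pow_const 2) (hφ.pow_const 2)

/-- A predictable sequence times centred functions of the innovations. -/
theorem IsInnovation.isMartingaleDiff_mul (hU : IsInnovation P ℋ U) {φ : E → ℝ}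
    (hφ : Measurable φ) (hφi : MemLp (fun ω => φ (U 1 ω)) 2 P)
    (hφ0 : ∫ ω, φ (U 1 ω) ∂P = 0) {w : ℕ → Ω → ℝ}
    (hw : ∀ k, 1 ≤ k → Measurable[ℋ k] (w k)) (hwi : ∀ k, 1 ≤ k → MemLp (w k) 2 P) :
    IsMartingaleDiff P ℋ fun k ω => w k ω * φ (U k ω) where
  meas k hk := ((hw k hk).mono (hU.mono k.le_succ) le_rfl).mul (hφ.comp (hU.meas k hk))
  memLp k hk := hU.memLp_mul hk (hw k hk) (hwi k hk) hφ hφi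
  orth k hk G hG _ := by
    simp_rw [← mul_assoc]
    exact (hU.integral_mul hk (hG.mul (hw k hk)) hφ).trans (by rw [hφ0, mul_zero])

/-- Bounded functions of a predictable sequence and the innovations, centred conditionally on the
past. -/
theorem IsInnovation.isMartingaleDiff_comp [IsProbabilityMeasure P] (hU : IsInnovation P ℋ U)
    {F : ℝ → E → ℝ} (hF : Measurable (Function.uncurry F)) {B : ℝ} (hB : ∀ y u, |F y u| ≤ B)
    {w : ℕ → Ω → ℝ} (hw : ∀ k, 1 ≤ k → Measurable[ℋ k] (w k)) :
    IsMartingaleDiff P ℋ fun k ω => F (w k ω) (U k ω) - ∫ ω', F (w k ω) (U 1 ω') ∂P := by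
  have hU1 := hU.measurable (le_refl 1)
  set T : ℝ → ℝ := fun y => ∫ ω', F y (U 1 ω') ∂P with hT
  have hTm : Measurable T := by
    have : StronglyMeasurable (Function.uncurry fun y ω' => F y (U 1 ω')) :=
      (hF.comp (measurable_fst.prodMk (hU1.comp measurable_snd))).stronglyMeasurable
    exact this.integral_prod_right.measurable
  have hTb : ∀ y, |T y| ≤ B := fun y => by
    have := norm_integral_le_of_norm_le_const (μ := P) (f := fun ω' => F y (U 1 ω')) (C := B)
      (ae_of_all _ fun ω' => hB _ _)
    simpa using this
  have hm : ∀ k, 1 ≤ k → Measurable[ℋ (k + 1)] fun ω => F (w k ω) (U k ω) - T (w k ω) :=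
    fun k hk => by
      have hw' := (hw k hk).mono (hU.mono k.le_succ) le_rfl
      exact (hF.comp (hw'.prodMk (hU.meas k hk))).sub (hTm.comp hw')
  refine ⟨hm, fun k hk => ?_, fun k hk G hG hGi => ?_⟩
  · refine MemLp.of_bound ((hm k hk).mono (hU.le _) le_rfl).aestronglyMeasurable (B + B)
      (ae_of_all _ fun ω => ?_)
    exact (norm_sub_le _ _).trans (add_le_add (hB _ _) (hTb _))
  · have hG' := hG.mono (hU.le _) le_rfl
    have hw' := (hw k hk).mono (hU.le _) le_rfl
    have hUk := hU.measurable hk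
    have hGI : Integrable G P := hGi.integrable (by norm_num)
    have i1 : Integrable (fun ω => G ω * F (w k ω) (U k ω)) P :=
      hGI.mul_bdd (c := B) (hF.comp (hw'.prodMk hUk)).aestronglyMeasurable
        (ae_of_all _ fun ω => hB _ _)
    have i2 : Integrable (fun ω => G ω * T (w k ω)) P :=
      hGI.mul_bdd (c := B) (hTm.comp hw').aestronglyMeasurable
        (ae_of_all _ fun ω => hTb _)
    simp_rw [mul_sub]
    rw [integral_sub i1 i2, sub_eq_zero]
    -- The pair `(G, w k)` is independent of `U k`, so the joint law is a product; Fubini then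
    -- integrates `U k` out under the law of `U 1`.
    have hpair : Measurable[ℋ k] fun ω => (G ω, w k ω) := hG.prodMk (hw k hk)
    have hind := hU.indepFun hk hpair
    have hmap := hind.map_prod_eq_prod_map_map (hpair.mono (hU.le _) le_rfl).aemeasurable
      hUk.aemeasurable
    rw [(hU.ident k hk).map_eq] at hmap
    have hprob : IsProbabilityMeasure (P.map (U 1)) :=
      Measure.isProbabilityMeasure_map hU1.aemeasurable
    have hpair' := hpair.mono (hU.le _) le_rfl
    have hKm : Measurable fun z : (ℝ × ℝ) × E => z.1.1 * F z.1.2 z.2 :=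
      (measurable_fst.comp measurable_fst).mul
        (hF.comp ((measurable_snd.comp measurable_fst).prodMk measurable_snd))
    have e1 : ∫ ω, G ω * F (w k ω) (U k ω) ∂P
        = ∫ z, z.1.1 * F z.1.2 z.2 ∂(P.map fun ω => ((G ω, w k ω), U k ω)) := by
      rw [integral_map (hpair'.prodMk hUk).aemeasurable hKm.aestronglyMeasurable]
    have hKi : Integrable (fun z : (ℝ × ℝ) × E => z.1.1 * F z.1.2 z.2)
        ((P.map fun ω => (G ω, w k ω)).prod (P.map (U 1))) := by
      rw [← hmap, integrable_map_measure hKm.aestronglyMeasurable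
        (hpair'.prodMk hUk).aemeasurable]
      exact i1
    rw [e1, hmap, integral_prod _ hKi, integral_map hpair'.aemeasurable
      hKi.1.integral_prod_right']
    refine integral_congr_ae (ae_of_all _ fun ω => ?_)
    simp only [integral_const_mul]
    rw [integral_map hU1.aemeasurable]
    exact (hF.comp (measurable_const.prodMk measurable_id)).aestronglyMeasurable

end Innovations

/-! ## Sums over the binary tree -/

section Tree

theorem mem_generation {n k : ℕ} : k ∈ generation n ↔ 2 ^ n ≤ k ∧ k < 2 ^ (n + 1) :=
  Finset.mem_Ico

theorem one_le_of_mem_generation {n k : ℕ} (h : k ∈ generation n) : 1 ≤ k :=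
  Nat.one_le_two_pow.trans (mem_generation.1 h).1

theorem genOf_of_mem {n k : ℕ} (h : k ∈ generation n) : genOf k = n :=
  Nat.log_eq_of_pow_le_of_lt_pow (mem_generation.1 h).1 (mem_generation.1 h).2

theorem mem_generation_genOf {k : ℕ} (h : 1 ≤ k) : k ∈ generation (genOf k) :=
  mem_generation.2 ⟨Nat.pow_log_le_self 2 (by omega), Nat.lt_pow_succ_log_self (by norm_num) k⟩

theorem card_generation (n : ℕ) : (generation n).card = 2 ^ n := by
  simp [generation, pow_succ, mul_two]

theorem treeBefore_eq (n : ℕ) : treeBefore n = Finset.Ico 1 (2 ^ n) := by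
  induction n with
  | zero => rfl
  | succ n ih =>
    have h : treeBefore (n + 1) = generation n ∪ treeBefore n := by
      simp [treeBefore, Finset.range_add_one, Finset.biUnion_insert]
    rw [h, ih, generation, Finset.union_comm,
      Finset.Ico_union_Ico_eq_Ico Nat.one_le_two_pow (Nat.pow_le_pow_right (by norm_num) n.le_succ)]

theorem card_treeBefore (n : ℕ) : (treeBefore n).card = 2 ^ n - 1 := by
  simp [treeBefore_eq]

theorem one_le_of_mem_treeBefore {n k : ℕ} (h : k ∈ treeBefore n) : 1 ≤ k := by
  rw [treeBefore_eq] at h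
  exact (Finset.mem_Ico.1 h).1

theorem sum_treeBefore {M : Type*} [AddCommMonoid M] (g : ℕ → M) (n : ℕ) :
    ∑ k ∈ treeBefore n, g k = ∑ l ∈ Finset.range n, ∑ k ∈ generation l, g k := by
  refine Finset.sum_biUnion fun i _ j _ hij => ?_
  refine Finset.disjoint_left.2 fun k hi hj => hij ?_
  rw [← genOf_of_mem hi, ← genOf_of_mem hj]

theorem sum_generation_succ (g : ℕ → ℝ) (n : ℕ) :
    ∑ k ∈ generation (n + 1), g k = ∑ k ∈ generation n, (g (2 * k) + g (2 * k + 1)) := by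
  have key : ∀ s t : ℕ, s ≤ t →
      ∑ k ∈ Finset.Ico (2 * s) (2 * t), g k = ∑ k ∈ Finset.Ico s t, (g (2 * k) + g (2 * k + 1)) := by
    intro s t hst
    induction t, hst using Nat.le_induction with
    | base => simp
    | succ t ht ih =>
      rw [Finset.sum_Ico_succ_top ht, ← ih, show 2 * (t + 1) = 2 * t + 1 + 1 by ring,
        Finset.sum_Ico_succ_top (by omega), Finset.sum_Ico_succ_top (by omega), add_assoc]
  have h := key (2 ^ n) (2 ^ (n + 1)) (Nat.pow_le_pow_right (by norm_num) n.le_succ)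
  rw [generation, generation, ← h]
  congr 2 <;> ring

theorem tree_induction {p : ∀ k : ℕ, 1 ≤ k → Prop} (h1 : p 1 le_rfl)
    (h2 : ∀ k hk, p k hk → p (2 * k) (by omega))
    (h3 : ∀ k hk, p k hk → p (2 * k + 1) (by omega)) : ∀ k hk, p k hk := by
  intro k
  induction k using Nat.strong_induction_on with
  | _ k ih =>
    intro hk
    rcases Nat.lt_or_ge k 2 with h | h
    · obtain rfl : k = 1 := by omega
      exact h1
    · rcases Nat.even_or_odd' k with ⟨j, rfl | rfl⟩
      · exact h2 j (by omega) (ih j (by omega) (by omega))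
      · exact h3 j (by omega) (ih j (by omega) (by omega))

theorem genOf_two_mul {k : ℕ} (hk : 1 ≤ k) : genOf (2 * k) = genOf k + 1 := by
  rw [genOf, mul_comm, Nat.log_mul_base (by norm_num) (by omega), genOf]

theorem genOf_two_mul_add_one {k : ℕ} (hk : 1 ≤ k) : genOf (2 * k + 1) = genOf k + 1 := by
  have h := mem_generation.1 (mem_generation_genOf hk)
  refine genOf_of_mem (mem_generation.2 ⟨?_, ?_⟩) <;> rw [pow_succ] <;> omega

/-- The two-parameter family of innovations: coefficients and noises. -/
abbrev Innov : Type := (ℝ × ℝ) × (ℝ × ℝ)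

/-- The trajectory driven by the innovations `U` and started from `x₀`. -/
def flow (U : ℕ → Innov) (x₀ : ℝ) : ℕ → ℝ
  | 0 => 0
  | 1 => x₀
  | (k + 2) =>
    if (k + 2) % 2 = 0 then
      (U ((k + 2) / 2)).1.1 * flow U x₀ ((k + 2) / 2) + (U ((k + 2) / 2)).2.1
    else (U ((k + 2) / 2)).1.2 * flow U x₀ ((k + 2) / 2) + (U ((k + 2) / 2)).2.2
  decreasing_by all_goals omega

theorem flow_one (U : ℕ → Innov) (x₀ : ℝ) : flow U x₀ 1 = x₀ := by rw [flow]

theorem flow_even (U : ℕ → Innov) (x₀ : ℝ) {k : ℕ} (hk : 1 ≤ k) :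
    flow U x₀ (2 * k) = (U k).1.1 * flow U x₀ k + (U k).2.1 := by
  obtain ⟨j, rfl⟩ := Nat.exists_eq_add_of_le' hk
  rw [show 2 * (j + 1) = 2 * j + 2 by ring, flow, if_pos (by omega),
    show (2 * j + 2) / 2 = j + 1 by omega]

theorem flow_odd (U : ℕ → Innov) (x₀ : ℝ) {k : ℕ} (hk : 1 ≤ k) :
    flow U x₀ (2 * k + 1) = (U k).1.2 * flow U x₀ k + (U k).2.2 := by
  obtain ⟨j, rfl⟩ := Nat.exists_eq_add_of_le' hk
  rw [show 2 * (j + 1) + 1 = (2 * j + 1) + 2 by ring, flow, if_neg (by omega),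
    show (2 * j + 1 + 2) / 2 = j + 1 by omega]

/-- The derivative of the trajectory with respect to its starting point. -/
def slope (U : ℕ → Innov) : ℕ → ℝ := flow (fun k => ((U k).1, 0)) 1

theorem slope_even (U : ℕ → Innov) {k : ℕ} (hk : 1 ≤ k) :
    slope U (2 * k) = (U k).1.1 * slope U k := by
  simp [slope, flow_even _ _ hk]

theorem slope_odd (U : ℕ → Innov) {k : ℕ} (hk : 1 ≤ k) :
    slope U (2 * k + 1) = (U k).1.2 * slope U k := by
  simp [slope, flow_odd _ _ hk]

/-- The recursion is affine in the root value. This isolates `x 1`, the only ingredient that may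
depend on the innovations. -/
theorem eq_flow_add_slope {U : ℕ → Innov} {x : ℕ → ℝ}
    (he : ∀ k, 1 ≤ k → x (2 * k) = (U k).1.1 * x k + (U k).2.1)
    (ho : ∀ k, 1 ≤ k → x (2 * k + 1) = (U k).1.2 * x k + (U k).2.2) {k : ℕ} (hk : 1 ≤ k) :
    x k = flow U 0 k + x 1 * slope U k := by
  induction k, hk using tree_induction with
  | h1 => simp [flow_one, slope]
  | h2 k hk ih => rw [he k hk, flow_even _ _ hk, slope_even _ hk, ih]; ring
  | h3 k hk ih => rw [ho k hk, flow_odd _ _ hk, slope_odd _ hk, ih]; ring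

end Tree

/-! ## Moments of the trajectories -/

section Moments

variable {Ω : Type*} [mΩ : MeasurableSpace Ω] {P : Measure Ω}

theorem IsInnovation.map {E F : Type*} [MeasurableSpace E] [MeasurableSpace F]
    {ℋ : ℕ → MeasurableSpace Ω} {U : ℕ → Ω → E} (hU : IsInnovation P ℋ U) {ψ : E → F}
    (hψ : Measurable ψ) : IsInnovation P ℋ fun k ω => ψ (U k ω) where
  mono := hU.mono
  le := hU.le
  meas k hk := hψ.comp (hU.meas k hk)
  indep k hk := indep_of_indep_of_le_right (hU.indep k hk)
    (Measurable.comap_le (hψ.comp (comap_measurable (U k))))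
  ident k hk := (hU.ident k hk).comp hψ

variable {ℋ : ℕ → MeasurableSpace Ω} {U : ℕ → Ω → Innov}

theorem IsInnovation.measurable_flow (hU : IsInnovation P ℋ U) (x₀ : ℝ) {k : ℕ} (hk : 1 ≤ k) :
    Measurable[ℋ k] fun ω => flow (fun j => U j ω) x₀ k := by
  induction k, hk using tree_induction with
  | h1 => simp_rw [flow_one]; exact measurable_const
  | h2 k hk ih =>
    simp_rw [flow_even _ _ hk]
    have h1 := (hU.meas k hk).mono (hU.mono (show k + 1 ≤ 2 * k by omega)) le_rfl
    exact (h1.fst.fst.mul (ih.mono (hU.mono (by omega)) le_rfl)).add h1.snd.fst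
  | h3 k hk ih =>
    simp_rw [flow_odd _ _ hk]
    have h1 := (hU.meas k hk).mono (hU.mono (show k + 1 ≤ 2 * k + 1 by omega)) le_rfl
    exact (h1.fst.snd.mul (ih.mono (hU.mono (by omega)) le_rfl)).add h1.snd.snd

theorem measurable_linearPart :
    Measurable fun u : Innov => ((u.1, 0) : Innov) :=
  measurable_fst.prodMk measurable_const

theorem IsInnovation.measurable_slope (hU : IsInnovation P ℋ U) {k : ℕ} (hk : 1 ≤ k) :
    Measurable[ℋ k] fun ω => slope (fun j => U j ω) k :=
  (hU.map measurable_linearPart).measurable_flow 1 hk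

/-- Square-integrable innovations whose coefficients are contractions in mean square. -/
structure IsContractive (P : Measure Ω) (ℋ : ℕ → MeasurableSpace Ω) (U : ℕ → Ω → Innov)
    (m : ℝ) : Prop extends IsInnovation P ℋ U where
  m_pos : 0 < m
  m_lt : m < 1
  memLp_a : MemLp (fun ω => (U 1 ω).1.1) 2 P
  memLp_b : MemLp (fun ω => (U 1 ω).1.2) 2 P
  memLp_c : MemLp (fun ω => (U 1 ω).2.1) 2 P
  memLp_d : MemLp (fun ω => (U 1 ω).2.2) 2 P
  sq_a : ∫ ω, (U 1 ω).1.1 ^ 2 ∂P ≤ m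
  sq_b : ∫ ω, (U 1 ω).1.2 ^ 2 ∂P ≤ m

variable {m : ℝ}

/-- Young's inequality `(x + y)² ≤ (1 + δ) x² + (1 + δ⁻¹) y²` absorbs the cross term, so the noise
need not be centred; `δ` is left free so that `(1 + δ) * m` can be kept below `1`. -/
theorem integral_sq_child_le (hU : IsInnovation P ℋ U) {α β : Innov → ℝ} (hα : Measurable α)
    (hβ : Measurable β) (hαi : MemLp (fun ω => α (U 1 ω)) 2 P)
    (hβi : MemLp (fun ω => β (U 1 ω)) 2 P) (hm : ∫ ω, α (U 1 ω) ^ 2 ∂P ≤ m)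
    {δ : ℝ} (hδ : 0 < δ) {k : ℕ} (hk : 1 ≤ k) {Y : Ω → ℝ} (hY : Measurable[ℋ k] Y)
    (hYi : MemLp Y 2 P) :
    MemLp (fun ω => α (U k ω) * Y ω + β (U k ω)) 2 P ∧
    ∫ ω, (α (U k ω) * Y ω + β (U k ω)) ^ 2 ∂P ≤
      (1 + δ) * m * ∫ ω, Y ω ^ 2 ∂P + (1 + δ⁻¹) * ∫ ω, β (U 1 ω) ^ 2 ∂P := by
  have hβk : MemLp (fun ω => β (U k ω)) 2 P :=
    ((hU.ident k hk).comp hβ).memLp_iff.2 hβi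
  have h1 : MemLp (fun ω => Y ω * α (U k ω)) 2 P := hU.memLp_mul hk hY hYi hα hαi
  have hL : MemLp (fun ω => α (U k ω) * Y ω + β (U k ω)) 2 P := by
    simp_rw [mul_comm (α _)]
    exact h1.add hβk
  refine ⟨hL, ?_⟩
  have e1 : ∫ ω, β (U k ω) ^ 2 ∂P = ∫ ω, β (U 1 ω) ^ 2 ∂P :=
    ((hU.ident k hk).comp (hβ.pow_const 2)).integral_eq
  have e2 := hU.integral_sq_mul hk hY hα
  calc ∫ ω, (α (U k ω) * Y ω + β (U k ω)) ^ 2 ∂P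
      ≤ ∫ ω, ((1 + δ) * (Y ω * α (U k ω)) ^ 2 + (1 + δ⁻¹) * β (U k ω) ^ 2) ∂P := by
        refine integral_mono hL.integrable_sq ((h1.integrable_sq.const_mul _).add
          (hβk.integrable_sq.const_mul _)) fun ω => ?_
        set x := Y ω * α (U k ω)
        set y := β (U k ω)
        have h3 : 0 ≤ (δ * x - y) ^ 2 / δ := by positivity
        have h4 : (δ * x - y) ^ 2 / δ = δ * x ^ 2 - 2 * x * y + δ⁻¹ * y ^ 2 := by
          field_simp
          ring
        change (α (U k ω) * Y ω + y) ^ 2 ≤ (1 + δ) * x ^ 2 + (1 + δ⁻¹) * y ^ 2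
        rw [mul_comm (α (U k ω))]
        change (x + y) ^ 2 ≤ _
        linarith [sq_nonneg x]
    _ = (1 + δ) * ((∫ ω, Y ω ^ 2 ∂P) * ∫ ω, α (U 1 ω) ^ 2 ∂P)
        + (1 + δ⁻¹) * ∫ ω, β (U 1 ω) ^ 2 ∂P := by
        rw [integral_add (h1.integrable_sq.const_mul _) (hβk.integrable_sq.const_mul _),
          integral_const_mul, integral_const_mul, e1, e2]
    _ ≤ _ := by
        have h5 : 0 ≤ ∫ ω, Y ω ^ 2 ∂P := integral_nonneg fun ω => sq_nonneg _
        have h6 := mul_le_mul_of_nonneg_left hm h5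
        nlinarith

theorem IsContractive.exists_flow_bound [IsProbabilityMeasure P] (hU : IsContractive P ℋ U m)
    (x₀ : ℝ) : ∃ C, ∀ k, 1 ≤ k → MemLp (fun ω => flow (fun j => U j ω) x₀ k) 2 P ∧
      ∫ ω, flow (fun j => U j ω) x₀ k ^ 2 ∂P ≤ C := by
  have m0 := hU.m_pos
  have m1 := hU.m_lt
  -- This choice makes the contraction factor `(1 + δ) * m` equal to `(1 + m) / 2 < 1`.
  set δ := (1 - m) / (2 * m) with hδ
  have hδ0 : 0 < δ := div_pos (by linarith) (by linarith)
  have hr : (1 + δ) * m = (1 + m) / 2 := by rw [hδ]; field_simp; ring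
  set s := (1 + δ⁻¹) * (∫ ω, (U 1 ω).2.1 ^ 2 ∂P + ∫ ω, (U 1 ω).2.2 ^ 2 ∂P) with hs
  have hc : 0 ≤ ∫ ω, (U 1 ω).2.1 ^ 2 ∂P := integral_nonneg fun ω => sq_nonneg _
  have hd : 0 ≤ ∫ ω, (U 1 ω).2.2 ^ 2 ∂P := integral_nonneg fun ω => sq_nonneg _
  have hδi : 0 < δ⁻¹ := inv_pos.2 hδ0
  have hs0 : 0 ≤ s := by positivity
  -- `2 * s / (1 - m)` is the fixed point of `t ↦ (1 + m) / 2 * t + s`; the term `x₀ ^ 2` takes care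
  -- of the root.
  refine ⟨2 * s / (1 - m) + x₀ ^ 2, fun k hk => ?_⟩
  have hstep : ∀ t ≤ 2 * s / (1 - m) + x₀ ^ 2,
      (1 + m) / 2 * t + s ≤ 2 * s / (1 - m) + x₀ ^ 2 := by
    intro t ht
    have : 2 * s / (1 - m) * (1 - m) = 2 * s := div_mul_cancel₀ _ (by linarith)
    nlinarith [sq_nonneg x₀]
  induction k, hk using tree_induction with
  | h1 =>
    simp only [flow_one]
    refine ⟨memLp_const _, ?_⟩
    have : 0 ≤ 2 * s / (1 - m) := div_nonneg (by linarith) (by linarith)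
    simpa
  | h2 k hk ih =>
    simp only [flow_even _ _ hk]
    have h := integral_sq_child_le hU.toIsInnovation (α := fun u => u.1.1) (β := fun u => u.2.1)
      (by fun_prop) (by fun_prop) hU.memLp_a hU.memLp_c hU.sq_a hδ0 hk
      (hU.measurable_flow x₀ hk) ih.1
    refine ⟨h.1, h.2.trans (le_trans ?_ (hstep _ ih.2))⟩
    rw [hr, hs]
    nlinarith
  | h3 k hk ih =>
    simp only [flow_odd _ _ hk]
    have h := integral_sq_child_le hU.toIsInnovation (α := fun u => u.1.2) (β := fun u => u.2.2)
      (by fun_prop) (by fun_prop) hU.memLp_b hU.memLp_d hU.sq_b hδ0 hk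
      (hU.measurable_flow x₀ hk) ih.1
    refine ⟨h.1, h.2.trans (le_trans ?_ (hstep _ ih.2))⟩
    rw [hr, hs]
    nlinarith

/-- A slope is the product of the coefficients along the ancestral line, which are independent with
second moments at most `m`. -/
theorem IsContractive.slope_bound [IsProbabilityMeasure P] (hU : IsContractive P ℋ U m)
    {k : ℕ} (hk : 1 ≤ k) : MemLp (fun ω => slope (fun j => U j ω) k) 2 P ∧
      ∫ ω, slope (fun j => U j ω) k ^ 2 ∂P ≤ m ^ genOf k := by
  have m0 := hU.m_pos
  induction k, hk using tree_induction with
  | h1 =>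
    have : ∀ V : ℕ → Innov, slope V 1 = 1 := fun V => flow_one _ _
    simp only [this]
    exact ⟨memLp_const _, by simp [genOf]⟩
  | h2 k hk ih =>
    simp only [slope_even _ hk, mul_comm _ (slope _ k)]
    have hm := hU.measurable_slope hk
    refine ⟨hU.memLp_mul hk hm ih.1 (φ := fun u => u.1.1) (by fun_prop) hU.memLp_a, ?_⟩
    rw [hU.integral_sq_mul hk hm (φ := fun u => u.1.1) (by fun_prop), genOf_two_mul hk, pow_succ]
    exact mul_le_mul ih.2 hU.sq_a (integral_nonneg fun _ => sq_nonneg _) (by positivity)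
  | h3 k hk ih =>
    simp only [slope_odd _ hk, mul_comm _ (slope _ k)]
    have hm := hU.measurable_slope hk
    refine ⟨hU.memLp_mul hk hm ih.1 (φ := fun u => u.1.2) (by fun_prop) hU.memLp_b, ?_⟩
    rw [hU.integral_sq_mul hk hm (φ := fun u => u.1.2) (by fun_prop),
      genOf_two_mul_add_one hk, pow_succ]
    exact mul_le_mul ih.2 hU.sq_b (integral_nonneg fun _ => sq_nonneg _) (by positivity)

/-- The generation average of squared slopes has expectation at most `m ^ n`, which is summable;
Cauchy–Schwarz passes to absolute values. Trajectories with different starts thus merge on average.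
-/
theorem IsContractive.ae_slope_tendsto [IsProbabilityMeasure P] (hU : IsContractive P ℋ U m) :
    ∀ᵐ ω ∂P, Tendsto (fun n => (∑ k ∈ generation n, |slope (fun j => U j ω) k|) / 2 ^ n)
      atTop (𝓝 0) := by
  have hb := fun k (hk : 1 ≤ k) => hU.slope_bound hk
  have hi : ∀ n, Integrable
      (fun ω => (∑ k ∈ generation n, slope (fun j => U j ω) k ^ 2) / 2 ^ n) P := fun n =>
    (integrable_finsetSum _ fun k hk =>
      (hb k (one_le_of_mem_generation hk)).1.integrable_sq).div_const _
  have hs : Summable fun n =>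
      ∫ ω, (∑ k ∈ generation n, slope (fun j => U j ω) k ^ 2) / 2 ^ n ∂P := by
    refine Summable.of_nonneg_of_le (fun n => integral_nonneg fun ω => by positivity)
      (fun n => ?_) (summable_geometric_of_lt_one hU.m_pos.le hU.m_lt)
    rw [integral_div, integral_finsetSum _ fun k hk =>
      (hb k (one_le_of_mem_generation hk)).1.integrable_sq, div_le_iff₀ (by positivity)]
    calc _ ≤ ∑ k ∈ generation n, m ^ n := Finset.sum_le_sum fun k hk => by
          have := (hb k (one_le_of_mem_generation hk)).2
          rwa [genOf_of_mem hk] at this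
      _ = m ^ n * 2 ^ n := by simp [card_generation, mul_comm]
  filter_upwards [ae_summable_of_summable_integral (fun n ω => by positivity) hi hs] with ω hω
  have h := hω.tendsto_atTop_zero.sqrt
  rw [Real.sqrt_zero] at h
  refine squeeze_zero (fun n => by positivity) (fun n => ?_) h
  refine Real.le_sqrt_of_sq_le ?_
  rw [div_pow, div_le_div_iff₀ (by positivity) (by positivity)]
  have := sq_sum_le_card_mul_sum_sq (s := generation n) (f := fun k => |slope (fun j => U j ω) k|)
  simp only [sq_abs, card_generation] at this
  push_cast at this
  nlinarith [show (0:ℝ) < 2 ^ n by positivity]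

/-- Almost sure bound for the sums over a generation of an integrable function of the
innovations. -/
theorem IsInnovation.ae_sum_abs_le {E : Type*} [MeasurableSpace E] {U : ℕ → Ω → E}
    (hU : IsInnovation P ℋ U) {φ : E → ℝ} (hφ : Measurable φ)
    (hφi : Integrable (fun ω => φ (U 1 ω)) P) :
    ∀ᵐ ω ∂P, ∃ C, 0 ≤ C ∧ ∀ n, ∑ k ∈ generation n, |φ (U k ω)| ≤ C * 2 ^ n := by
  have habs : Measurable fun u => |φ u| := hφ.abs
  -- Pairwise independence is enough for the strong law used below.
  have hpair : Pairwise
      (Function.onFun (IndepFun · · P) fun (i : ℕ) ω => |φ (U (i + 1) ω)|) := by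
    have h : ∀ i j : ℕ, i < j → IndepFun (fun ω => |φ (U (i + 1) ω)|)
        (fun ω => |φ (U (j + 1) ω)|) P := fun i j hij => by
      have hm : Measurable[ℋ (j + 1)] fun ω => |φ (U (i + 1) ω)| :=
        (habs.comp (hU.meas (i + 1) (by omega))).mono (hU.mono (by omega)) le_rfl
      exact (hU.indepFun (by omega) hm).comp measurable_id habs
    intro i j hij
    rcases lt_or_gt_of_ne hij with h' | h'
    · exact h i j h'
    · exact (h j i h').symm
  have hsl := strong_law_ae_real (μ := P) (fun (i : ℕ) ω => |φ (U (i + 1) ω)|) hφi.abs hpair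
    (fun i => ((hU.ident (i + 1) (by omega)).comp habs))
  filter_upwards [hsl] with ω hω
  obtain ⟨C, hC⟩ := hω.bddAbove_range
  have hC' : ∀ n : ℕ, (∑ i ∈ Finset.range n, |φ (U (i + 1) ω)|) / n ≤ C := fun n => hC ⟨n, rfl⟩
  -- At `n = 0` the average is `0 / 0 = 0`, so its upper bound is nonnegative.
  have hC0 : 0 ≤ C := by simpa using hC' 0
  -- Generation `n` lies among the first `2 ^ (n + 1)` individuals, whence the factor `2`.
  refine ⟨2 * C, by positivity, fun n => ?_⟩
  have h2 := hC' (2 ^ (n + 1))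
  rw [div_le_iff₀ (by positivity)] at h2
  calc ∑ k ∈ generation n, |φ (U k ω)|
      ≤ ∑ k ∈ Finset.Ico 1 (2 ^ (n + 1) + 1), |φ (U k ω)| := by
        refine Finset.sum_le_sum_of_subset_of_nonneg (fun k hk => ?_) fun _ _ _ => abs_nonneg _
        have := mem_generation.1 hk
        exact Finset.mem_Ico.2 ⟨one_le_of_mem_generation hk, by omega⟩
    _ = ∑ i ∈ Finset.range (2 ^ (n + 1)), |φ (U (i + 1) ω)| := by
        rw [Finset.sum_Ico_eq_sum_range]
        simp [add_comm]
    _ ≤ 2 * C * 2 ^ n := by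
        refine h2.trans (le_of_eq ?_)
        push_cast
        ring

end Moments

/-! ## Quadratic bounds for weighted sums over the generations -/

section Quadratic

variable {Ω : Type*} [mΩ : MeasurableSpace Ω] {P : Measure Ω} {ℋ : ℕ → MeasurableSpace Ω}

theorem sq_sum_Ico (g : ℕ → ℝ) (s t : ℕ) (hst : s ≤ t) :
    (∑ k ∈ Finset.Ico s t, g k) ^ 2 = ∑ k ∈ Finset.Ico s t, g k ^ 2
      + 2 * ∑ k ∈ Finset.Ico s t, (∑ j ∈ Finset.Ico s k, g j) * g k := by
  induction t, hst using Nat.le_induction with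
  | base => simp
  | succ t ht ih =>
    rw [Finset.sum_Ico_succ_top ht, Finset.sum_Ico_succ_top ht, Finset.sum_Ico_succ_top ht, add_sq,
      ih]
    ring

theorem memLp_of_abs_le_one_mul {f g : Ω → ℝ} (hg : MemLp g 2 P)
    (hf : AEStronglyMeasurable f P) (hb : ∀ ω, |f ω| ≤ 1) : MemLp (fun ω => f ω * g ω) 2 P := by
  refine hg.of_le (hf.mul hg.1) (ae_of_all _ fun ω => ?_)
  rw [norm_mul]
  exact mul_le_of_le_one_left (norm_nonneg _) (hb ω)

/-- Up to a factor `2`, this sum is the off-diagonal part of `∑ D l ^ 2 / 2 ^ l`. It is itself a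
martingale: the weight of `φ (U k)` involves only earlier members of the same generation. A partial
sum of at most `2 ^ l` orthogonal terms, divided by `2 ^ l`, has second moment at most `σ / 2 ^ l`,
so each generation contributes at most `σ ^ 2`. -/
theorem IsInnovation.integral_sq_offdiag_le [IsProbabilityMeasure P] {E : Type*}
    [MeasurableSpace E] {U : ℕ → Ω → E}
    (hU : IsInnovation P ℋ U) {φ : E → ℝ} (hφ : Measurable φ)
    (hφi : MemLp (fun ω => φ (U 1 ω)) 2 P) (hφ0 : ∫ ω, φ (U 1 ω) ∂P = 0) {f : ℕ → Ω → ℝ}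
    (hf : ∀ k, 1 ≤ k → Measurable[ℋ k] (f k)) (hf1 : ∀ k ω, |f k ω| ≤ 1) (n : ℕ) :
    MemLp (fun ω => ∑ k ∈ treeBefore n, (f k ω * ((∑ j ∈ Finset.Ico (2 ^ genOf k) k,
        f j ω * φ (U j ω)) / 2 ^ genOf k)) * φ (U k ω)) 2 P ∧
    ∫ ω, (∑ k ∈ treeBefore n, (f k ω * ((∑ j ∈ Finset.Ico (2 ^ genOf k) k,
        f j ω * φ (U j ω)) / 2 ^ genOf k)) * φ (U k ω)) ^ 2 ∂P
      ≤ n * (∫ ω, φ (U 1 ω) ^ 2 ∂P) ^ 2 := by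
  set σ := ∫ ω, φ (U 1 ω) ^ 2 ∂P with hσ
  have hσ0 : 0 ≤ σ := integral_nonneg fun _ => sq_nonneg _
  have hfL : ∀ k, 1 ≤ k → MemLp (f k) 2 P := fun k hk =>
    MemLp.of_bound ((hf k hk).mono (hU.le _) le_rfl).aestronglyMeasurable 1
      (ae_of_all _ fun ω => hf1 k ω)
  have hfσ : ∀ k, 1 ≤ k → ∫ ω, (f k ω * φ (U k ω)) ^ 2 ∂P ≤ σ := fun k hk => by
    rw [hU.integral_sq_mul hk (hf k hk) hφ]
    refine mul_le_of_le_one_left hσ0 ?_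
    have := integral_mono (hfL k hk).integrable_sq (integrable_const (1 : ℝ))
      fun ω => (sq_le_one_iff_abs_le_one _).2 (hf1 k ω)
    simpa using this
  have hMD := hU.isMartingaleDiff_mul hφ hφi hφ0 hf hfL
  set w : ℕ → Ω → ℝ := fun k ω => f k ω * ((∑ j ∈ Finset.Ico (2 ^ genOf k) k,
        f j ω * φ (U j ω)) / 2 ^ genOf k) with hw
  have h1 : ∀ k, ∀ j ∈ Finset.Ico (2 ^ genOf k) k, 1 ≤ j := fun k j hj =>
    Nat.one_le_two_pow.trans (Finset.mem_Ico.1 hj).1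
  have hSm : ∀ k, 1 ≤ k → Measurable[ℋ k] fun ω =>
      (∑ j ∈ Finset.Ico (2 ^ genOf k) k, f j ω * φ (U j ω)) / 2 ^ genOf k := fun k hk =>
    (Finset.measurable_fun_sum _ fun j hj =>
      (hMD.meas j (h1 k j hj)).mono (hU.mono (Finset.mem_Ico.1 hj).2) le_rfl).div_const _
  have hSL : ∀ k, MemLp (fun ω =>
      (∑ j ∈ Finset.Ico (2 ^ genOf k) k, f j ω * φ (U j ω)) / 2 ^ genOf k) 2 P := fun k => by
    simp_rw [div_eq_mul_inv]
    exact (hMD.memLp_sum _ (h1 k)).mul_const _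
  have hwm : ∀ k, 1 ≤ k → Measurable[ℋ k] (w k) := fun k hk => (hf k hk).mul (hSm k hk)
  have hwL : ∀ k, 1 ≤ k → MemLp (w k) 2 P := fun k hk =>
    memLp_of_abs_le_one_mul (hSL k) ((hf k hk).mono (hU.le _) le_rfl).aestronglyMeasurable
      (hf1 k)
  have hwσ : ∀ k, 1 ≤ k → ∫ ω, w k ω ^ 2 ∂P ≤ σ / 2 ^ genOf k := fun k hk => by
    calc ∫ ω, w k ω ^ 2 ∂P
        ≤ ∫ ω, ((∑ j ∈ Finset.Ico (2 ^ genOf k) k, f j ω * φ (U j ω)) / 2 ^ genOf k) ^ 2 ∂P := by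
          refine integral_mono (hwL k hk).integrable_sq (hSL k).integrable_sq fun ω => ?_
          simp only [hw, mul_pow]
          exact mul_le_of_le_one_left (sq_nonneg _) ((sq_le_one_iff_abs_le_one _).2 (hf1 k ω))
      _ = (∑ j ∈ Finset.Ico (2 ^ genOf k) k, ∫ ω, (f j ω * φ (U j ω)) ^ 2 ∂P)
            / (2 ^ genOf k) ^ 2 := by
          simp_rw [div_pow]
          rw [integral_div, hMD.integral_sq_sum hU.mono _ (h1 k)]
      _ ≤ (2 ^ genOf k * σ) / (2 ^ genOf k) ^ 2 := by
          gcongr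
          refine (Finset.sum_le_card_nsmul _ _ σ fun j hj => hfσ j (h1 k j hj)).trans ?_
          rw [nsmul_eq_mul]
          gcongr
          have := (mem_generation.1 (mem_generation_genOf hk)).2
          rw [pow_succ] at this
          rw [Nat.card_Ico]
          exact_mod_cast (by omega : k - 2 ^ genOf k ≤ 2 ^ genOf k)
      _ = σ / 2 ^ genOf k := by
          field_simp
  have hMD2 := hU.isMartingaleDiff_mul hφ hφi hφ0 hwm hwL
  have ht := fun k (hk : k ∈ treeBefore n) => one_le_of_mem_treeBefore hk
  refine ⟨hMD2.memLp_sum _ ht, ?_⟩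
  rw [hMD2.integral_sq_sum hU.mono _ ht, sum_treeBefore]
  calc _ ≤ ∑ l ∈ Finset.range n, ∑ k ∈ generation l, σ / 2 ^ l * σ := by
        refine Finset.sum_le_sum fun l _ => Finset.sum_le_sum fun k hk => ?_
        have hk1 := one_le_of_mem_generation hk
        rw [hU.integral_sq_mul hk1 (hwm k hk1) hφ, ← genOf_of_mem hk]
        exact mul_le_mul_of_nonneg_right (hwσ k hk1) hσ0
    _ = n * σ ^ 2 := by
        simp only [Finset.sum_const, card_generation, nsmul_eq_mul]
        have : ∀ l : ℕ, (((2 ^ l : ℕ) : ℝ) * (σ / 2 ^ l * σ)) = σ ^ 2 := fun l => by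
          push_cast; field_simp
        simp_rw [this]
        simp

/-- `∑_{l < n} 2^{-l} D_l² = O(n)` for `D_l = ∑_{k ∈ 𝔾_l} f_k φ(U_k)` with bounded predictable
weights. -/
theorem IsInnovation.ae_sum_sq_le [IsProbabilityMeasure P] {E : Type*}
    [MeasurableSpace E] {U : ℕ → Ω → E}
    (hU : IsInnovation P ℋ U) {φ : E → ℝ} (hφ : Measurable φ)
    (hφi : MemLp (fun ω => φ (U 1 ω)) 2 P) (hφ0 : ∫ ω, φ (U 1 ω) ∂P = 0) {f : ℕ → Ω → ℝ}
    (hf : ∀ k, 1 ≤ k → Measurable[ℋ k] (f k)) (hf1 : ∀ k ω, |f k ω| ≤ 1) :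
    ∀ᵐ ω ∂P, ∃ C : ℝ, ∀ n : ℕ, ∑ l ∈ Finset.range n,
      (∑ k ∈ generation l, f k ω * φ (U k ω)) ^ 2 / 2 ^ l ≤ C * n := by
  set N : ℕ → Ω → ℝ := fun n ω => ∑ k ∈ treeBefore n, (f k ω * ((∑ j ∈ Finset.Ico (2 ^ genOf k) k,
        f j ω * φ (U j ω)) / 2 ^ genOf k)) * φ (U k ω) with hN
  have hNb := fun n => hU.integral_sq_offdiag_le hφ hφi hφ0 hf hf1 n
  set σ := ∫ ω, φ (U 1 ω) ^ 2 ∂P with hσ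
  -- Since `N n` has second moment `O(n)`, the second moment of `N n / n` is summable along the
  -- squares `n = j ^ 2`.
  have hWL : ∀ j : ℕ, MemLp (fun ω => N (j ^ 2) ω / (j : ℝ) ^ 2) 2 P := fun j => by
    simp_rw [div_eq_mul_inv]
    exact (hNb (j ^ 2)).1.mul_const _
  have hWs : Summable fun j : ℕ => ∫ ω, (N (j ^ 2) ω / (j : ℝ) ^ 2) ^ 2 ∂P := by
    have hb : Summable fun j : ℕ => σ ^ 2 * (1 / (j : ℝ) ^ 2) :=
      (Real.summable_one_div_nat_pow.2 (by norm_num)).mul_left _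
    refine hb.of_nonneg_of_le (fun j => integral_nonneg fun _ => sq_nonneg _) fun j => ?_
    simp_rw [div_pow]
    rw [integral_div]
    rcases Nat.eq_zero_or_pos j with rfl | hj
    · simp
    have hj' : (0 : ℝ) < j := by exact_mod_cast hj
    rw [div_le_iff₀ (by positivity)]
    refine (hNb (j ^ 2)).2.trans (le_of_eq ?_)
    push_cast
    field_simp
  filter_upwards [ae_tendsto_zero_of_summable_sq hWL hWs,
    hU.ae_sum_abs_le (hφ.pow_const 2) hφi.integrable_sq] with ω hω hdiag
  obtain ⟨C₁, hC₁⟩ := hω.bddAbove_range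
  obtain ⟨C₂, hC₂0, hC₂⟩ := hdiag
  have hC₁' : ∀ j : ℕ, N (j ^ 2) ω ≤ C₁ * (j : ℝ) ^ 2 := fun j => by
    rcases Nat.eq_zero_or_pos j with rfl | hj
    · simp [hN, treeBefore]
    have hj' : (0 : ℝ) < (j : ℝ) ^ 2 := by positivity
    exact (div_le_iff₀ hj').1 (hC₁ ⟨j, rfl⟩)
  have hC₁0 : 0 ≤ C₁ := by simpa using hC₁ ⟨0, rfl⟩
  -- The diagonal terms are controlled by the strong law for `φ (U k) ^ 2`, the off-diagonal ones
  -- form `2 * N n`.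
  have hexp : ∀ n : ℕ, ∑ l ∈ Finset.range n,
      (∑ k ∈ generation l, f k ω * φ (U k ω)) ^ 2 / 2 ^ l ≤ C₂ * n + 2 * N n ω := fun n => by
    have hNn : N n ω = ∑ l ∈ Finset.range n, ∑ k ∈ generation l,
        ((∑ j ∈ Finset.Ico (2 ^ l) k, f j ω * φ (U j ω)) * (f k ω * φ (U k ω))) / 2 ^ l := by
      rw [hN]
      simp only
      rw [sum_treeBefore]
      refine Finset.sum_congr rfl fun l _ => Finset.sum_congr rfl fun k hk => ?_
      rw [genOf_of_mem hk]
      ring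
    rw [hNn, Finset.mul_sum]
    have : C₂ * n = ∑ l ∈ Finset.range n, C₂ := by simp [mul_comm]
    rw [this, ← Finset.sum_add_distrib]
    refine Finset.sum_le_sum fun l _ => ?_
    rw [← Finset.sum_div, generation, sq_sum_Ico _ _ _ (Nat.pow_le_pow_right (by norm_num) l.le_succ),
      add_div, mul_div_assoc]
    refine add_le_add ?_ le_rfl
    rw [div_le_iff₀ (by positivity)]
    refine le_trans (Finset.sum_le_sum fun k _ => ?_) (hC₂ l)
    rw [mul_pow, abs_of_nonneg (sq_nonneg _)]
    exact mul_le_of_le_one_left (sq_nonneg _) ((sq_le_one_iff_abs_le_one _).2 (hf1 k ω))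
  refine ⟨4 * (C₂ + 2 * C₁), fun n => ?_⟩
  rcases Nat.eq_zero_or_pos n with rfl | hn
  · simp
  -- The left side is nondecreasing in `n`, so it is enough to bound it at the next square, and `j ^
  -- 2 ≤ 4 * n`.
  set j := Nat.sqrt n + 1
  have hj1 : n ≤ j ^ 2 := by
    have := Nat.lt_succ_sqrt' n
    exact this.le
  have hj2 : j ^ 2 ≤ 4 * n := by
    have h1 := Nat.sqrt_le' n
    have h2 : 1 ≤ Nat.sqrt n := Nat.sqrt_pos.2 hn
    have : (Nat.sqrt n + 1) ^ 2 ≤ 4 * (Nat.sqrt n) ^ 2 := by nlinarith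
    calc j ^ 2 ≤ _ := this
      _ ≤ _ := by omega
  have hj2' : (j : ℝ) ^ 2 ≤ 4 * n := by exact_mod_cast hj2
  calc _ ≤ ∑ l ∈ Finset.range (j ^ 2),
      (∑ k ∈ generation l, f k ω * φ (U k ω)) ^ 2 / 2 ^ l :=
        Finset.sum_le_sum_of_subset_of_nonneg (Finset.range_subset_range.2 hj1)
          fun _ _ _ => by positivity
    _ ≤ C₂ * (j ^ 2 : ℕ) + 2 * N (j ^ 2) ω := hexp _
    _ ≤ (C₂ + 2 * C₁) * (j : ℝ) ^ 2 := by
        have := hC₁' j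
        push_cast
        linarith
    _ ≤ (C₂ + 2 * C₁) * (4 * n) := by gcongr
    _ = _ := by ring

end Quadratic

/-! ### Quadratic bounds simultaneously for all starting points. -/

section Coupling

variable {Ω : Type*} [mΩ : MeasurableSpace Ω] {P : Measure Ω} {ℋ : ℕ → MeasurableSpace Ω}
  {U : ℕ → Ω → Innov} {m : ℝ}

/-- The trajectory with starting point `t`, seen as a perturbation of the one started from `0`. -/
def path (U : ℕ → Innov) (t : ℝ) (k : ℕ) : ℝ := flow U 0 k + t * slope U k

/-- The sum is the derivative in `u` of the generation sum of `f (path u k) * φ (U k)`. For fixed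
`u` it is again a martingale sum, and its predictable weights carry a slope, which supplies the
extra factor `m ^ l`. -/
theorem IsContractive.lintegral_sq_deriv_le [IsProbabilityMeasure P] (hU : IsContractive P ℋ U m)
    {φ : Innov → ℝ} (hφ : Measurable φ) (hφi : MemLp (fun ω => φ (U 1 ω)) 2 P)
    (hφ0 : ∫ ω, φ (U 1 ω) ∂P = 0) {f' : ℝ → ℝ} (hf' : Measurable f') {L : ℝ}
    (hL : ∀ x, |f' x| ≤ L) (l : ℕ) (u : ℝ) :
    ∫⁻ ω, ENNReal.ofReal ((∑ k ∈ generation l, f' (path (fun j => U j ω) u k) *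
      slope (fun j => U j ω) k * φ (U k ω)) ^ 2) ∂P
      ≤ ENNReal.ofReal (L ^ 2 * (∫ ω, φ (U 1 ω) ^ 2 ∂P) * (2 ^ l * m ^ l)) := by
  set σ := ∫ ω, φ (U 1 ω) ^ 2 ∂P with hσ
  have hσ0 : 0 ≤ σ := integral_nonneg fun _ => sq_nonneg _
  have hpm : ∀ k, 1 ≤ k → Measurable[ℋ k] fun ω => f' (path (fun j => U j ω) u k) :=
    fun k hk => hf'.comp ((hU.measurable_flow 0 hk).add
      ((hU.measurable_slope hk).const_mul u))
  have hwm : ∀ k, 1 ≤ k → Measurable[ℋ k] fun ω => f' (path (fun j => U j ω) u k) *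
      slope (fun j => U j ω) k := fun k hk => (hpm k hk).mul (hU.measurable_slope hk)
  have hwL : ∀ k, 1 ≤ k → MemLp (fun ω => f' (path (fun j => U j ω) u k) *
      slope (fun j => U j ω) k) 2 P := fun k hk => by
    refine ((hU.slope_bound hk).1.const_mul L).of_le
      ((hwm k hk).mono (hU.le _) le_rfl).aestronglyMeasurable (ae_of_all _ fun ω => ?_)
    rw [norm_mul, norm_mul]
    exact mul_le_mul_of_nonneg_right ((hL _).trans (le_abs_self L)) (norm_nonneg _)
  have hMD := hU.isMartingaleDiff_mul hφ hφi hφ0 hwm hwL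
  have hs := fun k (hk : k ∈ generation l) => one_le_of_mem_generation hk
  rw [← ofReal_integral_eq_lintegral_ofReal (hMD.memLp_sum _ hs).integrable_sq
    (ae_of_all _ fun _ => sq_nonneg _)]
  refine ENNReal.ofReal_le_ofReal ?_
  rw [hMD.integral_sq_sum hU.mono _ hs]
  calc _ ≤ ∑ k ∈ generation l, L ^ 2 * m ^ l * σ := by
        refine Finset.sum_le_sum fun k hk => ?_
        have hk1 := hs k hk
        rw [hU.integral_sq_mul hk1 (hwm k hk1) hφ]
        refine mul_le_mul_of_nonneg_right ?_ hσ0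
        have hsl := hU.slope_bound hk1
        rw [genOf_of_mem hk] at hsl
        calc _ ≤ ∫ ω, L ^ 2 * slope (fun j => U j ω) k ^ 2 ∂P := by
              refine integral_mono (hwL k hk1).integrable_sq
                (hsl.1.integrable_sq.const_mul _) fun ω => ?_
              simp only [mul_pow]
              exact mul_le_mul_of_nonneg_right (sq_le_sq' (by linarith [abs_le.1 (hL
                (path (fun j => U j ω) u k))]) ((le_abs_self _).trans (hL _))) (sq_nonneg _)
          _ ≤ _ := by
              rw [integral_const_mul]
              exact mul_le_mul_of_nonneg_left hsl.2 (sq_nonneg _)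
    _ = _ := by
        rw [Finset.sum_const, card_generation, nsmul_eq_mul]
        push_cast
        ring

/-- By Tonelli, the expectations of the integrals over `u`, divided by `2 ^ l`, are dominated by a
geometric series in `m`. The series over `l` is therefore almost surely finite, and it bounds each
of its terms. -/
theorem IsContractive.ae_integral_sq_deriv_le [IsProbabilityMeasure P]
    (hU : IsContractive P ℋ U m)
    {φ : Innov → ℝ} (hφ : Measurable φ) (hφi : MemLp (fun ω => φ (U 1 ω)) 2 P)
    (hφ0 : ∫ ω, φ (U 1 ω) ∂P = 0) {f' : ℝ → ℝ} (hf' : Measurable f') {L : ℝ}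
    (hL : ∀ x, |f' x| ≤ L) (K : ℕ) :
    ∀ᵐ ω ∂P, ∃ C : ℝ, 0 ≤ C ∧ ∀ l : ℕ,
      ∫⁻ u in Set.Icc (-(K : ℝ)) K, ENNReal.ofReal ((∑ k ∈ generation l,
        f' (path (fun j => U j ω) u k) * slope (fun j => U j ω) k * φ (U k ω)) ^ 2)
        ≤ ENNReal.ofReal (C * 2 ^ l) := by
  set g : ℕ → Ω → ℝ → ℝ≥0∞ := fun l ω u => ENNReal.ofReal ((∑ k ∈ generation l,
        f' (path (fun j => U j ω) u k) * slope (fun j => U j ω) k * φ (U k ω)) ^ 2) with hg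
  have hgm : ∀ l, Measurable (Function.uncurry (g l)) := fun l => by
    refine ((Finset.measurable_fun_sum _ fun k hk => ?_).pow_const 2).ennreal_ofReal
    have hk1 := one_le_of_mem_generation hk
    have h1 := (hU.measurable_flow 0 hk1).mono (hU.le _) le_rfl
    have h2 := (hU.measurable_slope hk1).mono (hU.le _) le_rfl
    have h3 := hU.toIsInnovation.measurable hk1
    exact ((hf'.comp ((h1.comp measurable_fst).add (measurable_snd.mul
      (h2.comp measurable_fst)))).mul (h2.comp measurable_fst)).mul
      (hφ.comp (h3.comp measurable_fst))
  set σ := ∫ ω, φ (U 1 ω) ^ 2 ∂P with hσ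
  have hσ0 : 0 ≤ σ := integral_nonneg fun _ => sq_nonneg _
  have m0 := hU.m_pos
  have hbound : ∀ l, ∫⁻ ω, (∫⁻ u in Set.Icc (-(K : ℝ)) K, g l ω u) / ENNReal.ofReal (2 ^ l) ∂P
      ≤ ENNReal.ofReal (L ^ 2 * σ * (2 * K) * m ^ l) := fun l => by
    simp_rw [div_eq_mul_inv]
    rw [lintegral_mul_const' _ _ (ENNReal.inv_ne_top.2 (by simp)),
      lintegral_lintegral_swap (hgm l).aemeasurable, ← div_eq_mul_inv]
    refine ENNReal.div_le_of_le_mul ?_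
    calc _ ≤ ∫⁻ u in Set.Icc (-(K : ℝ)) K, ENNReal.ofReal (L ^ 2 * σ * (2 ^ l * m ^ l)) :=
          lintegral_mono fun u => hU.lintegral_sq_deriv_le hφ hφi hφ0 hf' hL l u
      _ = _ := by
          rw [setLIntegral_const, Real.volume_Icc, ← ENNReal.ofReal_mul (by positivity),
            ← ENNReal.ofReal_mul (by positivity)]
          congr 1
          ring
  have hgm2 : ∀ l, Measurable fun ω =>
      (∫⁻ u in Set.Icc (-(K : ℝ)) K, g l ω u) / ENNReal.ofReal (2 ^ l) := fun l =>
    (hgm l).lintegral_prod_right'.div_const _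
  have hfin : ∫⁻ ω, ∑' l, (∫⁻ u in Set.Icc (-(K : ℝ)) K, g l ω u) / ENNReal.ofReal (2 ^ l) ∂P
      ≠ ∞ := by
    rw [lintegral_tsum fun l => (hgm2 l).aemeasurable]
    refine ne_top_of_le_ne_top ?_ (ENNReal.tsum_le_tsum hbound)
    exact ((summable_geometric_of_lt_one m0.le hU.m_lt).mul_left _).tsum_ofReal_ne_top
  have hlt := ae_lt_top (Measurable.tsum hgm2) hfin
  filter_upwards [hlt] with ω hω
  refine ⟨ENNReal.toReal (∑' l, (∫⁻ u in Set.Icc (-(K : ℝ)) K, g l ω u) /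
    ENNReal.ofReal (2 ^ l)), ENNReal.toReal_nonneg, fun l => ?_⟩
  rw [ENNReal.ofReal_mul ENNReal.toReal_nonneg, ENNReal.ofReal_toReal hω.ne]
  have := ENNReal.le_tsum (f := fun l =>
    (∫⁻ u in Set.Icc (-(K : ℝ)) K, g l ω u) / ENNReal.ofReal (2 ^ l)) l
  rwa [ENNReal.div_le_iff (by simp) (by simp)] at this

/-- Pathwise Sobolev bound: a function whose derivative is square-integrable on `[-K, K]`. -/
theorem abs_sub_le_of_lintegral_sq_deriv {D D' : ℝ → ℝ} (hD : ∀ u, HasDerivAt D (D' u) u)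
    (hD' : Continuous D') {K S s : ℝ} (hS : 0 ≤ S) (hs : 0 < s)
    (h : ∫⁻ u in Set.Icc (-K) K, ENNReal.ofReal (D' u ^ 2) ≤ ENNReal.ofReal (S * s ^ 2))
    {t : ℝ} (ht : |t| ≤ K) : |D t - D 0| ≤ s * (2 * K + S) / 2 := by
  have hK : 0 ≤ K := (abs_nonneg t).trans ht
  have hint : IntegrableOn (fun u => D' u ^ 2) (Set.Icc (-K) K) :=
    (hD'.pow 2).continuousOn.integrableOn_compact isCompact_Icc
  have hsq : ∫ u in Set.Icc (-K) K, D' u ^ 2 ≤ S * s ^ 2 := by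
    rw [← ofReal_integral_eq_lintegral_ofReal hint (ae_of_all _ fun _ => sq_nonneg _)] at h
    exact (ENNReal.ofReal_le_ofReal_iff (by positivity)).1 h
  have hftc : ∫ u in (0 : ℝ)..t, D' u = D t - D 0 :=
    intervalIntegral.integral_eq_sub_of_hasDerivAt (fun u _ => hD u)
      (hD'.intervalIntegrable _ _)
  have habs : IntegrableOn (fun u => |D' u|) (Set.Icc (-K) K) :=
    hD'.abs.continuousOn.integrableOn_compact isCompact_Icc
  have hsub : Set.uIoc 0 t ⊆ Set.Icc (-K) K := by
    intro u hu
    have := abs_le.1 ht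
    rcases Set.mem_uIoc.1 hu with h | h
    · exact ⟨by linarith [h.1], by linarith [h.2]⟩
    · exact ⟨by linarith [h.1], by linarith [h.2]⟩
  have hone : IntegrableOn (fun _ : ℝ => s / 2) (Set.Icc (-K) K) :=
    continuous_const.continuousOn.integrableOn_compact isCompact_Icc
  calc |D t - D 0| = ‖∫ u in (0 : ℝ)..t, D' u‖ := by rw [hftc, Real.norm_eq_abs]
    _ ≤ ∫ u in Set.uIoc 0 t, ‖D' u‖ := intervalIntegral.norm_integral_le_integral_norm_uIoc
    _ ≤ ∫ u in Set.Icc (-K) K, |D' u| :=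
        setIntegral_mono_set habs (ae_of_all _ fun _ => abs_nonneg _) hsub.eventuallyLE
    _ ≤ ∫ u in Set.Icc (-K) K, (s / 2 + (2 * s)⁻¹ * D' u ^ 2) := by
        refine integral_mono habs (hone.add (hint.const_mul _)) fun u => ?_
        -- The scale `s` balances the pointwise bound `|D'| ≤ s / 2 + D' ^ 2 / (2 * s)`.
        have h3 : 0 ≤ (s - |D' u|) ^ 2 * (2 * s)⁻¹ := by positivity
        have h4 : (s - |D' u|) ^ 2 * (2 * s)⁻¹ = s / 2 + (2 * s)⁻¹ * D' u ^ 2 - |D' u| := by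
          rw [sub_sq, sq_abs]
          field_simp
          ring
        simp only
        linarith
    _ = s / 2 * (2 * K) + (2 * s)⁻¹ * ∫ u in Set.Icc (-K) K, D' u ^ 2 := by
        rw [integral_add hone (hint.const_mul _), integral_const_mul, setIntegral_const,
          smul_eq_mul, measureReal_def, Real.volume_Icc, ENNReal.toReal_ofReal (by linarith)]
        ring
    _ ≤ s / 2 * (2 * K) + (2 * s)⁻¹ * (S * s ^ 2) := by gcongr
    _ = s * (2 * K + S) / 2 := by
        field_simp

/-- `∑_{l < n} 2^{-l} D_l² = O(n)` for `D_l = ∑_{k ∈ 𝔾_l} f(x_k) φ(U_k)`, simultaneously for all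
trajectories `x`. -/
theorem IsContractive.ae_sum_sq_path_le [IsProbabilityMeasure P] (hU : IsContractive P ℋ U m)
    {φ : Innov → ℝ} (hφ : Measurable φ) (hφi : MemLp (fun ω => φ (U 1 ω)) 2 P)
    (hφ0 : ∫ ω, φ (U 1 ω) ∂P = 0) {f f' : ℝ → ℝ} (hf : ∀ x, HasDerivAt f (f' x) x)
    (hf' : Continuous f') {L : ℝ} (hL : ∀ x, |f' x| ≤ L) (hf1 : ∀ x, |f x| ≤ 1) :
    ∀ᵐ ω ∂P, ∀ t : ℝ, ∃ C : ℝ, ∀ n : ℕ, ∑ l ∈ Finset.range n,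
      (∑ k ∈ generation l, f (path (fun j => U j ω) t k) * φ (U k ω)) ^ 2 / 2 ^ l ≤ C * n := by
  have hfm : Measurable f := (continuous_iff_continuousAt.2 fun x => (hf x).continuousAt).measurable
  -- The trajectory from `0` is predictable, so the martingale bound applies directly to it.
  have h0 := hU.toIsInnovation.ae_sum_sq_le hφ hφi hφ0
    (f := fun k ω => f (flow (fun j => U j ω) 0 k))
    (fun k hk => hfm.comp (hU.measurable_flow 0 hk)) (fun k ω => hf1 _)
  -- Integer radii `K` keep the exceptional set null while covering all starts `t`.
  have h1 := ae_all_iff.2 fun K : ℕ => hU.ae_integral_sq_deriv_le hφ hφi hφ0 hf'.measurable hL K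
  filter_upwards [h0, h1] with ω ⟨C₀, hC₀⟩ h1 t
  obtain ⟨K, hK⟩ := exists_nat_ge |t|
  obtain ⟨S, hS0, hS⟩ := h1 K
  refine ⟨2 * C₀ + (2 * K + S) ^ 2 / 2, fun n => ?_⟩
  set D : ℕ → ℝ → ℝ := fun l u =>
    ∑ k ∈ generation l, f (path (fun j => U j ω) u k) * φ (U k ω) with hD
  have hD0 : ∀ l, D l 0 = ∑ k ∈ generation l, f (flow (fun j => U j ω) 0 k) * φ (U k ω) :=
    fun l => by simp [hD, path]
  have hdiff : ∀ l, (D l t - D l 0) ^ 2 / 2 ^ l ≤ (2 * K + S) ^ 2 / 4 := fun l => by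
    have hs2 : √(2 ^ l : ℝ) ^ 2 = 2 ^ l := Real.sq_sqrt (by positivity)
    have hd : ∀ u, HasDerivAt (D l) (∑ k ∈ generation l, f' (path (fun j => U j ω) u k) *
        slope (fun j => U j ω) k * φ (U k ω)) u := fun u => by
      refine HasDerivAt.fun_sum fun k _ => ?_
      refine HasDerivAt.mul_const ?_ _
      have hp : HasDerivAt (fun u => path (fun j => U j ω) u k) (slope (fun j => U j ω) k) u := by
        simpa [path] using ((hasDerivAt_id u).mul_const (slope (fun j => U j ω) k)).const_add
          (flow (fun j => U j ω) 0 k)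
      exact (hf _).comp u hp
    have hc : Continuous fun u => ∑ k ∈ generation l, f' (path (fun j => U j ω) u k) *
        slope (fun j => U j ω) k * φ (U k ω) := by
      unfold path
      fun_prop
    -- With `s = 2 ^ (l / 2)`, moving the start from `0` to `t` changes `D l` by `O(2 ^ (l / 2))`,
    -- hence each summand `D l ^ 2 / 2 ^ l` by a bounded excess, up to a factor `2`.
    have h := abs_sub_le_of_lintegral_sq_deriv hd hc hS0 (s := √(2 ^ l : ℝ)) (by positivity)
      (by rw [hs2]; exact hS l) hK
    rw [div_le_iff₀ (by positivity), ← sq_abs]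
    calc _ ≤ (√(2 ^ l : ℝ) * (2 * K + S) / 2) ^ 2 := by gcongr
      _ = _ := by
        rw [div_pow, mul_pow, hs2]
        ring
  calc ∑ l ∈ Finset.range n, D l t ^ 2 / 2 ^ l
      ≤ ∑ l ∈ Finset.range n, (2 * (D l 0 ^ 2 / 2 ^ l) + (2 * K + S) ^ 2 / 2) := by
        refine Finset.sum_le_sum fun l _ => ?_
        have : D l t ^ 2 / 2 ^ l ≤ 2 * (D l 0 ^ 2 / 2 ^ l) + 2 * ((D l t - D l 0) ^ 2 / 2 ^ l) := by
          rw [← mul_div_assoc, ← mul_div_assoc, ← add_div]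
          gcongr
          nlinarith [sq_nonneg (D l t - 2 * D l 0)]
        linarith [hdiff l]
    _ ≤ _ := by
        rw [Finset.sum_add_distrib, ← Finset.mul_sum]
        have := hC₀ n
        simp_rw [← hD0] at this
        simp only [Finset.sum_const, Finset.card_range, nsmul_eq_mul]
        linarith

end Coupling

/-! ## Tightness and the transfer operator -/

section Tightness

variable {Ω : Type*} [mΩ : MeasurableSpace Ω] {P : Measure Ω} {ℋ : ℕ → MeasurableSpace Ω}
  {U : ℕ → Ω → Innov} {m : ℝ}

theorem IsMartingaleDiff.ae_sum_generation_tendsto {ζ : ℕ → Ω → ℝ} (hm : Monotone ℋ)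
    (hζ : IsMartingaleDiff P ℋ ζ) {C : ℝ} (hC : ∀ k, 1 ≤ k → ∫ ω, ζ k ω ^ 2 ∂P ≤ C) :
    ∀ᵐ ω ∂P, Tendsto (fun n => (∑ k ∈ generation n, ζ k ω) / 2 ^ n) atTop (𝓝 0) := by
  have hs : ∀ n, ∀ k ∈ generation n, 1 ≤ k := fun n k hk => one_le_of_mem_generation hk
  refine ae_tendsto_zero_of_summable_sq (fun n => ?_) ?_
  · simp_rw [div_eq_mul_inv]
    exact (hζ.memLp_sum _ (hs n)).mul_const _
  · refine Summable.of_nonneg_of_le (fun n => integral_nonneg fun _ => sq_nonneg _) (fun n => ?_)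
      ((summable_geometric_of_lt_one (r := (1 / 2 : ℝ)) (by norm_num) (by norm_num)).mul_left C)
    simp_rw [div_pow]
    rw [integral_div, hζ.integral_sq_sum hm _ (hs n), div_le_iff₀ (by positivity)]
    refine (Finset.sum_le_card_nsmul _ _ C fun k hk => hC k (hs n k hk)).trans (le_of_eq ?_)
    rw [card_generation, nsmul_eq_mul]
    push_cast
    rw [one_pow]
    field_simp

theorem integral_abs_le_of_sq [IsProbabilityMeasure P] {f : Ω → ℝ} (hf : MemLp f 2 P)
    (h : ∫ ω, f ω ^ 2 ∂P ≤ m) : ∫ ω, |f ω| ∂P ≤ (1 + m) / 2 := by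
  have hi : Integrable (fun ω => (1 + f ω ^ 2) / 2) P :=
    ((integrable_const 1).add hf.integrable_sq).div_const 2
  calc ∫ ω, |f ω| ∂P ≤ ∫ ω, (1 + f ω ^ 2) / 2 ∂P := by
        refine integral_mono (hf.integrable (by norm_num)).abs hi fun ω => ?_
        have := sq_nonneg (|f ω| - 1)
        rw [sub_sq, sq_abs] at this
        simp only
        linarith
    _ ≤ _ := by
        rw [integral_div, integral_add (integrable_const 1) hf.integrable_sq]
        simp
        linarith

/-- What matters is that `1 + m < 2`: absolute values averaged over two children contract. -/
theorem IsContractive.integral_abs_add_le [IsProbabilityMeasure P] (hU : IsContractive P ℋ U m) :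
    ∫ ω, (|(U 1 ω).1.1| + |(U 1 ω).1.2|) ∂P ≤ 1 + m := by
  rw [integral_add (hU.memLp_a.integrable (by norm_num)).abs
    (hU.memLp_b.integrable (by norm_num)).abs]
  have := integral_abs_le_of_sq hU.memLp_a hU.sq_a
  have := integral_abs_le_of_sq hU.memLp_b hU.sq_b
  linarith

/-- From one generation to the next, the sum of absolute values grows at most by the mean factor `M
≤ 1 + m`, plus a martingale term and a noise term, both `O(2 ^ n)`. After division by `2 ^ n` this
is a contracting affine recursion. -/
theorem IsContractive.ae_sum_abs_flow_le [IsProbabilityMeasure P] (hU : IsContractive P ℋ U m) :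
    ∀ᵐ ω ∂P, ∃ C : ℝ, ∀ n, ∑ k ∈ generation n, |flow (fun j => U j ω) 0 k| ≤ C * 2 ^ n := by
  obtain ⟨B, hB⟩ := hU.exists_flow_bound 0
  set φ : Innov → ℝ := fun u => |u.1.1| + |u.1.2| with hφ
  have hφm : Measurable φ := by fun_prop
  have hφi : MemLp (fun ω => φ (U 1 ω)) 2 P := hU.memLp_a.abs.add hU.memLp_b.abs
  set M := ∫ ω, φ (U 1 ω) ∂P with hM
  have hM1 : M ≤ 1 + m := hU.integral_abs_add_le
  have hψi : MemLp (fun ω => φ (U 1 ω) - M) 2 P := hφi.sub (memLp_const M)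
  have hψ0 : ∫ ω, (φ (U 1 ω) - M) ∂P = 0 := by
    rw [integral_sub (hφi.integrable (by norm_num)) (integrable_const M)]
    simp [hM]
  have hMD := hU.isMartingaleDiff_mul (φ := fun u => φ u - M) (hφm.sub_const M) hψi hψ0
    (w := fun k ω => |flow (fun j => U j ω) 0 k|)
    (fun k hk => (continuous_abs.measurable.comp (hU.measurable_flow 0 hk))) (fun k hk => (hB k hk).1.abs)
  have hlim := hMD.ae_sum_generation_tendsto hU.mono
    (C := B * ∫ ω, (φ (U 1 ω) - M) ^ 2 ∂P) fun k hk => by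
      have := hU.integral_sq_mul hk (G := fun ω => |flow (fun j => U j ω) 0 k|)
        (continuous_abs.measurable.comp (hU.measurable_flow 0 hk)) (φ := fun u => φ u - M)
        (hφm.sub_const M)
      rw [this]
      simp only [sq_abs]
      exact mul_le_mul_of_nonneg_right (hB k hk).2 (integral_nonneg fun _ => sq_nonneg _)
  have hcd := hU.toIsInnovation.ae_sum_abs_le (φ := fun u => |u.2.1| + |u.2.2|) (by fun_prop)
    ((hU.memLp_c.integrable (by norm_num)).abs.add (hU.memLp_d.integrable (by norm_num)).abs)
  filter_upwards [hlim, hcd] with ω hω ⟨C₂, hC₂0, hC₂⟩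
  obtain ⟨C₁, hC₁⟩ := hω.bddAbove_range
  set Y := flow (fun j => U j ω) 0 with hY
  have hC₁' : ∀ n, ∑ k ∈ generation n, |Y k| * (φ (U k ω) - M) ≤ C₁ * 2 ^ n := fun n =>
    (div_le_iff₀ (by positivity)).1 (hC₁ ⟨n, rfl⟩)
  have hm1 := hU.m_lt
  have hm0 := hU.m_pos
  -- Chosen so that `(1 + m) * R + C₁ + C₂ ≤ 2 * R`, which closes the induction.
  set R := |Y 1| + |C₁ + C₂| / (1 - m) with hR
  have hR1 : (1 - m) * R ≥ C₁ + C₂ := by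
    have : |C₁ + C₂| / (1 - m) * (1 - m) = |C₁ + C₂| := div_mul_cancel₀ _ (by linarith)
    nlinarith [abs_nonneg (Y 1), le_abs_self (C₁ + C₂)]
  refine ⟨R, fun n => ?_⟩
  induction n with
  | zero =>
    simp only [show generation 0 = {1} from rfl, Finset.sum_singleton, pow_zero, mul_one, hR]
    have : 0 ≤ |C₁ + C₂| / (1 - m) := div_nonneg (abs_nonneg _) (by linarith)
    linarith
  | succ n ih =>
    rw [sum_generation_succ]
    calc _ ≤ ∑ k ∈ generation n, (M * |Y k| + |Y k| * (φ (U k ω) - M)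
            + (|(U k ω).2.1| + |(U k ω).2.2|)) := by
          refine Finset.sum_le_sum fun k hk => ?_
          have hk1 := one_le_of_mem_generation hk
          rw [hY, flow_even _ _ hk1, flow_odd _ _ hk1, ← hY]
          have h1 := abs_add_le ((U k ω).1.1 * Y k) (U k ω).2.1
          have h2 := abs_add_le ((U k ω).1.2 * Y k) (U k ω).2.2
          rw [abs_mul] at h1 h2
          simp only [hφ]
          linarith
      _ = M * ∑ k ∈ generation n, |Y k| + ∑ k ∈ generation n, |Y k| * (φ (U k ω) - M)
            + ∑ k ∈ generation n, (|(U k ω).2.1| + |(U k ω).2.2|) := by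
          rw [Finset.sum_add_distrib, Finset.sum_add_distrib, Finset.mul_sum]
      _ ≤ (1 + m) * (R * 2 ^ n) + C₁ * 2 ^ n + C₂ * 2 ^ n := by
          have h0 : 0 ≤ ∑ k ∈ generation n, |Y k| := Finset.sum_nonneg fun _ _ => abs_nonneg _
          have h3 : M * ∑ k ∈ generation n, |Y k| ≤ (1 + m) * (R * 2 ^ n) :=
            (mul_le_mul_of_nonneg_right hM1 h0).trans
              (mul_le_mul_of_nonneg_left ih (by linarith))
          exact add_le_add (add_le_add h3 (hC₁' n))
            ((Finset.sum_le_sum fun k _ => le_abs_self _).trans (hC₂ n))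
      _ ≤ R * 2 ^ (n + 1) := by
          have : (0 : ℝ) < 2 ^ n := by positivity
          rw [pow_succ]
          nlinarith

theorem IsContractive.ae_sum_abs_path_le [IsProbabilityMeasure P] (hU : IsContractive P ℋ U m) :
    ∀ᵐ ω ∂P, ∀ t : ℝ, ∃ C : ℝ, ∀ n, ∑ k ∈ generation n, |path (fun j => U j ω) t k| ≤ C * 2 ^ n := by
  filter_upwards [hU.ae_sum_abs_flow_le, hU.ae_slope_tendsto] with ω ⟨C, hC⟩ hs t
  obtain ⟨C₁, hC₁⟩ := hs.bddAbove_range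
  refine ⟨C + |t| * C₁, fun n => ?_⟩
  have h1 : ∑ k ∈ generation n, |slope (fun j => U j ω) k| ≤ C₁ * 2 ^ n :=
    (div_le_iff₀ (by positivity)).1 (hC₁ ⟨n, rfl⟩)
  calc _ ≤ ∑ k ∈ generation n, (|flow (fun j => U j ω) 0 k| + |t| * |slope (fun j => U j ω) k|) :=
        Finset.sum_le_sum fun k _ => by
          rw [← abs_mul]
          exact abs_add_le _ _
    _ = _ := by rw [Finset.sum_add_distrib, ← Finset.mul_sum]
    _ ≤ C * 2 ^ n + |t| * (C₁ * 2 ^ n) :=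
        add_le_add (hC n) (mul_le_mul_of_nonneg_left h1 (abs_nonneg t))
    _ = _ := by ring

/-- Sum over both children of the expected value of `q`, given the value `x` of the parent. -/
noncomputable def transfer (P : Measure Ω) (V : Ω → Innov) (q : ℝ → ℝ) (x : ℝ) : ℝ :=
  ∫ ω, (q ((V ω).1.1 * x + (V ω).2.1) + q ((V ω).1.2 * x + (V ω).2.2)) ∂P

theorem transfer_integrable [IsProbabilityMeasure P] {V : Ω → Innov} (hV : Measurable V)
    {q : ℝ → ℝ} (hq : Continuous q) {B : ℝ} (hB : ∀ x, |q x| ≤ B) (x : ℝ) :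
    Integrable (fun ω => q ((V ω).1.1 * x + (V ω).2.1) + q ((V ω).1.2 * x + (V ω).2.2)) P := by
  have hqm := hq.measurable
  refine Integrable.of_bound (C := B + B) (by fun_prop) (ae_of_all _ fun ω => ?_)
  exact (norm_add_le _ _).trans (add_le_add (hB _) (hB _))

theorem abs_transfer_le [IsProbabilityMeasure P] {V : Ω → Innov} {q : ℝ → ℝ} {B : ℝ}
    (hB : ∀ x, |q x| ≤ B) (x : ℝ) : |transfer P V q x| ≤ 2 * B := by
  have := norm_integral_le_of_norm_le_const (μ := P) (C := B + B)
    (f := fun ω => q ((V ω).1.1 * x + (V ω).2.1) + q ((V ω).1.2 * x + (V ω).2.2))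
    (ae_of_all _ fun ω => (norm_add_le _ _).trans (add_le_add (hB _) (hB _)))
  rw [probReal_univ, mul_one, ← two_mul] at this
  exact this

theorem transfer_nonneg {V : Ω → Innov} {q : ℝ → ℝ} (hq : ∀ x, 0 ≤ q x) (x : ℝ) :
    0 ≤ transfer P V q x :=
  integral_nonneg fun _ => add_nonneg (hq _) (hq _)

/-- Lipschitz regularity survives the transfer because the mean of `|a| + |b|` is at most `2`; this
permits a second application of the law of large numbers. -/
theorem IsContractive.transfer_lipschitz [IsProbabilityMeasure P] (hU : IsContractive P ℋ U m)
    {q : ℝ → ℝ} (hq : Continuous q) {B L : ℝ} (hB : ∀ x, |q x| ≤ B)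
    (hL : ∀ x y, |q x - q y| ≤ L * |x - y|) (hL0 : 0 ≤ L) (x y : ℝ) :
    |transfer P (U 1) q x - transfer P (U 1) q y| ≤ 2 * L * |x - y| := by
  have hV := hU.toIsInnovation.measurable le_rfl
  have hab : Integrable (fun ω => |(U 1 ω).1.1| + |(U 1 ω).1.2|) P :=
    (hU.memLp_a.integrable (by norm_num)).abs.add (hU.memLp_b.integrable (by norm_num)).abs
  rw [transfer, transfer, ← integral_sub (transfer_integrable hV hq hB x)
    (transfer_integrable hV hq hB y)]
  rw [← Real.norm_eq_abs]
  calc _ ≤ ∫ ω, L * |x - y| * (|(U 1 ω).1.1| + |(U 1 ω).1.2|) ∂P := by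
        refine norm_integral_le_of_norm_le (hab.const_mul _) (ae_of_all _ fun ω => ?_)
        have h1 := hL ((U 1 ω).1.1 * x + (U 1 ω).2.1) ((U 1 ω).1.1 * y + (U 1 ω).2.1)
        have h2 := hL ((U 1 ω).1.2 * x + (U 1 ω).2.2) ((U 1 ω).1.2 * y + (U 1 ω).2.2)
        rw [add_sub_add_right_eq_sub, ← mul_sub, abs_mul] at h1 h2
        rw [Real.norm_eq_abs, add_sub_add_comm]
        refine (abs_add_le _ _).trans ((add_le_add h1 h2).trans (le_of_eq ?_))
        ring
    _ ≤ L * |x - y| * 2 := by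
        rw [integral_const_mul]
        exact mul_le_mul_of_nonneg_left (hU.integral_abs_add_le.trans (by linarith [hU.m_lt]))
          (by positivity)
    _ = _ := by ring

theorem continuous_of_lipschitz {q : ℝ → ℝ} {L : ℝ} (hL : ∀ x y, |q x - q y| ≤ L * |x - y|) :
    Continuous q :=
  (LipschitzWith.of_dist_le' (K := L) fun x y => by
    simpa [Real.dist_eq] using hL x y).continuous

/-- Law of large numbers over the generations for bounded Lipschitz functions, simultaneously for
all trajectories. -/
theorem IsContractive.ae_transfer_tendsto [IsProbabilityMeasure P] (hU : IsContractive P ℋ U m)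
    {q : ℝ → ℝ} {B L : ℝ} (hB : ∀ x, |q x| ≤ B)
    (hL : ∀ x y, |q x - q y| ≤ L * |x - y|) (hL0 : 0 ≤ L) :
    ∀ᵐ ω ∂P, ∀ t : ℝ, Tendsto (fun n => (∑ k ∈ generation (n + 1), q (path (fun j => U j ω) t k)
      - ∑ k ∈ generation n, transfer P (U 1) q (path (fun j => U j ω) t k)) / 2 ^ n)
      atTop (𝓝 0) := by
  have hq := continuous_of_lipschitz hL
  have hqm := hq.measurable
  set F : ℝ → Innov → ℝ := fun y u => q (u.1.1 * y + u.2.1) + q (u.1.2 * y + u.2.2) with hF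
  have hFm : Measurable (Function.uncurry F) := by
    simp only [hF, Function.uncurry_def]
    fun_prop
  have hFB : ∀ y u, |F y u| ≤ 2 * B := fun y u =>
    (abs_add_le _ _).trans (by linarith [hB (u.1.1 * y + u.2.1), hB (u.1.2 * y + u.2.2)])
  -- The law of large numbers is first a martingale statement for the start `0`; the Lipschitz
  -- bounds and the vanishing average slope then carry it to every `t`.
  have hMD := hU.isMartingaleDiff_comp hFm hFB
    (w := fun k ω => flow (fun j => U j ω) 0 k) (fun k hk => hU.measurable_flow 0 hk)
  have hlim := hMD.ae_sum_generation_tendsto hU.mono (C := (4 * B) ^ 2) fun k hk => by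
    have := integral_mono (hMD.memLp k hk).integrable_sq (integrable_const ((4 * B) ^ 2))
      fun ω => by
        refine sq_le_sq.2 ((abs_sub _ _).trans (le_trans ?_ (le_abs_self (4 * B))))
        have h1 := hFB (flow (fun j => U j ω) 0 k) (U k ω)
        have h2 : |∫ ω', F (flow (fun j => U j ω) 0 k) (U 1 ω') ∂P| ≤ 2 * B :=
          abs_transfer_le hB _
        linarith
    simpa using this
  filter_upwards [hlim, hU.ae_slope_tendsto] with ω hω hs t
  set S : ℕ → ℝ := fun n => (∑ k ∈ generation n, |slope (fun j => U j ω) k|) / 2 ^ n with hS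
  have hdom : Tendsto (fun n => |(∑ k ∈ generation n, (F (flow (fun j => U j ω) 0 k) (U k ω)
      - ∫ ω', F (flow (fun j => U j ω) 0 k) (U 1 ω') ∂P)) / 2 ^ n|
      + (2 * L * |t| * S (n + 1) + 2 * L * |t| * S n)) atTop (𝓝 0) := by
    have h1 := hω.abs
    have h2 := ((tendsto_add_atTop_iff_nat 1).2 hs).const_mul (2 * L * |t|)
    have h3 := hs.const_mul (2 * L * |t|)
    simpa using h1.add (h2.add h3)
  refine squeeze_zero_norm (fun n => ?_) hdom
  set y := flow (fun j => U j ω) 0 with hy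
  set x := path (fun j => U j ω) t with hx
  set T := transfer P (U 1) q with hT
  have hxy : ∀ k, x k - y k = t * slope (fun j => U j ω) k := fun k => by
    rw [hx, path, hy]; ring
  have e1 : ∑ k ∈ generation n, F (y k) (U k ω) = ∑ k ∈ generation (n + 1), q (y k) := by
    rw [sum_generation_succ]
    refine Finset.sum_congr rfl fun k hk => ?_
    have hk1 := one_le_of_mem_generation hk
    rw [hy, flow_even _ _ hk1, flow_odd _ _ hk1]
  have e2 : ∑ k ∈ generation (n + 1), q (x k) - ∑ k ∈ generation n, T (x k)
      = ∑ k ∈ generation n, (F (y k) (U k ω) - T (y k))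
        + (∑ k ∈ generation (n + 1), (q (x k) - q (y k))
          - ∑ k ∈ generation n, (T (x k) - T (y k))) := by
    simp only [Finset.sum_sub_distrib, e1]
    ring
  have b1 : |∑ k ∈ generation (n + 1), (q (x k) - q (y k))|
      ≤ L * |t| * ∑ k ∈ generation (n + 1), |slope (fun j => U j ω) k| := by
    rw [Finset.mul_sum]
    refine (Finset.abs_sum_le_sum_abs _ _).trans (Finset.sum_le_sum fun k _ => ?_)
    have := hL (x k) (y k)
    rwa [hxy, abs_mul, ← mul_assoc] at this
  have b2 : |∑ k ∈ generation n, (T (x k) - T (y k))|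
      ≤ 2 * L * |t| * ∑ k ∈ generation n, |slope (fun j => U j ω) k| := by
    rw [Finset.mul_sum]
    refine (Finset.abs_sum_le_sum_abs _ _).trans (Finset.sum_le_sum fun k _ => ?_)
    have := hU.transfer_lipschitz hq hB hL hL0 (x k) (y k)
    rwa [hxy, abs_mul, ← mul_assoc] at this
  rw [e2, add_div, Real.norm_eq_abs]
  refine (abs_add_le _ _).trans (add_le_add le_rfl ?_)
  rw [abs_div, abs_of_pos (show (0 : ℝ) < 2 ^ n by positivity), div_le_iff₀ (by positivity)]
  refine (abs_sub _ _).trans ((add_le_add b1 b2).trans (le_of_eq ?_))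
  simp only [hS]
  field_simp
  ring

end Tightness

/-! ## The weights `x^p / (1 + x²)²` -/

section Weights

/-- The weight `x^p / (1 + x²)²`. -/
noncomputable def wt (p : ℕ) (x : ℝ) : ℝ := x ^ p / (1 + x ^ 2) ^ 2

/-- The derivative of `wt p`. -/
noncomputable def wtDeriv (p : ℕ) (x : ℝ) : ℝ :=
  p * x ^ (p - 1) / (1 + x ^ 2) ^ 2 - 4 * (x ^ (p + 1) / (1 + x ^ 2) ^ 3)

theorem abs_pow_div_le_one {p i : ℕ} (hp : p ≤ 2 * i) (x : ℝ) :
    |x ^ p / (1 + x ^ 2) ^ i| ≤ 1 := by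
  rw [abs_div, abs_pow, abs_of_pos (show (0 : ℝ) < (1 + x ^ 2) ^ i by positivity),
    div_le_one (by positivity)]
  rcases le_total |x| 1 with h | h
  · exact (pow_le_one₀ (abs_nonneg x) h).trans (one_le_pow₀ (by nlinarith [sq_nonneg x]))
  · calc |x| ^ p ≤ |x| ^ (2 * i) := pow_le_pow_right₀ h hp
      _ = (x ^ 2) ^ i := by rw [pow_mul, sq_abs]
      _ ≤ _ := pow_le_pow_left₀ (sq_nonneg x) (by linarith) i

theorem abs_wt_le {p : ℕ} (hp : p ≤ 4) (x : ℝ) : |wt p x| ≤ 1 :=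
  abs_pow_div_le_one (i := 2) hp x

theorem hasDerivAt_wt (p : ℕ) (x : ℝ) : HasDerivAt (wt p) (wtDeriv p x) x := by
  have h1 : HasDerivAt (fun x : ℝ => (1 + x ^ 2) ^ 2) (2 * (1 + x ^ 2) * (2 * x)) x := by
    have := (((hasDerivAt_pow 2 x).const_add 1).fun_pow 2)
    simpa using this
  have h2 := (hasDerivAt_pow p x).div h1 (by positivity)
  have h3 : HasDerivAt (wt p) _ x := h2
  convert h3 using 1
  have : (1 + x ^ 2) ≠ 0 := by positivity
  rw [wtDeriv]
  field_simp
  ring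

theorem continuous_wtDeriv (p : ℕ) : Continuous (wtDeriv p) := by
  have h : ∀ x : ℝ, (1 + x ^ 2) ≠ 0 := fun x => by positivity
  unfold wtDeriv
  refine ((by fun_prop : Continuous fun x : ℝ => (p : ℝ) * x ^ (p - 1)).div (by fun_prop)
    fun x => pow_ne_zero 2 (h x)).sub (continuous_const.mul
    ((by fun_prop : Continuous fun x : ℝ => x ^ (p + 1)).div (by fun_prop)
    fun x => pow_ne_zero 3 (h x)))

theorem abs_wtDeriv_le {p : ℕ} (hp : p ≤ 4) (x : ℝ) : |wtDeriv p x| ≤ 8 := by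
  have h1 := abs_pow_div_le_one (p := p - 1) (i := 2) (by omega) x
  have h2 := abs_pow_div_le_one (p := p + 1) (i := 3) (by omega) x
  rw [wtDeriv, mul_div_assoc]
  refine (abs_sub _ _).trans ?_
  rw [abs_mul, abs_mul, Nat.abs_cast, abs_of_pos (show (0 : ℝ) < 4 by norm_num)]
  have hp' : (p : ℝ) ≤ 4 := by exact_mod_cast hp
  nlinarith [mul_le_mul hp' h1 (abs_nonneg _) (by norm_num)]

theorem wt_lipschitz {p : ℕ} (hp : p ≤ 4) (x y : ℝ) : |wt p x - wt p y| ≤ 8 * |x - y| :=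
  convex_univ.norm_image_sub_le_of_norm_hasDerivWithin_le
    (fun z _ => (hasDerivAt_wt p z).hasDerivWithinAt) (fun z _ => abs_wtDeriv_le hp z)
    (Set.mem_univ y) (Set.mem_univ x)

/-- The summand of the quadratic form of the second-stage Gram matrix. -/
noncomputable def gramForm (u v x : ℝ) : ℝ := (u * x ^ 2 + v) ^ 2 / (1 + x ^ 2) ^ 2

/-- Control of the three functions `wt 4`, `wt 2`, `wt 0` thus gives control uniform in `(u, v)`. -/
theorem gramForm_eq (u v x : ℝ) :
    gramForm u v x = u ^ 2 * wt 4 x + 2 * u * v * wt 2 x + v ^ 2 * wt 0 x := by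
  simp only [gramForm, wt]
  ring

theorem gramForm_nonneg (u v x : ℝ) : 0 ≤ gramForm u v x := by
  unfold gramForm
  positivity

theorem gramForm_eq_zero {u v x : ℝ} (h : gramForm u v x = 0) : u * x ^ 2 + v = 0 := by
  have h1 : (1 + x ^ 2) ^ 2 ≠ 0 := by positivity
  rw [gramForm, div_eq_zero_iff, or_iff_left h1] at h
  exact pow_eq_zero_iff two_ne_zero |>.1 h

end Weights

/-! ## Nondegeneracy of the Gram matrices -/

section Nondegenerate

variable {Ω : Type*} [mΩ : MeasurableSpace Ω] {P : Measure Ω} {ℋ : ℕ → MeasurableSpace Ω}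
  {U : ℕ → Ω → Innov} {m : ℝ}

/-- Innovations with fourth moments, independent coefficients and noises, and a nondegenerate
noise. -/
structure IsNondegenerate (P : Measure Ω) (ℋ : ℕ → MeasurableSpace Ω) (U : ℕ → Ω → Innov)
    (m : ℝ) : Prop extends IsContractive P ℋ U m where
  memLp4_a : MemLp (fun ω => (U 1 ω).1.1) 4 P
  memLp4_b : MemLp (fun ω => (U 1 ω).1.2) 4 P
  memLp4_c : MemLp (fun ω => (U 1 ω).2.1) 4 P
  memLp4_d : MemLp (fun ω => (U 1 ω).2.2) 4 P
  indepFun : IndepFun (fun ω => (U 1 ω).1) (fun ω => (U 1 ω).2) P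
  var_c : 0 < ∫ ω, ((U 1 ω).2.1 - ∫ ω', (U 1 ω').2.1 ∂P) ^ 2 ∂P
  nondeg_c : (∫ ω, (U 1 ω).2.1 ^ 2 ∂P) ^ 2 < ∫ ω, (U 1 ω).2.1 ^ 4 ∂P

/-- Otherwise `a x + ε` would be almost surely constant. Multiplying this relation by the centred
noise and integrating, independence of `a` and `ε` would force the variance of the noise to vanish.
-/
theorem IsNondegenerate.exists_ne [IsProbabilityMeasure P] (hU : IsNondegenerate P ℋ U m)
    {p : ℝ → Prop} (x : ℝ) (h : ∀ᵐ ω ∂P, p ((U 1 ω).1.1 * x + (U 1 ω).2.1)) :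
    ∃ y z, y ≠ z ∧ p y ∧ p z := by
  by_contra! hcon
  obtain ⟨ω₀, hω₀⟩ := h.exists
  set y₀ := (U 1 ω₀).1.1 * x + (U 1 ω₀).2.1
  have hy : ∀ᵐ ω ∂P, (U 1 ω).1.1 * x + (U 1 ω).2.1 = y₀ := by
    filter_upwards [h] with ω hω
    by_contra hne
    exact hcon _ _ hne hω hω₀
  set c := ∫ ω', (U 1 ω').2.1 ∂P with hc
  have hci : Integrable (fun ω => (U 1 ω).2.1) P := hU.memLp_c.integrable (by norm_num)
  have hcc : MemLp (fun ω => (U 1 ω).2.1 - c) 2 P := hU.memLp_c.sub (memLp_const c)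
  have hc0 : ∫ ω, ((U 1 ω).2.1 - c) ∂P = 0 := by
    rw [integral_sub hci (integrable_const c)]
    simp [hc]
  have hind := (hU.indepFun.comp (φ := fun z : ℝ × ℝ => z.1) (ψ := fun z : ℝ × ℝ => z.1 - c)
    (by fun_prop) (by fun_prop)).integral_fun_mul_eq_mul_integral hU.memLp_a.1 hcc.1
  simp only [Function.comp_apply] at hind
  rw [hc0, mul_zero] at hind
  have hai : Integrable (fun ω => (U 1 ω).1.1 * ((U 1 ω).2.1 - c)) P :=
    hU.memLp_a.integrable_mul hcc
  have e : ∫ ω, ((U 1 ω).2.1 - c) ^ 2 ∂P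
      = ∫ ω, ((y₀ - c) * ((U 1 ω).2.1 - c) - x * ((U 1 ω).1.1 * ((U 1 ω).2.1 - c))) ∂P := by
    refine integral_congr_ae ?_
    filter_upwards [hy] with ω hω
    rw [← hω]
    ring
  have := hU.var_c
  rw [e, integral_sub ((hcc.integrable (by norm_num)).const_mul _) (hai.const_mul x),
    integral_const_mul, integral_const_mul, hind, hc0] at this
  simp at this

/-- Subtracting the two equations leaves `a (a (y + z) + 2 ε) = 0`. Testing against `a (ε - c)`
gives `2 E[a²] Var ε = 0`, so `a = 0` almost surely. Then `ε²` is constant, against `nondeg_c`. -/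
theorem IsNondegenerate.not_ae_two_zeros [IsProbabilityMeasure P] (hU : IsNondegenerate P ℋ U m)
    {u v y z : ℝ} (huv : u ≠ 0 ∨ v ≠ 0) (hyz : y ≠ z)
    (hy : ∀ᵐ ω ∂P, u * ((U 1 ω).1.1 * y + (U 1 ω).2.1) ^ 2 + v = 0)
    (hz : ∀ᵐ ω ∂P, u * ((U 1 ω).1.1 * z + (U 1 ω).2.1) ^ 2 + v = 0) : False := by
  have hu : u ≠ 0 := by
    rintro rfl
    obtain ⟨ω, hω⟩ := hy.exists
    simp at hω
    simp [hω] at huv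
  set A : Ω → ℝ := fun ω => (U 1 ω).1.1 with hA
  set e : Ω → ℝ := fun ω => (U 1 ω).2.1 with he
  set c := ∫ ω', e ω' ∂P with hc
  have hA4 : MemLp A 4 P := hU.memLp4_a
  have he4 : MemLp e 4 P := hU.memLp4_c
  have hA2 : MemLp A 2 P := hU.memLp_a
  have he2 : MemLp e 2 P := hU.memLp_c
  have hci : Integrable e P := he2.integrable (by norm_num)
  have hec : MemLp (fun ω => e ω - c) 2 P := he2.sub (memLp_const c)
  have hc0 : ∫ ω, (e ω - c) ∂P = 0 := by
    rw [integral_sub hci (integrable_const c)]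
    simp [hc]
  have hAe : IndepFun A e P := hU.indepFun.comp (φ := Prod.fst) (ψ := Prod.fst)
    measurable_fst measurable_fst
  have hzero : ∀ᵐ ω ∂P, A ω * (A ω * (y + z) + 2 * e ω) = 0 := by
    filter_upwards [hy, hz] with ω h1 h2
    have h3 : (u * (y - z)) * (A ω * (A ω * (y + z) + 2 * e ω)) = 0 := by
      simp only [hA, he]
      linear_combination h1 - h2
    exact (mul_eq_zero.1 h3).resolve_left (mul_ne_zero hu (sub_ne_zero.2 hyz))
  -- The test function `A * (e - c)` produces a third power of the coefficient.
  have hA3 : Integrable (fun ω => A ω ^ 3) P := by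
    have h3 : MemLp A 3 P := hA4.mono_exponent (by norm_num)
    have := h3.integrable_norm_pow (by norm_num)
    refine this.mono (hA2.1.pow 3) (ae_of_all _ fun ω => ?_)
    simp
  have i1 : Integrable (fun ω => A ω ^ 3 * (e ω - c)) P :=
    (hAe.comp (φ := fun a => a ^ 3) (ψ := fun t => t - c) (by fun_prop)
      (by fun_prop)).integrable_mul hA3 (hec.integrable (by norm_num))
  have hqi : Integrable (fun ω => e ω * (e ω - c)) P := he2.integrable_mul hec
  have hqm : Measurable fun t : ℝ => t * (t - c) := by fun_prop
  have i2 : Integrable (fun ω => A ω ^ 2 * (e ω * (e ω - c))) P :=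
    (hAe.comp (φ := fun a => a ^ 2) (ψ := fun t => t * (t - c)) (by fun_prop)
      hqm).integrable_mul hA2.integrable_sq hqi
  have j1 : ∫ ω, A ω ^ 3 * (e ω - c) ∂P = 0 := by
    have := (hAe.comp (φ := fun a => a ^ 3) (ψ := fun t => t - c) (by fun_prop)
      (by fun_prop)).integral_fun_mul_eq_mul_integral hA3.1 hec.1
    simp only [Function.comp_apply] at this
    rw [this, hc0, mul_zero]
  have hvar : ∫ ω, e ω * (e ω - c) ∂P = ∫ ω, (e ω - c) ^ 2 ∂P := by
    have : ∀ ω, e ω * (e ω - c) = (e ω - c) ^ 2 + c * (e ω - c) := fun ω => by ring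
    simp_rw [this]
    rw [integral_add hec.integrable_sq ((hec.integrable (by norm_num)).const_mul c),
      integral_const_mul, hc0]
    ring
  have j2 : ∫ ω, A ω ^ 2 * (e ω * (e ω - c)) ∂P
      = (∫ ω, A ω ^ 2 ∂P) * ∫ ω, (e ω - c) ^ 2 ∂P := by
    have := (hAe.comp (φ := fun a => a ^ 2) (ψ := fun t => t * (t - c)) (by fun_prop)
      hqm).integral_fun_mul_eq_mul_integral hA2.integrable_sq.1 hqi.1
    simp only [Function.comp_apply] at this
    rw [this, hvar]
  have hsum : ∫ ω, ((y + z) * (A ω ^ 3 * (e ω - c)) + 2 * (A ω ^ 2 * (e ω * (e ω - c)))) ∂P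
      = 0 := by
    refine integral_eq_zero_of_ae ?_
    filter_upwards [hzero] with ω hω
    simp only [Pi.zero_apply]
    linear_combination A ω * (e ω - c) * hω
  rw [integral_add (i1.const_mul _) (i2.const_mul _), integral_const_mul, integral_const_mul, j1,
    j2] at hsum
  have hvar0 : 0 < ∫ ω, (e ω - c) ^ 2 ∂P := hU.var_c
  have hA0 : ∫ ω, A ω ^ 2 ∂P = 0 := by
    by_contra hne
    have := mul_ne_zero hne hvar0.ne'
    apply this
    linarith
  have hAz : ∀ᵐ ω ∂P, A ω = 0 := by
    filter_upwards [(integral_eq_zero_iff_of_nonneg (fun ω => sq_nonneg (A ω))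
      hA2.integrable_sq).1 hA0] with ω hω
    simpa using hω
  have hesq : ∀ᵐ ω ∂P, e ω ^ 2 = -v / u := by
    filter_upwards [hAz, hy] with ω h1 h2
    have h1' : (U 1 ω).1.1 = 0 := h1
    rw [h1', zero_mul, zero_add] at h2
    rw [eq_div_iff hu]
    linear_combination h2
  have k1 : ∫ ω, e ω ^ 2 ∂P = -v / u := by
    rw [integral_congr_ae hesq]
    simp
  have k2 : ∫ ω, e ω ^ 4 ∂P = (-v / u) ^ 2 := by
    have : ∀ᵐ ω ∂P, e ω ^ 4 = (-v / u) ^ 2 := by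
      filter_upwards [hesq] with ω h
      rw [← h]
      ring
    rw [integral_congr_ae this]
    simp
  have := hU.nondeg_c
  rw [show (fun ω => (U 1 ω).2.1 ^ 2) = fun ω => e ω ^ 2 from rfl,
    show (fun ω => (U 1 ω).2.1 ^ 4) = fun ω => e ω ^ 4 from rfl, k1, k2] at this
  exact lt_irrefl _ this

theorem ae_eq_zero_of_transfer [IsProbabilityMeasure P] {V : Ω → Innov} (hV : Measurable V)
    {q : ℝ → ℝ} (hq : Continuous q) (hq0 : ∀ x, 0 ≤ q x) {B : ℝ} (hB : ∀ x, |q x| ≤ B) {x : ℝ}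
    (h : transfer P V q x = 0) : ∀ᵐ ω ∂P, q ((V ω).1.1 * x + (V ω).2.1) = 0 := by
  filter_upwards [(integral_eq_zero_iff_of_nonneg (fun ω => add_nonneg (hq0 _) (hq0 _))
    (transfer_integrable hV hq hB x)).1 h] with ω hω
  have : q ((V ω).1.1 * x + (V ω).2.1) + q ((V ω).1.2 * x + (V ω).2.2) = 0 := hω
  linarith [hq0 ((V ω).1.1 * x + (V ω).2.1), hq0 ((V ω).1.2 * x + (V ω).2.2)]

theorem transfer_lin [IsProbabilityMeasure P] {V : Ω → Innov} (hV : Measurable V)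
    {q₁ q₂ q₃ : ℝ → ℝ} (h₁ : Continuous q₁) (h₂ : Continuous q₂) (h₃ : Continuous q₃) {B : ℝ}
    (hB₁ : ∀ x, |q₁ x| ≤ B) (hB₂ : ∀ x, |q₂ x| ≤ B) (hB₃ : ∀ x, |q₃ x| ≤ B) (r s t x : ℝ) :
    transfer P V (fun x => r * q₁ x + s * q₂ x + t * q₃ x) x
      = r * transfer P V q₁ x + s * transfer P V q₂ x + t * transfer P V q₃ x := by
  have i₁ := transfer_integrable (P := P) hV h₁ hB₁ x
  have i₂ := transfer_integrable (P := P) hV h₂ hB₂ x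
  have i₃ := transfer_integrable (P := P) hV h₃ hB₃ x
  simp only [transfer]
  rw [← integral_const_mul, ← integral_const_mul, ← integral_const_mul,
    ← integral_add (i₁.const_mul r) (i₂.const_mul s)]
  refine Eq.trans (integral_congr_ae (ae_of_all _ fun ω => ?_))
    (integral_add ((i₁.const_mul r).add (i₂.const_mul s)) (i₃.const_mul t))
  ring

/-- The quadratic form of the second-stage Gram matrix, averaged over two generations. -/
noncomputable def meanForm (P : Measure Ω) (V : Ω → Innov) (u v x : ℝ) : ℝ :=
  u ^ 2 * transfer P V (transfer P V (wt 4)) x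
    + 2 * u * v * transfer P V (transfer P V (wt 2)) x
    + v ^ 2 * transfer P V (transfer P V (wt 0)) x

theorem continuous_wt (p : ℕ) : Continuous (wt p) :=
  continuous_iff_continuousAt.2 fun x => (hasDerivAt_wt p x).continuousAt

theorem IsContractive.transfer_wt_lipschitz [IsProbabilityMeasure P]
    (hU : IsContractive P ℋ U m) {p : ℕ} (hp : p ≤ 4) (x y : ℝ) :
    |transfer P (U 1) (wt p) x - transfer P (U 1) (wt p) y| ≤ 2 * 8 * |x - y| :=
  hU.transfer_lipschitz (continuous_wt p) (abs_wt_le hp) (wt_lipschitz hp) (by norm_num) x y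

theorem IsContractive.continuous_transfer_wt [IsProbabilityMeasure P]
    (hU : IsContractive P ℋ U m) {p : ℕ} (hp : p ≤ 4) :
    Continuous (transfer P (U 1) (wt p)) :=
  continuous_of_lipschitz (hU.transfer_wt_lipschitz hp)

theorem IsContractive.continuous_transfer_transfer_wt [IsProbabilityMeasure P]
    (hU : IsContractive P ℋ U m) {p : ℕ} (hp : p ≤ 4) :
    Continuous (transfer P (U 1) (transfer P (U 1) (wt p))) :=
  continuous_of_lipschitz (hU.transfer_lipschitz (hU.continuous_transfer_wt hp)
    (abs_transfer_le (abs_wt_le hp)) (hU.transfer_wt_lipschitz hp) (by norm_num))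

theorem IsContractive.transfer_gramForm [IsProbabilityMeasure P]
    (hU : IsContractive P ℋ U m) (u v : ℝ) :
    transfer P (U 1) (gramForm u v) = fun x => u ^ 2 * transfer P (U 1) (wt 4) x
      + 2 * u * v * transfer P (U 1) (wt 2) x + v ^ 2 * transfer P (U 1) (wt 0) x := by
  funext x
  rw [show gramForm u v = fun x => _ from funext fun x => gramForm_eq u v x]
  exact transfer_lin (hU.toIsInnovation.measurable le_rfl) (continuous_wt 4) (continuous_wt 2)
    (continuous_wt 0) (abs_wt_le le_rfl) (abs_wt_le (by norm_num)) (abs_wt_le (by norm_num)) _ _ _ x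

theorem IsContractive.meanForm_eq [IsProbabilityMeasure P]
    (hU : IsContractive P ℋ U m) (u v x : ℝ) :
    meanForm P (U 1) u v x = transfer P (U 1) (transfer P (U 1) (gramForm u v)) x := by
  rw [hU.transfer_gramForm, transfer_lin (hU.toIsInnovation.measurable le_rfl)
    (hU.continuous_transfer_wt le_rfl) (hU.continuous_transfer_wt (by norm_num))
    (hU.continuous_transfer_wt (by norm_num)) (abs_transfer_le (abs_wt_le le_rfl))
    (abs_transfer_le (abs_wt_le (by norm_num))) (abs_transfer_le (abs_wt_le (by norm_num)))]
  rfl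

theorem IsContractive.meanForm_nonneg [IsProbabilityMeasure P]
    (hU : IsContractive P ℋ U m) (u v x : ℝ) : 0 ≤ meanForm P (U 1) u v x := by
  rw [hU.meanForm_eq]
  exact transfer_nonneg (fun _ => transfer_nonneg (gramForm_nonneg u v) _) _

theorem abs_gramForm_le (u v x : ℝ) : |gramForm u v x| ≤ u ^ 2 + |2 * u * v| + v ^ 2 := by
  rw [gramForm_eq]
  have h4 := abs_wt_le (p := 4) le_rfl x
  have h2 := abs_wt_le (p := 2) (by norm_num) x
  have h0 := abs_wt_le (p := 0) (by norm_num) x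
  refine (abs_add_three _ _ _).trans ?_
  rw [abs_mul, abs_mul (2 * u * v), abs_mul (v ^ 2), abs_of_nonneg (sq_nonneg u),
    abs_of_nonneg (sq_nonneg v)]
  exact add_le_add (add_le_add (mul_le_of_le_one_right (sq_nonneg _) h4)
    (mul_le_of_le_one_right (abs_nonneg _) h2)) (mul_le_of_le_one_right (sq_nonneg _) h0)

/-- One transfer may still vanish at a point, for instance with constant coefficients and two-valued
noises. If the second transfer vanished at `x`, the first would vanish at two distinct possible
children of `x`, which `not_ae_two_zeros` excludes. -/
theorem IsNondegenerate.meanForm_pos [IsProbabilityMeasure P] (hU : IsNondegenerate P ℋ U m)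
    {u v : ℝ} (huv : u ≠ 0 ∨ v ≠ 0) (x : ℝ) : 0 < meanForm P (U 1) u v x := by
  refine (hU.meanForm_nonneg u v x).lt_of_ne fun h0 => ?_
  rw [hU.meanForm_eq] at h0
  have hV := hU.toIsInnovation.measurable le_rfl
  have hg : Continuous (gramForm u v) := by
    rw [show gramForm u v = fun x => _ from funext fun x => gramForm_eq u v x]
    have := continuous_wt 4
    have := continuous_wt 2
    have := continuous_wt 0
    fun_prop
  have hTg : Continuous (transfer P (U 1) (gramForm u v)) := by
    rw [hU.transfer_gramForm]
    have := hU.continuous_transfer_wt (p := 4) le_rfl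
    have := hU.continuous_transfer_wt (p := 2) (by norm_num)
    have := hU.continuous_transfer_wt (p := 0) (by norm_num)
    fun_prop
  have h1 := ae_eq_zero_of_transfer hV hTg (fun _ => transfer_nonneg (gramForm_nonneg u v) _)
    (abs_transfer_le (abs_gramForm_le u v)) h0.symm
  obtain ⟨y, z, hyz, hy, hz⟩ := hU.exists_ne (p := fun y => transfer P (U 1) (gramForm u v) y = 0)
    x h1
  have h2 := ae_eq_zero_of_transfer hV hg (gramForm_nonneg u v) (abs_gramForm_le u v) hy
  have h3 := ae_eq_zero_of_transfer hV hg (gramForm_nonneg u v) (abs_gramForm_le u v) hz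
  exact hU.not_ae_two_zeros huv hyz (h2.mono fun ω h => gramForm_eq_zero h)
    (h3.mono fun ω h => gramForm_eq_zero h)

/-- Compactness of the unit circle times `[-K, K]`, then homogeneity of degree two in `(u, v)`. -/
theorem IsNondegenerate.exists_meanForm_ge [IsProbabilityMeasure P]
    (hU : IsNondegenerate P ℋ U m) (K : ℝ) : ∃ c : ℝ, 0 < c ∧ ∀ u v x : ℝ, |x| ≤ K →
      c * (u ^ 2 + v ^ 2) ≤ meanForm P (U 1) u v x := by
  rcases lt_or_ge K 0 with hK | hK
  · exact ⟨1, one_pos, fun u v x hx => absurd (abs_nonneg x) (by linarith)⟩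
  set S : Set (ℝ × ℝ × ℝ) := {z | z.1 ^ 2 + z.2.1 ^ 2 = 1 ∧ |z.2.2| ≤ K} with hS
  have hScl : IsClosed S :=
    (isClosed_eq (f := fun z : ℝ × ℝ × ℝ => z.1 ^ 2 + z.2.1 ^ 2) (by fun_prop)
      continuous_const).inter
      (isClosed_le (f := fun z : ℝ × ℝ × ℝ => |z.2.2|) (by fun_prop) continuous_const)
  have hSc : IsCompact S := by
    refine IsCompact.of_isClosed_subset ((isCompact_Icc (a := (-1 : ℝ)) (b := 1)).prod
      ((isCompact_Icc (a := (-1 : ℝ)) (b := 1)).prod (isCompact_Icc (a := -K) (b := K)))) hScl ?_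
    rintro ⟨u, v, x⟩ ⟨h1, h2⟩
    simp only at h1 h2
    exact ⟨abs_le.1 ((sq_le_one_iff_abs_le_one u).1 (by nlinarith [sq_nonneg v])),
      abs_le.1 ((sq_le_one_iff_abs_le_one v).1 (by nlinarith [sq_nonneg u])), abs_le.1 h2⟩
  have hcont : Continuous fun z : ℝ × ℝ × ℝ => meanForm P (U 1) z.1 z.2.1 z.2.2 := by
    have := hU.continuous_transfer_transfer_wt (p := 4) le_rfl
    have := hU.continuous_transfer_transfer_wt (p := 2) (by norm_num)
    have := hU.continuous_transfer_transfer_wt (p := 0) (by norm_num)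
    unfold meanForm
    fun_prop
  obtain ⟨z, hz, hmin⟩ := hSc.exists_isMinOn ⟨(1, 0, 0), by simp [hS, hK]⟩ hcont.continuousOn
  refine ⟨meanForm P (U 1) z.1 z.2.1 z.2.2, hU.meanForm_pos ?_ _, fun u v x hx => ?_⟩
  · by_contra! h
    have := hz.1
    rw [h.1, h.2] at this
    norm_num at this
  · rcases (add_nonneg (sq_nonneg u) (sq_nonneg v)).eq_or_lt with h0 | h0
    · rw [← h0, mul_zero]
      exact hU.meanForm_nonneg u v x
    · set r := √(u ^ 2 + v ^ 2) with hr
      have hr0 : 0 < r := Real.sqrt_pos.2 h0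
      have hr2 : r ^ 2 = u ^ 2 + v ^ 2 := Real.sq_sqrt h0.le
      have hmem : (u / r, v / r, x) ∈ S := by
        refine ⟨?_, hx⟩
        simp only [div_pow]
        rw [← add_div, hr2, div_self h0.ne']
      have h := hmin hmem
      simp only [Set.mem_ofPred_eq] at h
      have e : meanForm P (U 1) u v x = meanForm P (U 1) (u / r) (v / r) x * r ^ 2 := by
        unfold meanForm
        field_simp
      rw [e, ← hr2]
      exact mul_le_mul_of_nonneg_right h (sq_nonneg r)

theorem IsContractive.ae_sum_wt_tendsto [IsProbabilityMeasure P] (hU : IsContractive P ℋ U m)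
    {p : ℕ} (hp : p ≤ 4) :
    ∀ᵐ ω ∂P, ∀ t : ℝ, Tendsto (fun n => (∑ k ∈ generation (n + 2), wt p (path (fun j => U j ω) t k)
      - ∑ k ∈ generation n, transfer P (U 1) (transfer P (U 1) (wt p))
        (path (fun j => U j ω) t k)) / 2 ^ n) atTop (𝓝 0) := by
  filter_upwards [hU.ae_transfer_tendsto (abs_wt_le hp) (wt_lipschitz hp) (by norm_num),
    hU.ae_transfer_tendsto (abs_transfer_le (abs_wt_le hp)) (hU.transfer_wt_lipschitz hp)
      (by norm_num)] with ω h1 h2 t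
  have h := (((tendsto_add_atTop_iff_nat 1).2 (h1 t)).const_mul 2).add (h2 t)
  rw [mul_zero, add_zero] at h
  refine h.congr fun n => ?_
  rw [pow_succ]
  field_simp
  ring

/-- Almost surely, the quadratic form of the Gram matrix of each generation is bounded below. -/
theorem IsNondegenerate.ae_gramForm_ge [IsProbabilityMeasure P] (hU : IsNondegenerate P ℋ U m) :
    ∀ᵐ ω ∂P, ∀ t : ℝ, ∃ c : ℝ, 0 < c ∧ ∀ᶠ n in atTop, ∀ u v : ℝ,
      c * (u ^ 2 + v ^ 2) * 2 ^ n
        ≤ ∑ k ∈ generation n, gramForm u v (path (fun j => U j ω) t k) := by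
  filter_upwards [hU.ae_sum_abs_path_le, hU.ae_sum_wt_tendsto (p := 4) le_rfl,
    hU.ae_sum_wt_tendsto (p := 2) (by norm_num), hU.ae_sum_wt_tendsto (p := 0) (by norm_num)]
    with ω hC h4 h2 h0 t
  obtain ⟨C, hC⟩ := hC t
  have hC0 : 0 ≤ C := by
    have := (Finset.sum_nonneg fun k _ => abs_nonneg _).trans (hC 0)
    simpa using this
  -- Any radius above `2 * C` works: the sum of `|x k| / K` over a generation is then at most half
  -- its size.
  obtain ⟨c, hc, hmin⟩ := hU.exists_meanForm_ge (2 * C + 1)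
  set x := path (fun j => U j ω) t with hx
  set K := 2 * C + 1 with hK
  have hK0 : 0 < K := by linarith
  -- The minorant `1 - |y| / K` of the indicator of `[-K, K]` gives Markov's inequality without
  -- counting individuals.
  have hlow : ∀ u v y : ℝ, c * (u ^ 2 + v ^ 2) * (1 - |y| / K) ≤ meanForm P (U 1) u v y := by
    intro u v y
    have hcu : 0 ≤ c * (u ^ 2 + v ^ 2) := by positivity
    rcases le_or_gt |y| K with h | h
    · refine le_trans (mul_le_of_le_one_right hcu ?_) (hmin u v y h)
      have : 0 ≤ |y| / K := by positivity
      linarith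
    · refine le_trans (mul_nonpos_of_nonneg_of_nonpos hcu ?_) (hU.meanForm_nonneg u v y)
      have : 1 ≤ |y| / K := (one_le_div hK0).2 h.le
      linarith
  have hsum : ∀ u v : ℝ, ∀ n, c * (u ^ 2 + v ^ 2) * 2 ^ n / 2
      ≤ ∑ k ∈ generation n, meanForm P (U 1) u v (x k) := by
    intro u v n
    have hcu : 0 ≤ c * (u ^ 2 + v ^ 2) := by positivity
    calc c * (u ^ 2 + v ^ 2) * 2 ^ n / 2 = c * (u ^ 2 + v ^ 2) * (2 ^ n / 2) := by ring
      _ ≤ c * (u ^ 2 + v ^ 2) * (2 ^ n - (∑ k ∈ generation n, |x k|) / K) := by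
          refine mul_le_mul_of_nonneg_left ?_ hcu
          have h1 := hC n
          have h3 : (∑ k ∈ generation n, |x k|) / K ≤ 2 ^ n / 2 := by
            rw [div_le_iff₀ hK0, hK]
            nlinarith [show (0 : ℝ) < 2 ^ n by positivity]
          linarith
      _ = ∑ k ∈ generation n, c * (u ^ 2 + v ^ 2) * (1 - |x k| / K) := by
          rw [← Finset.mul_sum, Finset.sum_sub_distrib, Finset.sum_div]
          simp [card_generation]
      _ ≤ _ := Finset.sum_le_sum fun k _ => hlow u v (x k)
  -- The three errors together cost at most `c / 4` out of `c / 2`; the remaining `c / 4 * 2 ^ n` is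
  -- `c / 16 * 2 ^ (n + 2)`.
  have hε : (0 : ℝ) < c / 8 := by positivity
  have key : ∀ p : ℕ, Tendsto (fun n => (∑ k ∈ generation (n + 2), wt p (x k)
      - ∑ k ∈ generation n, transfer P (U 1) (transfer P (U 1) (wt p)) (x k)) / 2 ^ n)
      atTop (𝓝 0) → ∀ᶠ n in atTop, |∑ k ∈ generation (n + 2), wt p (x k)
      - ∑ k ∈ generation n, transfer P (U 1) (transfer P (U 1) (wt p)) (x k)| ≤ c / 8 * 2 ^ n := by
    intro p hp
    have := hp.abs
    rw [abs_zero] at this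
    filter_upwards [this.eventually_lt_const hε] with n hn
    rw [abs_div, abs_of_pos (show (0 : ℝ) < 2 ^ n by positivity), div_lt_iff₀ (by positivity)] at hn
    exact hn.le
  refine ⟨c / 16, by positivity, ?_⟩
  have hev : ∀ᶠ n in atTop, ∀ u v : ℝ, c / 16 * (u ^ 2 + v ^ 2) * 2 ^ (n + 2)
      ≤ ∑ k ∈ generation (n + 2), gramForm u v (x k) := by
    filter_upwards [key 4 (h4 t), key 2 (h2 t), key 0 (h0 t)] with n e4 e2 e0 u v
    have hs := hsum u v n
    simp_rw [gramForm_eq]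
    simp only [meanForm, Finset.sum_add_distrib, ← Finset.mul_sum] at hs ⊢
    rw [abs_le] at e4 e2 e0
    have hpow : (0 : ℝ) < 2 ^ n := by positivity
    set D4 := ∑ k ∈ generation (n + 2), wt 4 (x k)
      - ∑ k ∈ generation n, transfer P (U 1) (transfer P (U 1) (wt 4)) (x k) with hD4
    set D2 := ∑ k ∈ generation (n + 2), wt 2 (x k)
      - ∑ k ∈ generation n, transfer P (U 1) (transfer P (U 1) (wt 2)) (x k) with hD2
    set D0 := ∑ k ∈ generation (n + 2), wt 0 (x k)
      - ∑ k ∈ generation n, transfer P (U 1) (transfer P (U 1) (wt 0)) (x k) with hD0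
    have f4 : -(u ^ 2 * (c / 8 * 2 ^ n)) ≤ u ^ 2 * D4 := by nlinarith [sq_nonneg u]
    have f0 : -(v ^ 2 * (c / 8 * 2 ^ n)) ≤ v ^ 2 * D0 := by nlinarith [sq_nonneg v]
    have f2 : -((u ^ 2 + v ^ 2) * (c / 8 * 2 ^ n)) ≤ 2 * u * v * D2 := by
      have g1 : 0 ≤ (u + v) ^ 2 * (c / 8 * 2 ^ n + D2) :=
        mul_nonneg (sq_nonneg _) (by linarith)
      have g2 : 0 ≤ (u - v) ^ 2 * (c / 8 * 2 ^ n - D2) :=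
        mul_nonneg (sq_nonneg _) (by linarith)
      nlinarith
    rw [pow_add]
    simp only [hD4, hD2, hD0] at f4 f2 f0
    nlinarith
  rw [eventually_atTop] at hev ⊢
  obtain ⟨N, hN⟩ := hev
  refine ⟨N + 2, fun n hn => ?_⟩
  obtain ⟨j, rfl⟩ := Nat.exists_eq_add_of_le' (show 2 ≤ n by omega)
  exact hN j (by omega)

end Nondegenerate

/-! ## Sequences with linearly bounded partial sums -/

section LinearBound

/-- The partial sums of `s` grow at most linearly. -/
def LinBound (s : ℕ → ℝ) : Prop := ∃ C : ℝ, ∀ n : ℕ, ∑ l ∈ Finset.range n, s l ≤ C * n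

/-- `∑_{l < n} 2^{-l} D_l² = O(n)`. -/
def SqLinBound (D : ℕ → ℝ) : Prop := LinBound fun l => D l ^ 2 / 2 ^ l

theorem LinBound.add {s t : ℕ → ℝ} (hs : LinBound s) (ht : LinBound t) :
    LinBound fun l => s l + t l := by
  obtain ⟨C, hC⟩ := hs
  obtain ⟨D, hD⟩ := ht
  refine ⟨C + D, fun n => ?_⟩
  rw [Finset.sum_add_distrib, add_mul]
  exact add_le_add (hC n) (hD n)

theorem LinBound.const_mul {s : ℕ → ℝ} (hs : LinBound s) {c : ℝ} (hc : 0 ≤ c) :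
    LinBound fun l => c * s l := by
  obtain ⟨C, hC⟩ := hs
  refine ⟨c * C, fun n => ?_⟩
  rw [← Finset.mul_sum, mul_assoc]
  exact mul_le_mul_of_nonneg_left (hC n) hc

theorem LinBound.mono {s t : ℕ → ℝ} (ht : LinBound t) (h : ∀ l, s l ≤ t l) : LinBound s := by
  obtain ⟨C, hC⟩ := ht
  exact ⟨C, fun n => (Finset.sum_le_sum fun l _ => h l).trans (hC n)⟩

theorem LinBound.mono_eventually {s t : ℕ → ℝ} (ht : LinBound t) (ht0 : ∀ l, 0 ≤ t l)
    (h : ∀ᶠ l in atTop, s l ≤ t l) : LinBound s := by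
  obtain ⟨C, hC⟩ := ht
  obtain ⟨N, hN⟩ := eventually_atTop.1 h
  set A := ∑ l ∈ Finset.range N, |s l| with hA
  have hA0 : 0 ≤ A := Finset.sum_nonneg fun _ _ => abs_nonneg _
  refine ⟨A + C, fun n => ?_⟩
  rcases Nat.eq_zero_or_pos n with rfl | hn
  · simp
  have hn1 : (1 : ℝ) ≤ n := by exact_mod_cast hn
  calc ∑ l ∈ Finset.range n, s l
      ≤ ∑ l ∈ Finset.range n, ((if l < N then |s l| else 0) + t l) := by
        refine Finset.sum_le_sum fun l _ => ?_
        split_ifs with hl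
        · linarith [le_abs_self (s l), ht0 l]
        · linarith [hN l (not_lt.1 hl)]
    _ ≤ A + C * n := by
        rw [Finset.sum_add_distrib, ← Finset.sum_filter]
        refine add_le_add ?_ (hC n)
        refine Finset.sum_le_sum_of_subset_of_nonneg (fun l hl => ?_) fun _ _ _ => abs_nonneg _
        exact Finset.mem_range.2 (Finset.mem_filter.1 hl).2
    _ ≤ (A + C) * n := by nlinarith

theorem SqLinBound.add {D E : ℕ → ℝ} (hD : SqLinBound D) (hE : SqLinBound E) :
    SqLinBound fun l => D l + E l := by
  refine ((LinBound.const_mul hD (c := 2) (by norm_num)).add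
    (LinBound.const_mul hE (c := 2) (by norm_num))).mono fun l => ?_
  rw [← mul_div_assoc, ← mul_div_assoc, ← add_div]
  gcongr
  nlinarith [sq_nonneg (D l - E l)]

/-- Cumulated sums of a sequence with `∑ 2^{-l} D_l² = O(n)` satisfy the same bound. -/
theorem SqLinBound.cumul {D : ℕ → ℝ} (hD : SqLinBound D) :
    SqLinBound fun n => ∑ l ∈ Finset.range n, D l := by
  obtain ⟨C, hC⟩ := hD
  set M : ℕ → ℝ := fun n => ∑ l ∈ Finset.range n, D l with hM
  have hC0 : 0 ≤ C := by
    have := (Finset.sum_nonneg fun l _ => by positivity).trans (hC 1)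
    simpa using this
  -- From `(M + D)² ≤ 3/2 M² + 3 D²`; the doubled denominator turns `3/2` into the contraction
  -- factor `3/4`.
  have hstep : ∀ l, M (l + 1) ^ 2 / 2 ^ (l + 1)
      ≤ 3 / 4 * (M l ^ 2 / 2 ^ l) + 3 / 2 * (D l ^ 2 / 2 ^ l) := by
    intro l
    have e : M (l + 1) = M l + D l := Finset.sum_range_succ _ _
    rw [e, pow_succ 2 l, div_le_iff₀ (by positivity)]
    have : (3 / 4 * (M l ^ 2 / 2 ^ l) + 3 / 2 * (D l ^ 2 / 2 ^ l)) * (2 ^ l * 2)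
        = 3 / 2 * M l ^ 2 + 3 * D l ^ 2 := by
      field_simp
      ring
    rw [this]
    nlinarith [sq_nonneg (M l - 2 * D l)]
  -- Here `6 = (3/2) / (1 - 3/4)`.
  refine ⟨6 * C, fun n => ?_⟩
  cases n with
  | zero => simp
  | succ n =>
    have h1 : ∑ l ∈ Finset.range (n + 1), M l ^ 2 / 2 ^ l
        = ∑ l ∈ Finset.range n, M (l + 1) ^ 2 / 2 ^ (l + 1) := by
      rw [Finset.sum_range_succ']
      simp [hM]
    have h2 := Finset.sum_le_sum fun l (_ : l ∈ Finset.range n) => hstep l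
    rw [← h1, Finset.sum_add_distrib, ← Finset.mul_sum, ← Finset.mul_sum] at h2
    have h3 : ∑ l ∈ Finset.range n, M l ^ 2 / 2 ^ l
        ≤ ∑ l ∈ Finset.range (n + 1), M l ^ 2 / 2 ^ l :=
      Finset.sum_le_sum_of_subset_of_nonneg (Finset.range_subset_range.2 n.le_succ)
        fun _ _ _ => by positivity
    have h4 := hC n
    have h5 : 6 * C * ((n + 1 : ℕ) : ℝ) = 6 * (C * n) + 6 * C := by push_cast; ring
    rw [h5]
    linarith

/-- A single term is bounded by the whole sum, so `D n ^ 2 ≤ C * (n + 1) * 2 ^ n`. -/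
theorem SqLinBound.tendsto_zero {D : ℕ → ℝ} (hD : SqLinBound D) :
    Tendsto (fun n => D n / 2 ^ n) atTop (𝓝 0) := by
  obtain ⟨C, hC⟩ := hD
  have hb : ∀ n : ℕ, (D n / 2 ^ n) ^ 2 ≤ C * ((n : ℝ) * (1 / 2) ^ n + (1 / 2) ^ n) := by
    intro n
    have h1 : D n ^ 2 / 2 ^ n ≤ C * ((n + 1 : ℕ) : ℝ) :=
      (Finset.single_le_sum (f := fun l => D l ^ 2 / 2 ^ l) (fun _ _ => by positivity)
        (Finset.self_mem_range_succ n)).trans (hC (n + 1))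
    have e : (D n / 2 ^ n) ^ 2 = (D n ^ 2 / 2 ^ n) * (1 / 2) ^ n := by
      rw [one_div, inv_pow]
      field_simp
    rw [e]
    calc _ ≤ C * ((n + 1 : ℕ) : ℝ) * (1 / 2) ^ n := by gcongr
      _ = _ := by push_cast; ring
  have hlim : Tendsto (fun n : ℕ => C * ((n : ℝ) * (1 / 2 : ℝ) ^ n + (1 / 2) ^ n)) atTop (𝓝 0) := by
    have h1 := tendsto_self_mul_const_pow_of_lt_one (r := (1 / 2 : ℝ)) (by norm_num) (by norm_num)
    have h2 := tendsto_pow_atTop_nhds_zero_of_lt_one (r := (1 / 2 : ℝ)) (by norm_num) (by norm_num)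
    simpa using (h1.add h2).const_mul C
  have h := (squeeze_zero (fun n => sq_nonneg _) hb hlim).sqrt
  rw [Real.sqrt_zero] at h
  rw [tendsto_zero_iff_abs_tendsto_zero]
  simpa [Real.sqrt_sq_eq_abs, Function.comp_def] using h

/-- AM–GM with weight `2 ^ l`. It treats the terms where first-stage errors meet true residuals. -/
theorem LinBound.abs_mul {δ R : ℕ → ℝ} (hδ : LinBound fun l => 2 ^ l * δ l ^ 2)
    (hR : SqLinBound R) : LinBound fun l => |δ l| * |R l| := by
  refine ((hδ.add hR).const_mul (c := 1 / 2) (by norm_num)).mono fun l => ?_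
  have h2 : (0 : ℝ) < 2 ^ l := by positivity
  have h : 0 ≤ (2 ^ l * |δ l| - |R l|) ^ 2 / 2 ^ l := by positivity
  have e : (2 ^ l * |δ l| - |R l|) ^ 2 / 2 ^ l
      = 2 ^ l * δ l ^ 2 + R l ^ 2 / 2 ^ l - 2 * (|δ l| * |R l|) := by
    rw [sub_sq, mul_pow, sq_abs, sq_abs]
    field_simp
    ring
  rw [e] at h
  linarith

end LinearBound

/-! ## Weighted least squares with a positive definite Gram matrix -/

section LeastSquares

theorem dotProduct_gram {ι : Type*} (s : Finset ι) (c : ι → ℝ) (f : ι → Fin 2 → ℝ)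
    (y : Fin 2 → ℝ) :
    (∑ k ∈ s, c k • Matrix.vecMulVec (f k) (f k)) *ᵥ y = ∑ k ∈ s, (c k * (f k ⬝ᵥ y)) • f k := by
  rw [Matrix.sum_mulVec]
  refine Finset.sum_congr rfl fun k _ => ?_
  rw [Matrix.smul_mulVec, Matrix.vecMulVec_mulVec, mul_smul, op_smul_eq_smul]

theorem dotProduct_mulVec_gram {ι : Type*} (s : Finset ι) (c : ι → ℝ) (f : ι → Fin 2 → ℝ)
    (y : Fin 2 → ℝ) :
    y ⬝ᵥ ((∑ k ∈ s, c k • Matrix.vecMulVec (f k) (f k)) *ᵥ y)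
      = ∑ k ∈ s, c k * (f k ⬝ᵥ y) ^ 2 := by
  rw [dotProduct_gram, dotProduct_sum]
  refine Finset.sum_congr rfl fun k _ => ?_
  rw [dotProduct_smul, dotProduct_comm y, smul_eq_mul]
  ring

variable {A : Matrix (Fin 2) (Fin 2) ℝ} {r : ℝ}

theorem isUnit_det_of_form (hr : 0 < r)
    (hA : ∀ y : Fin 2 → ℝ, r * (y 0 ^ 2 + y 1 ^ 2) ≤ y ⬝ᵥ (A *ᵥ y)) : IsUnit A.det := by
  rw [isUnit_iff_ne_zero]
  intro h
  obtain ⟨y, hy, hAy⟩ := Matrix.exists_mulVec_eq_zero_iff.2 h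
  have := hA y
  rw [hAy, dotProduct_zero] at this
  have h0 : y 0 ^ 2 + y 1 ^ 2 ≤ 0 := by
    by_contra! hlt
    nlinarith [mul_pos hr hlt]
  have hy0 : y 0 = 0 :=
    pow_eq_zero_iff two_ne_zero |>.1 (by linarith [sq_nonneg (y 0), sq_nonneg (y 1)])
  have hy1 : y 1 = 0 :=
    pow_eq_zero_iff two_ne_zero |>.1 (by linarith [sq_nonneg (y 0), sq_nonneg (y 1)])
  apply hy
  funext i
  fin_cases i
  · exact hy0
  · exact hy1

/-- With `z = A y`, expand `|r y - z|² ≥ 0` and use `r |y|² ≤ y · z`; symmetry of `A` plays no role.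
-/
theorem sq_norm_le_of_form (hr : 0 < r)
    (hA : ∀ y : Fin 2 → ℝ, r * (y 0 ^ 2 + y 1 ^ 2) ≤ y ⬝ᵥ (A *ᵥ y)) (y : Fin 2 → ℝ) :
    r ^ 2 * (y 0 ^ 2 + y 1 ^ 2) ≤ (A *ᵥ y) 0 ^ 2 + (A *ᵥ y) 1 ^ 2 := by
  set z := A *ᵥ y with hz
  have h := hA y
  rw [← hz, dotProduct, Fin.sum_univ_two] at h
  nlinarith [sq_nonneg (r * y 0 - z 0), sq_nonneg (r * y 1 - z 1)]

end LeastSquares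

/-! ## Two-stage least squares along a regular trajectory -/

section Deterministic

/-- Error bound for weighted least squares: distance of the estimator from any `β`, in terms of the
residuals `ρ_k - f_k ⬝ β`. -/
theorem wls_error_le {ι : Type*} (s : Finset ι) (c ρ : ι → ℝ) (f : ι → Fin 2 → ℝ) {r : ℝ}
    (hr : 0 < r) (hA : ∀ y : Fin 2 → ℝ, r * (y 0 ^ 2 + y 1 ^ 2)
      ≤ y ⬝ᵥ ((∑ k ∈ s, c k • Matrix.vecMulVec (f k) (f k)) *ᵥ y)) (β : Fin 2 → ℝ) :
    r ^ 2 * ((((regularize (∑ k ∈ s, c k • Matrix.vecMulVec (f k) (f k)))⁻¹ *ᵥ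
        ∑ k ∈ s, (c k * ρ k) • f k) 0 - β 0) ^ 2
      + (((regularize (∑ k ∈ s, c k • Matrix.vecMulVec (f k) (f k)))⁻¹ *ᵥ
        ∑ k ∈ s, (c k * ρ k) • f k) 1 - β 1) ^ 2)
      ≤ (∑ k ∈ s, c k * (ρ k - f k ⬝ᵥ β) * f k 0) ^ 2
        + (∑ k ∈ s, c k * (ρ k - f k ⬝ᵥ β) * f k 1) ^ 2 := by
  set A := ∑ k ∈ s, c k • Matrix.vecMulVec (f k) (f k) with hAdef
  have hdet := isUnit_det_of_form hr hA
  rw [regularize, if_pos hdet]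
  set b := A⁻¹ *ᵥ ∑ k ∈ s, (c k * ρ k) • f k with hb
  have hAb : A *ᵥ (b - β) = ∑ k ∈ s, (c k * (ρ k - f k ⬝ᵥ β)) • f k := by
    rw [Matrix.mulVec_sub, hb, Matrix.mulVec_mulVec, Matrix.mul_nonsing_inv _ hdet,
      Matrix.one_mulVec, hAdef, dotProduct_gram, ← Finset.sum_sub_distrib]
    refine Finset.sum_congr rfl fun k _ => ?_
    rw [← sub_smul, ← mul_sub]
  have h := sq_norm_le_of_form hr hA (b - β)
  rw [hAb] at h
  simpa [Finset.sum_apply] using h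

/-- The residual of the first-stage regression for the child `j ∈ {0, 1}`. -/
noncomputable def Vhat (x : ℕ → ℝ) (j : Fin 2) (k : ℕ) : ℝ :=
  chi x k j - thetaHat x (genOf k) 0 j * x k - thetaHat x (genOf k) 1 j

/-- A trajectory `x` of the autoregression with parameter `θ` and residuals `w`, whose Gram matrices
are nondegenerate and whose weighted residuals satisfy quadratic bounds. -/
structure IsRegularTrajectory (x : ℕ → ℝ) (θ : Matrix (Fin 2) (Fin 2) ℝ) (w : Fin 2 → ℕ → ℝ) :
    Prop where
  child : ∀ k, 1 ≤ k → ∀ j, chi x k j = θ 0 j * x k + θ 1 j + w j k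
  gram : ∃ c : ℝ, 0 < c ∧ ∀ᶠ n in atTop, ∀ u v : ℝ,
    c * (u ^ 2 + v ^ 2) * 2 ^ n ≤ ∑ k ∈ generation n, gramForm u v (x k)
  resid : ∀ j, ∀ p ≤ 3, SqLinBound fun l => ∑ k ∈ generation l, wt p (x k) * w j k

variable {x : ℕ → ℝ} {θ : Matrix (Fin 2) (Fin 2) ℝ} {w : Fin 2 → ℕ → ℝ}

theorem one_div_wd_mul_pow (x : ℕ → ℝ) (k p : ℕ) : 1 / wd x k * x k ^ p = wt p (x k) := by
  rw [wt, wd, wc]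
  ring

/-- First-stage weights become sums of second-stage ones, so one family of bounds serves both
stages. -/
theorem one_div_wc_mul_pow (x : ℕ → ℝ) (k p : ℕ) :
    1 / wc x k * x k ^ p = wt p (x k) + wt (p + 2) (x k) := by
  rw [wt, wt, wc]
  have : 1 + x k ^ 2 ≠ 0 := by positivity
  field_simp
  ring

theorem wt_mul (p : ℕ) (y : ℝ) : wt p y * y = wt (p + 1) y := by
  rw [wt, wt]
  ring

theorem wt_mul_sq (p : ℕ) (y : ℝ) : wt p y * y ^ 2 = wt (p + 2) y := by
  rw [wt, wt]
  ring

theorem psi_dotProduct (x : ℕ → ℝ) (k : ℕ) (y : Fin 2 → ℝ) :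
    psi x k ⬝ᵥ y = x k ^ 2 * y 0 + y 1 := by
  simp [psi, dotProduct, Fin.sum_univ_two]

theorem Phi_dotProduct (x : ℕ → ℝ) (k : ℕ) (y : Fin 2 → ℝ) :
    Phi x k ⬝ᵥ y = x k * y 0 + y 1 := by
  simp [Phi, dotProduct, Fin.sum_univ_two]

/-- The last generation, `n - 1`, already supplies the bound; half of `c` is lost because its size
is `2 ^ (n - 1)`. -/
theorem IsRegularTrajectory.gramForm_tree (h : IsRegularTrajectory x θ w) :
    ∃ r : ℝ, 0 < r ∧ ∀ᶠ n in atTop, ∀ u v : ℝ,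
      r * 2 ^ n * (u ^ 2 + v ^ 2) ≤ ∑ k ∈ treeBefore n, gramForm u v (x k) := by
  obtain ⟨c, hc, hev⟩ := h.gram
  refine ⟨c / 2, by positivity, ?_⟩
  rw [eventually_atTop] at hev ⊢
  obtain ⟨N, hN⟩ := hev
  refine ⟨N + 1, fun n hn u v => ?_⟩
  obtain ⟨l, rfl⟩ := Nat.exists_eq_add_of_le' (show 1 ≤ n by omega)
  rw [sum_treeBefore, Finset.sum_range_succ]
  have h1 := hN l (by omega) u v
  have h2 : 0 ≤ ∑ i ∈ Finset.range l, ∑ k ∈ generation i, gramForm u v (x k) :=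
    Finset.sum_nonneg fun i _ => Finset.sum_nonneg fun k _ => gramForm_nonneg u v _
  rw [pow_succ]
  linarith

theorem IsRegularTrajectory.gramQ_form (h : IsRegularTrajectory x θ w) :
    ∃ r : ℝ, 0 < r ∧ ∀ᶠ n in atTop, ∀ y : Fin 2 → ℝ, r * 2 ^ n * (y 0 ^ 2 + y 1 ^ 2)
      ≤ y ⬝ᵥ ((∑ k ∈ treeBefore n, (1 / wd x k) • Matrix.vecMulVec (psi x k) (psi x k)) *ᵥ y) := by
  obtain ⟨r, hr, hev⟩ := h.gramForm_tree
  refine ⟨r, hr, hev.mono fun n hn y => (hn (y 0) (y 1)).trans (le_of_eq ?_)⟩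
  rw [dotProduct_mulVec_gram]
  refine Finset.sum_congr rfl fun k _ => ?_
  rw [psi_dotProduct, gramForm, wd, wc]
  ring

/-- Factor `u²y² - v² = (uy - v)(uy + v)` and bound `(uy - v)² ≤ (u² + v²)(1 + y²)` by
Cauchy–Schwarz. Nondegeneracy of the first-stage Gram matrix is thereby deduced from that of the
second. -/
theorem gramForm_sq_le (u v y : ℝ) :
    gramForm (u ^ 2) (-v ^ 2) y ≤ (u ^ 2 + v ^ 2) * (1 / (1 + y ^ 2) * (y * u + v) ^ 2) := by
  have hy : 0 < 1 + y ^ 2 := by positivity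
  have e1 : gramForm (u ^ 2) (-v ^ 2) y = (y * u - v) ^ 2 * (y * u + v) ^ 2 / (1 + y ^ 2) ^ 2 := by
    rw [gramForm]
    ring
  have e2 : (u ^ 2 + v ^ 2) * (1 / (1 + y ^ 2) * (y * u + v) ^ 2)
      = ((u ^ 2 + v ^ 2) * (1 + y ^ 2)) * (y * u + v) ^ 2 / (1 + y ^ 2) ^ 2 := by
    field_simp
  rw [e1, e2]
  gcongr
  nlinarith [sq_nonneg (u + v * y)]

theorem IsRegularTrajectory.gramS_form (h : IsRegularTrajectory x θ w) :
    ∃ r : ℝ, 0 < r ∧ ∀ᶠ n in atTop, ∀ y : Fin 2 → ℝ, r * 2 ^ n * (y 0 ^ 2 + y 1 ^ 2)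
      ≤ y ⬝ᵥ ((∑ k ∈ treeBefore n, (1 / wc x k) • Matrix.vecMulVec (Phi x k) (Phi x k)) *ᵥ y) := by
  obtain ⟨r, hr, hev⟩ := h.gramForm_tree
  refine ⟨r / 2, by positivity, hev.mono fun n hn y => ?_⟩
  rw [dotProduct_mulVec_gram]
  set u := y 0
  set v := y 1
  set F := ∑ k ∈ treeBefore n, 1 / wc x k * (Phi x k ⬝ᵥ y) ^ 2 with hF
  have h1 : r * 2 ^ n * ((u ^ 2) ^ 2 + (-v ^ 2) ^ 2) ≤ (u ^ 2 + v ^ 2) * F := by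
    refine (hn (u ^ 2) (-v ^ 2)).trans ?_
    rw [hF, Finset.mul_sum]
    refine Finset.sum_le_sum fun k _ => ?_
    rw [Phi_dotProduct, wc]
    exact gramForm_sq_le u v (x k)
  have hF0 : 0 ≤ F := Finset.sum_nonneg fun k _ => by
    rw [wc]
    positivity
  rcases (add_nonneg (sq_nonneg u) (sq_nonneg v)).eq_or_lt with h0 | h0
  · rw [← h0, mul_zero]
    exact hF0
  · refine le_of_mul_le_mul_left (le_trans ?_ h1) h0
    -- Equivalent to `u⁴ + v⁴ ≥ (u² + v²)² / 2`, the origin of `r / 2`.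
    have : 0 ≤ r * 2 ^ n * (u ^ 2 - v ^ 2) ^ 2 := by positivity
    nlinarith

theorem thetaHat_apply (x : ℕ → ℝ) (n : ℕ) (i j : Fin 2) :
    thetaHat x n i j = ((gramS x n)⁻¹ *ᵥ
      ∑ k ∈ treeBefore n, (1 / wc x k * chi x k j) • Phi x k) i := by
  rw [thetaHat, Matrix.mul_apply, Matrix.mulVec, dotProduct]
  refine Finset.sum_congr rfl fun l _ => ?_
  congr 1
  rw [Matrix.sum_apply, Finset.sum_apply]
  refine Finset.sum_congr rfl fun k _ => ?_
  simp [Matrix.vecMulVec_apply]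
  ring

/-- The estimation errors of the first stage, weighted by the size of the generations, have linearly
bounded partial sums. -/
theorem IsRegularTrajectory.linBound_thetaHat (h : IsRegularTrajectory x θ w) (i j : Fin 2) :
    LinBound fun n => 2 ^ n * (thetaHat x n i j - θ i j) ^ 2 := by
  obtain ⟨r, hr, hev⟩ := h.gramS_form
  -- The normal equations express the error through residual sums over the whole tree, that is,
  -- cumulated generation sums.
  have hM : ∀ p ≤ 1, SqLinBound fun n =>
      ∑ k ∈ treeBefore n, (1 / wc x k * x k ^ p) * w j k := fun p hp => by
    simp_rw [sum_treeBefore, one_div_wc_mul_pow, add_mul, Finset.sum_add_distrib]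
    have h1 := (h.resid j p (by omega)).add (h.resid j (p + 2) (by omega))
    simpa only [Finset.sum_add_distrib] using h1.cumul
  have hb := (LinBound.add (hM 1 le_rfl) (hM 0 zero_le_one)).const_mul (c := (r ^ 2)⁻¹) (by positivity)
  refine hb.mono_eventually (fun n => by positivity) (hev.mono fun n hn => ?_)
  have hS := wls_error_le (treeBefore n) (fun k => 1 / wc x k) (fun k => chi x k j) (Phi x)
    (by positivity) hn ![θ 0 j, θ 1 j]
  have e : ∀ k ∈ treeBefore n, chi x k j - Phi x k ⬝ᵥ ![θ 0 j, θ 1 j] = w j k := fun k hk => by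
    rw [h.child k (one_le_of_mem_treeBefore hk), Phi_dotProduct]
    simp
    ring
  have e0 : ∑ k ∈ treeBefore n, 1 / wc x k * (chi x k j - Phi x k ⬝ᵥ ![θ 0 j, θ 1 j]) * Phi x k 0
      = ∑ k ∈ treeBefore n, (1 / wc x k * x k ^ 1) * w j k :=
    Finset.sum_congr rfl fun k hk => by
      rw [e k hk]
      simp [Phi]
      ring
  have e1 : ∑ k ∈ treeBefore n, 1 / wc x k * (chi x k j - Phi x k ⬝ᵥ ![θ 0 j, θ 1 j]) * Phi x k 1
      = ∑ k ∈ treeBefore n, (1 / wc x k * x k ^ 0) * w j k :=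
    Finset.sum_congr rfl fun k hk => by
      rw [e k hk]
      simp [Phi]
  rw [e0, e1] at hS
  change (r * 2 ^ n) ^ 2 * ((((gramS x n)⁻¹ *ᵥ _) 0 - _) ^ 2 + (((gramS x n)⁻¹ *ᵥ _) 1 - _) ^ 2)
    ≤ _ at hS
  rw [← thetaHat_apply, ← thetaHat_apply] at hS
  simp only [Matrix.cons_val_zero, Matrix.cons_val_one] at hS
  set M1 := ∑ k ∈ treeBefore n, (1 / wc x k * x k ^ 1) * w j k
  set M0 := ∑ k ∈ treeBefore n, (1 / wc x k * x k ^ 0) * w j k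
  have hij : (thetaHat x n i j - θ i j) ^ 2
      ≤ (thetaHat x n 0 j - θ 0 j) ^ 2 + (thetaHat x n 1 j - θ 1 j) ^ 2 := by
    fin_cases i
    · exact le_add_of_nonneg_right (sq_nonneg _)
    · exact le_add_of_nonneg_left (sq_nonneg _)
  have hp : (0 : ℝ) < 2 ^ n := by positivity
  have key : (r * 2 ^ n) ^ 2 * (thetaHat x n i j - θ i j) ^ 2 ≤ M1 ^ 2 + M0 ^ 2 :=
    (mul_le_mul_of_nonneg_left hij (sq_nonneg _)).trans hS
  rw [← add_div, inv_mul_eq_div, div_div, le_div_iff₀ (by positivity)]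
  calc _ = (r * 2 ^ n) ^ 2 * (thetaHat x n i j - θ i j) ^ 2 := by ring
    _ ≤ _ := key

end Deterministic

/-! ### Effect of the estimated residuals, convergence and rate. -/

section SecondStage

variable {x : ℕ → ℝ} {θ : Matrix (Fin 2) (Fin 2) ℝ} {w : Fin 2 → ℕ → ℝ}

theorem abs_sum_wt_le {p : ℕ} (hp : p ≤ 4) (x : ℕ → ℝ) (l : ℕ) :
    |∑ k ∈ generation l, wt p (x k)| ≤ 2 ^ l := by
  refine (Finset.abs_sum_le_sum_abs _ _).trans
    ((Finset.sum_le_card_nsmul _ _ 1 fun k _ => abs_wt_le hp (x k)).trans (le_of_eq ?_))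
  rw [card_generation, nsmul_eq_mul, mul_one]
  push_cast
  rfl

theorem IsRegularTrajectory.Vhat_eq (h : IsRegularTrajectory x θ w) {l k : ℕ}
    (hk : k ∈ generation l) (j : Fin 2) :
    Vhat x j k = w j k - ((thetaHat x l 0 j - θ 0 j) * x k + (thetaHat x l 1 j - θ 1 j)) := by
  rw [Vhat, h.child k (one_le_of_mem_generation hk), genOf_of_mem hk]
  ring

/-- All residuals of generation `l` use the same `thetaHat x l`, so its errors factor out of the
generation sums. -/
theorem IsRegularTrajectory.sum_Vhat_sub (h : IsRegularTrajectory x θ w) (i j : Fin 2) (p l : ℕ) :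
    ∑ k ∈ generation l, wt p (x k) * (Vhat x i k * Vhat x j k - w i k * w j k)
      = (thetaHat x l 0 i - θ 0 i) * (thetaHat x l 0 j - θ 0 j)
          * ∑ k ∈ generation l, wt (p + 2) (x k)
        + ((thetaHat x l 0 i - θ 0 i) * (thetaHat x l 1 j - θ 1 j)
          + (thetaHat x l 1 i - θ 1 i) * (thetaHat x l 0 j - θ 0 j))
          * ∑ k ∈ generation l, wt (p + 1) (x k)
        + (thetaHat x l 1 i - θ 1 i) * (thetaHat x l 1 j - θ 1 j)
          * ∑ k ∈ generation l, wt p (x k)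
        - ((thetaHat x l 0 j - θ 0 j) * ∑ k ∈ generation l, wt (p + 1) (x k) * w i k
          + (thetaHat x l 1 j - θ 1 j) * ∑ k ∈ generation l, wt p (x k) * w i k
          + (thetaHat x l 0 i - θ 0 i) * ∑ k ∈ generation l, wt (p + 1) (x k) * w j k
          + (thetaHat x l 1 i - θ 1 i) * ∑ k ∈ generation l, wt p (x k) * w j k) := by
  simp only [Finset.mul_sum, ← Finset.sum_add_distrib, ← Finset.sum_sub_distrib]
  refine Finset.sum_congr rfl fun k hk => ?_
  rw [h.Vhat_eq hk, h.Vhat_eq hk, ← wt_mul_sq, ← wt_mul]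
  ring

/-- Terms quadratic in the errors meet weight sums of size at most `2 ^ l`, linear ones are handled
by `LinBound.abs_mul`. The condition `p ≤ 2` keeps `wt (p + 2)` bounded and `p + 1` within `resid`.
-/
theorem IsRegularTrajectory.linBound_Vhat_sub (h : IsRegularTrajectory x θ w) (i j : Fin 2)
    {p : ℕ} (hp : p ≤ 2) : LinBound fun l =>
      |∑ k ∈ generation l, wt p (x k) * (Vhat x i k * Vhat x j k - w i k * w j k)| := by
  have hR : ∀ a b c : Fin 2, ∀ q ≤ 3, LinBound fun l => |thetaHat x l a b - θ a b|
      * |∑ k ∈ generation l, wt q (x k) * w c k| := fun a b c q hq =>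
    (h.linBound_thetaHat a b).abs_mul (h.resid c q hq)
  have hδ := h.linBound_thetaHat
  refine (((((hδ 0 i).add (hδ 1 i)).add (hδ 0 j)).add (hδ 1 j)).add
    ((((hR 0 j i (p + 1) (by omega)).add (hR 1 j i p (by omega))).add
      (hR 0 i j (p + 1) (by omega))).add (hR 1 i j p (by omega)))).mono fun l => ?_
  rw [h.sum_Vhat_sub]
  set a := thetaHat x l 0 i - θ 0 i
  set b := thetaHat x l 1 i - θ 1 i
  set c := thetaHat x l 0 j - θ 0 j
  set d := thetaHat x l 1 j - θ 1 j
  have s2 := abs_sum_wt_le (p := p + 2) (by omega) x l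
  have s1 := abs_sum_wt_le (p := p + 1) (by omega) x l
  have s0 := abs_sum_wt_le (p := p) (by omega) x l
  set S2 := ∑ k ∈ generation l, wt (p + 2) (x k)
  set S1 := ∑ k ∈ generation l, wt (p + 1) (x k)
  set S0 := ∑ k ∈ generation l, wt p (x k)
  have t1 : |a * c * S2 + (a * d + b * c) * S1 + b * d * S0|
      ≤ 2 ^ l * a ^ 2 + 2 ^ l * b ^ 2 + 2 ^ l * c ^ 2 + 2 ^ l * d ^ 2 := by
    have h2 : (0 : ℝ) < 2 ^ l := by positivity
    calc _ ≤ |a * c| * |S2| + |a * d + b * c| * |S1| + |b * d| * |S0| := by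
          rw [← abs_mul, ← abs_mul, ← abs_mul]
          exact abs_add_three _ _ _
      _ ≤ |a * c| * 2 ^ l + (|a * d| + |b * c|) * 2 ^ l + |b * d| * 2 ^ l := by
          gcongr
          exact abs_add_le _ _
      _ = 2 ^ l * ((|a| + |b|) * (|c| + |d|)) := by
          simp only [abs_mul]
          ring
      _ ≤ 2 ^ l * (a ^ 2 + b ^ 2 + c ^ 2 + d ^ 2) := by
          gcongr
          rw [← sq_abs a, ← sq_abs b, ← sq_abs c, ← sq_abs d]
          nlinarith [sq_nonneg (|a| + |b| - (|c| + |d|)), sq_nonneg (|a| - |b|),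
            sq_nonneg (|c| - |d|)]
      _ = _ := by ring
  refine (abs_sub _ _).trans (add_le_add t1 ?_)
  refine (abs_add_le _ _).trans (add_le_add ((abs_add_three _ _ _).trans ?_) ?_)
  · simp only [abs_mul]
    exact le_rfl
  · rw [abs_mul]

theorem IsRegularTrajectory.exists_tree_Vhat_sub (h : IsRegularTrajectory x θ w) (i j : Fin 2)
    {p : ℕ} (hp : p ≤ 2) : ∃ C : ℝ, ∀ n : ℕ,
      |∑ k ∈ treeBefore n, wt p (x k) * (Vhat x i k * Vhat x j k - w i k * w j k)| ≤ C * n := by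
  obtain ⟨C, hC⟩ := h.linBound_Vhat_sub i j hp
  refine ⟨C, fun n => ?_⟩
  rw [sum_treeBefore]
  exact (Finset.abs_sum_le_sum_abs _ _).trans (hC n)

/-- The error bound for the second-stage estimator. -/
theorem wlsSecond_error_le {n : ℕ} {r : ℝ} (hr : 0 < r)
    (hA : ∀ y : Fin 2 → ℝ, r * (y 0 ^ 2 + y 1 ^ 2) ≤ y ⬝ᵥ
      ((∑ k ∈ treeBefore n, (1 / wd x k) • Matrix.vecMulVec (psi x k) (psi x k)) *ᵥ y))
    (ρ : ℕ → ℝ) (β : Fin 2 → ℝ) :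
    r ^ 2 * ((wlsSecond x ρ n 0 - β 0) ^ 2 + (wlsSecond x ρ n 1 - β 1) ^ 2)
      ≤ (∑ k ∈ treeBefore n, wt 2 (x k) * (ρ k - (β 0 * x k ^ 2 + β 1))) ^ 2
        + (∑ k ∈ treeBefore n, wt 0 (x k) * (ρ k - (β 0 * x k ^ 2 + β 1))) ^ 2 := by
  refine (wls_error_le (treeBefore n) (fun k => 1 / wd x k) ρ (psi x) hr hA β).trans (le_of_eq ?_)
  congr 2 <;> refine Finset.sum_congr rfl fun k _ => ?_
  · rw [← one_div_wd_mul_pow, psi_dotProduct]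
    simp only [psi, Matrix.cons_val_zero]
    ring
  · rw [← one_div_wd_mul_pow, psi_dotProduct]
    simp only [psi, Matrix.cons_val_one, Matrix.cons_val_fin_one]
    ring

theorem wlsSecond_sub (x ρ ρ' : ℕ → ℝ) (n : ℕ) :
    wlsSecond x ρ n - wlsSecond x ρ' n = wlsSecond x (fun k => ρ k - ρ' k) n := by
  simp only [wlsSecond]
  rw [← Matrix.mulVec_sub, ← Finset.sum_sub_distrib]
  simp only [← sub_smul, ← mul_sub]

/-- The right-hand side of the normal equations splits into the cost `O(n)` of estimating residuals
and an oracle part, `o(2 ^ n)` by `hO`; the Gram matrix is of order `2 ^ n`. -/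
theorem IsRegularTrajectory.tendsto_wlsSecond (h : IsRegularTrajectory x θ w) (i j : Fin 2)
    (β : Fin 2 → ℝ) (hO : ∀ p ≤ 2, SqLinBound fun l =>
      ∑ k ∈ generation l, wt p (x k) * (w i k * w j k - (β 0 * x k ^ 2 + β 1))) :
    Tendsto (fun n => wlsSecond x (fun k => Vhat x i k * Vhat x j k) n) atTop (𝓝 β) := by
  obtain ⟨r, hr, hev⟩ := h.gramQ_form
  have hN : ∀ p ≤ 2, Tendsto (fun n => (∑ k ∈ treeBefore n, wt p (x k)
      * (Vhat x i k * Vhat x j k - (β 0 * x k ^ 2 + β 1))) / 2 ^ n) atTop (𝓝 0) := fun p hp => by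
    have h1 := (hO p hp).cumul.tendsto_zero
    simp_rw [← sum_treeBefore] at h1
    obtain ⟨C, hC⟩ := h.exists_tree_Vhat_sub i j hp
    have h2 : Tendsto (fun n => (∑ k ∈ treeBefore n, wt p (x k)
        * (Vhat x i k * Vhat x j k - w i k * w j k)) / 2 ^ n) atTop (𝓝 0) := by
      have hlim : Tendsto (fun n : ℕ => C * ((n : ℝ) * (1 / 2 : ℝ) ^ n)) atTop (𝓝 0) := by
        simpa using (tendsto_self_mul_const_pow_of_lt_one (r := (1 / 2 : ℝ)) (by norm_num)
          (by norm_num)).const_mul C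
      refine squeeze_zero_norm (fun n => ?_) hlim
      rw [norm_div, Real.norm_eq_abs, Real.norm_eq_abs,
        abs_of_pos (show (0 : ℝ) < 2 ^ n by positivity), div_le_iff₀ (by positivity)]
      refine (hC n).trans (le_of_eq ?_)
      rw [one_div, inv_pow]
      field_simp
    have h3 := h2.add h1
    rw [add_zero] at h3
    refine h3.congr fun n => ?_
    rw [← add_div, ← Finset.sum_add_distrib]
    congr 1
    refine Finset.sum_congr rfl fun k _ => ?_
    ring
  have hsq := (((hN 2 le_rfl).pow 2).add ((hN 0 (by norm_num)).pow 2)).const_mul (r ^ 2)⁻¹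
  have hb : ∀ᶠ n in atTop, ∀ a : Fin 2,
      (wlsSecond x (fun k => Vhat x i k * Vhat x j k) n a - β a) ^ 2 ≤ (r ^ 2)⁻¹ *
      (((∑ k ∈ treeBefore n, wt 2 (x k)
        * (Vhat x i k * Vhat x j k - (β 0 * x k ^ 2 + β 1))) / 2 ^ n) ^ 2
      + ((∑ k ∈ treeBefore n, wt 0 (x k)
        * (Vhat x i k * Vhat x j k - (β 0 * x k ^ 2 + β 1))) / 2 ^ n) ^ 2) := by
    filter_upwards [hev] with n hn a
    have hp : (0 : ℝ) < 2 ^ n := by positivity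
    have h1 := wlsSecond_error_le (by positivity) hn (fun k => Vhat x i k * Vhat x j k) β
    rw [div_pow, div_pow, ← add_div, inv_mul_eq_div, div_div, le_div_iff₀ (by positivity)]
    refine le_trans ?_ h1
    rw [mul_comm, mul_pow, mul_comm ((2 ^ n : ℝ) ^ 2)]
    refine mul_le_mul_of_nonneg_left ?_ (by positivity)
    fin_cases a
    · exact le_add_of_nonneg_right (sq_nonneg _)
    · exact le_add_of_nonneg_left (sq_nonneg _)
  rw [tendsto_pi_nhds]
  intro a
  have hz : Tendsto (fun n => (wlsSecond x (fun k => Vhat x i k * Vhat x j k) n a - β a) ^ 2)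
      atTop (𝓝 0) := by
    refine squeeze_zero' (Eventually.of_forall fun n => sq_nonneg _) (hb.mono fun n hn => hn a) ?_
    simpa using hsq
  have h4 := hz.sqrt
  simp only [Real.sqrt_sq_eq_abs, Real.sqrt_zero] at h4
  have h5 := (tendsto_zero_iff_abs_tendsto_zero _).2 h4
  exact tendsto_sub_nhds_zero_iff.1 h5

/-- Both estimators share the Gram matrix, so their difference is the least squares fit to the
difference of the responses, compared with `β = 0`. -/
theorem IsRegularTrajectory.hasTreeRate (h : IsRegularTrajectory x θ w) (i j : Fin 2) :
    HasTreeRate fun n => wlsSecond x (fun k => Vhat x i k * Vhat x j k) n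
      - wlsSecond x (fun k => w i k * w j k) n := by
  obtain ⟨r, hr, hev⟩ := h.gramQ_form
  obtain ⟨C₂, hC₂⟩ := h.exists_tree_Vhat_sub i j (p := 2) le_rfl
  obtain ⟨C₀, hC₀⟩ := h.exists_tree_Vhat_sub i j (p := 0) (by norm_num)
  refine IsBigO.of_bound (√(C₂ ^ 2 + C₀ ^ 2) / r) ?_
  filter_upwards [hev, eventually_ge_atTop 1] with n hn hn1
  rw [wlsSecond_sub]
  have h1 := wlsSecond_error_le (by positivity) hn
    (fun k => Vhat x i k * Vhat x j k - w i k * w j k) 0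
  simp only [Pi.zero_apply, zero_mul, add_zero, sub_zero] at h1
  set u := wlsSecond x (fun k => Vhat x i k * Vhat x j k - w i k * w j k) n
  have hp : (1 : ℝ) < 2 ^ n := one_lt_pow₀ (by norm_num) (by omega)
  have h2 : (r * 2 ^ n) ^ 2 * (u 0 ^ 2 + u 1 ^ 2) ≤ (C₂ ^ 2 + C₀ ^ 2) * (n : ℝ) ^ 2 := by
    refine h1.trans ?_
    rw [add_mul, ← mul_pow, ← mul_pow, ← sq_abs, ← sq_abs (∑ k ∈ treeBefore n, wt 0 (x k) * _)]
    exact add_le_add (pow_le_pow_left₀ (abs_nonneg _) (hC₂ n) 2)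
      (pow_le_pow_left₀ (abs_nonneg _) (hC₀ n) 2)
  have hcard : ((treeBefore n).card : ℝ) = 2 ^ n - 1 := by
    rw [card_treeBefore, Nat.cast_sub Nat.one_le_two_pow]
    push_cast
    rfl
  rw [norm_norm, EuclideanSpace.norm_eq, Fin.sum_univ_two, hcard, norm_div, Real.norm_natCast,
    Real.norm_of_nonneg (show (0 : ℝ) ≤ 2 ^ n - 1 by linarith)]
  simp only [Real.norm_eq_abs, sq_abs]
  have h3 : √(u 0 ^ 2 + u 1 ^ 2) ≤ √(C₂ ^ 2 + C₀ ^ 2) / r * (n / 2 ^ n) := by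
    refine Real.sqrt_le_iff.2 ⟨by positivity, ?_⟩
    rw [mul_pow, div_pow, Real.sq_sqrt (by positivity), div_pow, div_mul_div_comm,
      le_div_iff₀ (by positivity)]
    refine le_trans (le_of_eq ?_) h2
    ring
  refine h3.trans ?_
  gcongr
  · linarith

end SecondStage

/-! ## Trajectories driven by independent innovations are regular -/

section Regular

variable {Ω : Type*} [mΩ : MeasurableSpace Ω] {P : Measure Ω} {ℋ : ℕ → MeasurableSpace Ω}
  {U : ℕ → Ω → Innov} {m : ℝ}

/-- The centred coefficient of the child `j`. -/
def ctrCoef (θ : Matrix (Fin 2) (Fin 2) ℝ) (j : Fin 2) (u : Innov) : ℝ :=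
  ![u.1.1, u.1.2] j - θ 0 j

/-- The centred noise of the child `j`. -/
def ctrNoise (θ : Matrix (Fin 2) (Fin 2) ℝ) (j : Fin 2) (u : Innov) : ℝ :=
  ![u.2.1, u.2.2] j - θ 1 j

theorem measurable_ctrCoef (θ : Matrix (Fin 2) (Fin 2) ℝ) (j : Fin 2) :
    Measurable (ctrCoef θ j) := by
  fin_cases j
  · exact measurable_fst.fst.sub_const _
  · exact measurable_fst.snd.sub_const _

theorem measurable_ctrNoise (θ : Matrix (Fin 2) (Fin 2) ℝ) (j : Fin 2) :
    Measurable (ctrNoise θ j) := by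
  fin_cases j
  · exact measurable_snd.fst.sub_const _
  · exact measurable_snd.snd.sub_const _

theorem holderTriple_four_four_two : ENNReal.HolderTriple 4 4 2 where
  inv_add_inv_eq_inv := by
    rw [← ENNReal.toReal_eq_toReal_iff' (by simp) (by simp), ENNReal.toReal_add (by simp) (by simp)]
    simp only [ENNReal.toReal_inv, ENNReal.toReal_ofNat]
    norm_num

theorem memLp_mul_four {f g : Ω → ℝ} (hf : MemLp f 4 P) (hg : MemLp g 4 P) :
    MemLp (fun ω => f ω * g ω) 2 P :=
  haveI := holderTriple_four_four_two
  MemLp.mul' hg hf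

theorem IsNondegenerate.memLp_ctrCoef [IsProbabilityMeasure P] (hU : IsNondegenerate P ℋ U m)
    (θ : Matrix (Fin 2) (Fin 2) ℝ) (j : Fin 2) : MemLp (fun ω => ctrCoef θ j (U 1 ω)) 4 P := by
  fin_cases j
  · exact hU.memLp4_a.sub (memLp_const _)
  · exact hU.memLp4_b.sub (memLp_const _)

theorem IsNondegenerate.memLp_ctrNoise [IsProbabilityMeasure P] (hU : IsNondegenerate P ℋ U m)
    (θ : Matrix (Fin 2) (Fin 2) ℝ) (j : Fin 2) : MemLp (fun ω => ctrNoise θ j (U 1 ω)) 4 P := by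
  fin_cases j
  · exact hU.memLp4_c.sub (memLp_const _)
  · exact hU.memLp4_d.sub (memLp_const _)

theorem IsContractive.ae_sqLinBound [IsProbabilityMeasure P] (hU : IsContractive P ℋ U m)
    {φ : Innov → ℝ} (hφ : Measurable φ) (hφi : MemLp (fun ω => φ (U 1 ω)) 2 P)
    (hφ0 : ∫ ω, φ (U 1 ω) ∂P = 0) :
    ∀ᵐ ω ∂P, ∀ p ≤ 4, ∀ t : ℝ, SqLinBound fun l =>
      ∑ k ∈ generation l, wt p (path (fun j => U j ω) t k) * φ (U k ω) := by
  rw [ae_all_iff]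
  intro p
  by_cases hp : p ≤ 4
  · filter_upwards [hU.ae_sum_sq_path_le hφ hφi hφ0 (hasDerivAt_wt p) (continuous_wtDeriv p)
      (abs_wtDeriv_le hp) (abs_wt_le hp)] with ω hω _
    exact hω
  · exact ae_of_all _ fun ω h => absurd h hp

variable {θ : Matrix (Fin 2) (Fin 2) ℝ}

/-- The limit of the second-stage estimator built from the residuals of the children `i`, `j`. -/
noncomputable def covLimit (P : Measure Ω) (V : Ω → Innov) (θ : Matrix (Fin 2) (Fin 2) ℝ)
    (i j : Fin 2) : Fin 2 → ℝ :=
  ![∫ ω, ctrCoef θ i (V ω) * ctrCoef θ j (V ω) ∂P, ∫ ω, ctrNoise θ i (V ω) * ctrNoise θ j (V ω) ∂P]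

theorem IsContractive.ae_sqLinBound_sub [IsProbabilityMeasure P] (hU : IsContractive P ℋ U m)
    {φ : Innov → ℝ} (hφ : Measurable φ) (hφi : MemLp (fun ω => φ (U 1 ω)) 2 P) :
    ∀ᵐ ω ∂P, ∀ p ≤ 4, ∀ t : ℝ, SqLinBound fun l => ∑ k ∈ generation l,
      wt p (path (fun j => U j ω) t k) * (φ (U k ω) - ∫ ω', φ (U 1 ω') ∂P) := by
  refine hU.ae_sqLinBound (φ := fun u => φ u - ∫ ω', φ (U 1 ω') ∂P) (hφ.sub_const _)
    (hφi.sub (memLp_const _)) ?_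
  rw [integral_sub (hφi.integrable (by norm_num)) (integrable_const _)]
  simp

/-- Almost surely, every trajectory driven by the innovations `U` is regular, and the products of its
residuals are asymptotically explained by the regressors `x²` and `1`. -/
theorem IsNondegenerate.ae_isRegularTrajectory [IsProbabilityMeasure P]
    (hU : IsNondegenerate P ℋ U m) (hα : ∀ j, ∫ ω, ctrCoef θ j (U 1 ω) ∂P = 0)
    (hη : ∀ j, ∫ ω, ctrNoise θ j (U 1 ω) ∂P = 0) :
    ∀ᵐ ω ∂P, ∀ (t : ℝ) (x : ℕ → ℝ), (∀ k, 1 ≤ k → x k = path (fun j => U j ω) t k) →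
      (∀ k, 1 ≤ k → ∀ j, chi x k j
        = (θ 0 j + ctrCoef θ j (U k ω)) * x k + (θ 1 j + ctrNoise θ j (U k ω))) →
      IsRegularTrajectory x θ
        (fun j k => ctrCoef θ j (U k ω) * x k + ctrNoise θ j (U k ω)) ∧
      ∀ i j, ∀ p ≤ 2, SqLinBound fun l => ∑ k ∈ generation l, wt p (x k) *
        ((ctrCoef θ i (U k ω) * x k + ctrNoise θ i (U k ω))
          * (ctrCoef θ j (U k ω) * x k + ctrNoise θ j (U k ω))
          - (covLimit P (U 1) θ i j 0 * x k ^ 2 + covLimit P (U 1) θ i j 1)) := by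
  have hαL := hU.memLp_ctrCoef θ
  have hηL := hU.memLp_ctrNoise θ
  have hαm := measurable_ctrCoef θ
  have hηm := measurable_ctrNoise θ
  have h1 := ae_all_iff.2 fun j => hU.ae_sqLinBound (hαm j)
    ((hαL j).mono_exponent (by norm_num)) (hα j)
  have h2 := ae_all_iff.2 fun j => hU.ae_sqLinBound (hηm j)
    ((hηL j).mono_exponent (by norm_num)) (hη j)
  have h3 := ae_all_iff.2 fun i => ae_all_iff.2 fun j =>
    hU.ae_sqLinBound_sub ((hαm i).mul (hαm j)) (memLp_mul_four (hαL i) (hαL j))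
  have h4 := ae_all_iff.2 fun i => ae_all_iff.2 fun j =>
    hU.ae_sqLinBound_sub ((hηm i).mul (hηm j)) (memLp_mul_four (hηL i) (hηL j))
  -- Independence of coefficients and noises removes the term linear in `x` from the conditional
  -- mean of residual products, leaving only the regressors `x²` and `1`.
  have h5 : ∀ i j : Fin 2, ∫ ω, ctrCoef θ i (U 1 ω) * ctrNoise θ j (U 1 ω) ∂P = 0 := fun i j => by
    have hm1 : Measurable fun z : ℝ × ℝ => ctrCoef θ i (z, 0) :=
      (hαm i).comp (measurable_id.prodMk measurable_const)
    have hm2 : Measurable fun z : ℝ × ℝ => ctrNoise θ j (0, z) :=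
      (hηm j).comp (measurable_const.prodMk measurable_id)
    have := (hU.indepFun.comp hm1 hm2).integral_fun_mul_eq_mul_integral
      (hαL i).1 (hηL j).1
    refine this.trans ?_
    have e : ∫ ω, ((fun z : ℝ × ℝ => ctrCoef θ i (z, 0)) ∘ fun ω => (U 1 ω).1) ω ∂P = 0 := hα i
    rw [e, zero_mul]
  have h6 := ae_all_iff.2 fun i => ae_all_iff.2 fun j =>
    hU.ae_sqLinBound ((hαm i).mul (hηm j)) (memLp_mul_four (hαL i) (hηL j)) (h5 i j)
  filter_upwards [h1, h2, h3, h4, h6, hU.ae_gramForm_ge] with ω h1 h2 h3 h4 h6 hg t x hx hchild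
  have hxs : ∀ l (F : ℕ → ℝ → ℝ), ∑ k ∈ generation l, F k (x k)
      = ∑ k ∈ generation l, F k (path (fun j => U j ω) t k) := fun l F =>
    Finset.sum_congr rfl fun k hk => by rw [hx k (one_le_of_mem_generation hk)]
  refine ⟨⟨fun k hk j => ?_, ?_, fun j p hp => ?_⟩, fun i j p hp => ?_⟩
  · rw [hchild k hk j]
    ring
  · obtain ⟨c, hc, hev⟩ := hg t
    refine ⟨c, hc, hev.mono fun n hn u v => (hn u v).trans (le_of_eq ?_)⟩
    rw [hxs n fun _ y => gramForm u v y]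
  · have h := (h1 j (p + 1) (by omega) t).add (h2 j p (by omega) t)
    refine cast (congrArg SqLinBound (funext fun l => ?_)) h
    rw [hxs l fun k y => wt p y * (ctrCoef θ j (U k ω) * y + ctrNoise θ j (U k ω)),
      ← Finset.sum_add_distrib]
    refine Finset.sum_congr rfl fun k _ => ?_
    rw [← wt_mul]
    ring
  · have h := ((h3 i j (p + 2) (by omega) t).add (h4 i j p (by omega) t)).add
      ((h6 i j (p + 1) (by omega) t).add (h6 j i (p + 1) (by omega) t))
    refine cast (congrArg SqLinBound (funext fun l => ?_)) h
    rw [hxs l fun k y => wt p y * ((ctrCoef θ i (U k ω) * y + ctrNoise θ i (U k ω))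
      * (ctrCoef θ j (U k ω) * y + ctrNoise θ j (U k ω))
      - (covLimit P (U 1) θ i j 0 * y ^ 2 + covLimit P (U 1) θ i j 1)),
      ← Finset.sum_add_distrib, ← Finset.sum_add_distrib, ← Finset.sum_add_distrib]
    refine Finset.sum_congr rfl fun k _ => ?_
    simp only [covLimit, Matrix.cons_val_zero, Matrix.cons_val_one, Matrix.cons_val_fin_one]
    rw [← wt_mul_sq, ← wt_mul]
    simp only [Pi.mul_apply]
    ring

end Regular

/-! ## Independence of the innovations -/

section Independence

variable {Ω : Type*} [mΩ : MeasurableSpace Ω] {P : Measure Ω}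

/-- Measurable rectangles form a generating π-system, on which independence factors first across the
two sequences and then within each. -/
theorem iIndepFun_prodMk_of_indepFun {α β : Type*} [MeasurableSpace α] [MeasurableSpace β]
    {A : ℕ → Ω → α} {B : ℕ → Ω → β} (hAm : ∀ i, Measurable (A i)) (hBm : ∀ i, Measurable (B i))
    (hA : iIndepFun A P) (hB : iIndepFun B P)
    (hAB : IndepFun (fun ω i => A i ω) (fun ω i => B i ω) P) :
    iIndepFun (fun i ω => (A i ω, B i ω)) P := by
  have hABi : ∀ i, IndepFun (A i) (B i) P := fun i =>
    hAB.comp (measurable_pi_apply i) (measurable_pi_apply i)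
  refine iIndepSets.iIndep (fun i => ((hAm i).prodMk (hBm i)).comap_le)
    (fun i => {s | ∃ t ∈ Set.image2 (fun (s : Set α) (t : Set β) => s ×ˢ t)
      {s | MeasurableSet s} {t | MeasurableSet t}, (fun ω => (A i ω, B i ω)) ⁻¹' t = s})
    (fun i => isPiSystem_prod.comap _) (fun i => ?_) ?_
  · rw [← generateFrom_prod, MeasurableSpace.comap_generateFrom]
    rfl
  · rw [iIndepSets_iff]
    intro S f hf
    have hf' : ∀ i, ∃ (s : Set α) (t : Set β), MeasurableSet s ∧ MeasurableSet t ∧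
        (i ∈ S → f i = A i ⁻¹' s ∩ B i ⁻¹' t) := fun i => by
      by_cases hi : i ∈ S
      · obtain ⟨_, ⟨s, hs, t, ht, rfl⟩, he⟩ := hf i hi
        exact ⟨s, t, hs, ht, fun _ => he.symm⟩
      · exact ⟨Set.univ, Set.univ, MeasurableSet.univ, MeasurableSet.univ, fun h => absurd h hi⟩
    choose s t hs ht he using hf'
    have e1 : ⋂ i ∈ S, f i = (fun ω i => A i ω) ⁻¹' (⋂ i ∈ S, (fun z => z i) ⁻¹' s i)
        ∩ (fun ω i => B i ω) ⁻¹' (⋂ i ∈ S, (fun z => z i) ⁻¹' t i) := by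
      ext ω
      simp only [Set.mem_iInter, Set.mem_inter_iff, Set.mem_preimage]
      constructor
      · intro h
        refine ⟨fun i hi => ?_, fun i hi => ?_⟩
        · have := h i hi
          rw [he i hi] at this
          exact this.1
        · have := h i hi
          rw [he i hi] at this
          exact this.2
      · intro h i hi
        rw [he i hi]
        exact ⟨h.1 i hi, h.2 i hi⟩
    have m1 : MeasurableSet (⋂ i ∈ S, (fun z : ℕ → α => z i) ⁻¹' s i) :=
      Finset.measurableSet_biInter S fun i _ => measurable_pi_apply i (hs i)
    have m2 : MeasurableSet (⋂ i ∈ S, (fun z : ℕ → β => z i) ⁻¹' t i) :=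
      Finset.measurableSet_biInter S fun i _ => measurable_pi_apply i (ht i)
    rw [e1, hAB.measure_inter_preimage_eq_mul _ _ m1 m2]
    have e2 : (fun ω i => A i ω) ⁻¹' (⋂ i ∈ S, (fun z => z i) ⁻¹' s i) = ⋂ i ∈ S, A i ⁻¹' s i := by
      ext ω
      simp
    have e3 : (fun ω i => B i ω) ⁻¹' (⋂ i ∈ S, (fun z => z i) ⁻¹' t i) = ⋂ i ∈ S, B i ⁻¹' t i := by
      ext ω
      simp
    rw [e2, e3, hA.measure_inter_preimage_eq_mul S fun i _ => hs i,
      hB.measure_inter_preimage_eq_mul S fun i _ => ht i, ← Finset.prod_mul_distrib]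
    refine Finset.prod_congr rfl fun i hi => ?_
    rw [he i hi, (hABi i).measure_inter_preimage_eq_mul _ _ (hs i) (ht i)]

/-- The σ-algebra generated by the `U_j`, `1 ≤ j < k`. -/
abbrev past {E : Type*} [mE : MeasurableSpace E] (U : ℕ → Ω → E) (k : ℕ) : MeasurableSpace Ω :=
  ⨆ i ∈ {i : ℕ | i + 1 < k}, mE.comap (U (i + 1))

theorem isInnovation_past {E : Type*} [mE : MeasurableSpace E] {U : ℕ → Ω → E}
    (hm : ∀ k, 1 ≤ k → Measurable (U k)) (hU : iIndepFun (fun i => U (i + 1)) P)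
    (hid : ∀ k, 1 ≤ k → IdentDistrib (U k) (U 1) P P) : IsInnovation P (past U) U where
  mono k l hkl := iSup₂_le fun i hi =>
    le_iSup₂_of_le (f := fun (i : ℕ) (_ : i ∈ {i : ℕ | i + 1 < l}) => mE.comap (U (i + 1))) i
      (lt_of_lt_of_le hi hkl) le_rfl
  le k := iSup₂_le fun i _ => (hm (i + 1) (by omega)).comap_le
  meas k hk := by
    obtain ⟨j, rfl⟩ := Nat.exists_eq_add_of_le' hk
    exact (comap_measurable (U (j + 1))).mono (le_iSup₂_of_le
      (f := fun (i : ℕ) (_ : i ∈ {i : ℕ | i + 1 < j + 1 + 1}) => mE.comap (U (i + 1))) j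
      (Nat.lt_succ_self _) le_rfl) le_rfl
  indep k hk := by
    obtain ⟨j, rfl⟩ := Nat.exists_eq_add_of_le' hk
    have h := indep_iSup_of_disjoint (fun i => (hm (i + 1) (by omega)).comap_le) hU.iIndep
      (S := {i : ℕ | i + 1 < j + 1}) (T := {j}) (by simp)
    simpa [past] using h
  ident := hid

end Independence

/-! ## The bifurcating process -/

section Bifurcation

/-- Used at generation `0` to turn the constant conditional moments into plain moments of `U 1`;
identical distribution covers the other innovations. -/
theorem integral_eq_of_condExp {Ω : Type*} {m mΩ : MeasurableSpace Ω} {P : Measure Ω} [IsProbabilityMeasure P]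
    (hm : m ≤ mΩ) {f : Ω → ℝ} {c : ℝ} (h : P[f | m] =ᵐ[P] fun _ => c) : ∫ ω, f ω ∂P = c := by
  rw [← integral_condExp hm, integral_congr_ae h]
  simp

theorem integral_sq_of_condVar {Ω : Type*} {m mΩ : MeasurableSpace Ω} {P : Measure Ω} [IsProbabilityMeasure P]
    (hm : m ≤ mΩ) {f : Ω → ℝ} {c v : ℝ} (h : P[f | m] =ᵐ[P] fun _ => c)
    (hv : Var[f; P | m] =ᵐ[P] fun _ => v) : ∫ ω, (f ω - c) ^ 2 ∂P = v := by
  have e := integral_eq_of_condExp (f := (f - P[f | m]) ^ 2) hm hv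
  rw [← e]
  refine integral_congr_ae ?_
  filter_upwards [h] with ω hω
  simp [hω]

theorem measurable_natFilt {Ω : Type*} (X : ℕ → Ω → ℝ) {k : ℕ} (hk : 1 ≤ k) :
    Measurable[natFilt X (genOf k)] (X k) := by
  have hmem : k ∈ treeBefore (genOf k + 1) := by
    rw [treeBefore_eq, Finset.mem_Ico]
    exact ⟨hk, (mem_generation.1 (mem_generation_genOf hk)).2⟩
  have hle : ∀ s : Finset ℕ, k ∈ s → MeasurableSpace.comap (X k) inferInstance ≤
      ⨆ j ∈ s, MeasurableSpace.comap (X j) inferInstance := fun s hs =>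
    le_iSup₂ (f := fun j (_ : j ∈ s) => MeasurableSpace.comap (X j) inferInstance) k hs
  exact measurable_iff_comap_le.2 (hle _ hmem)

variable {Ω : Type*} [mΩ : MeasurableSpace Ω] {P : Measure Ω} {X a b ε : ℕ → Ω → ℝ}

/-- The coefficients and noises attached to the individual `k`. -/
def innov (a b ε : ℕ → Ω → ℝ) (k : ℕ) (ω : Ω) : Innov :=
  ((a k ω, b k ω), (ε (2 * k) ω, ε (2 * k + 1) ω))

theorem IsRCBAR.natFilt_le (hX : IsRCBAR P X a b ε) (n : ℕ) : natFilt X n ≤ mΩ :=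
  iSup₂_le fun k hk => (hX.measurable_X k (one_le_of_mem_treeBefore hk)).comap_le

theorem IsRCBAR.measurable_innov (hX : IsRCBAR P X a b ε) {k : ℕ} (hk : 1 ≤ k) :
    Measurable (innov a b ε k) :=
  ((hX.measurable_a k hk).prodMk (hX.measurable_b k hk)).prodMk
    ((hX.measurable_ε _ (by omega)).prodMk (hX.measurable_ε _ (by omega)))

theorem IsRCBAR.indepFun_innov (hX : IsRCBAR P X a b ε) {k : ℕ} (hk : 1 ≤ k) :
    IndepFun (fun ω => (innov a b ε k ω).1) (fun ω => (innov a b ε k ω).2) P := by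
  obtain ⟨j, rfl⟩ := Nat.exists_eq_add_of_le' hk
  exact hX.coef_noise_indep.comp (measurable_pi_apply j) (measurable_pi_apply j)

theorem IsRCBAR.isInnovation [IsProbabilityMeasure P] (hX : IsRCBAR P X a b ε) :
    IsInnovation P (past (innov a b ε)) (innov a b ε) := by
  refine isInnovation_past (fun k hk => hX.measurable_innov hk) ?_ fun k hk => ?_
  · exact iIndepFun_prodMk_of_indepFun
      (fun i => (hX.measurable_a _ (by omega)).prodMk (hX.measurable_b _ (by omega)))
      (fun i => (hX.measurable_ε _ (by omega)).prodMk (hX.measurable_ε _ (by omega)))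
      hX.coef_indep hX.noise_indep hX.coef_noise_indep
  · exact (hX.coef_ident k hk).prodMk (hX.noise_ident k hk) (hX.indepFun_innov hk)
      (hX.indepFun_innov le_rfl)

variable {a₀ b₀ c₀ d₀ σa σb σc σd ρab ρcd : ℝ}

theorem one_mem_generation_zero : 1 ∈ generation 0 := by simp [generation]

theorem IsRCBAR.exists_isNondegenerate [IsProbabilityMeasure P] (hX : IsRCBAR P X a b ε)
    (hmean : CondMeans P X a b ε a₀ b₀ c₀ d₀) (h1 : H1 P a b)
    (h2 : H2 P X a b ε σa σb σc σd)
    (h4 : H4 P X a b ε a₀ b₀ c₀ d₀ σa σb σc σd ρab ρcd) :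
    ∃ m, IsNondegenerate P (past (innov a b ε)) (innov a b ε) m := by
  have hc := integral_eq_of_condExp (hX.natFilt_le 0) (hmean.mean_c 0 1 one_mem_generation_zero)
  have hvc := integral_sq_of_condVar (hX.natFilt_le 0)
    (hmean.mean_c 0 1 one_mem_generation_zero) (h2.var_c 0 1 one_mem_generation_zero)
  -- The value `1 / 2` only ensures `0 < m`, also when both coefficients vanish.
  refine ⟨max (max (∫ ω, a 1 ω ^ 2 ∂P) (∫ ω, b 1 ω ^ 2 ∂P)) (1 / 2),
    { hX.isInnovation with
      m_pos := lt_max_of_lt_right (by norm_num)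
      m_lt := max_lt (max_lt (h1.sq_a 1 le_rfl) (h1.sq_b 1 le_rfl)) (by norm_num)
      memLp_a := h1.memLp_a 1 le_rfl
      memLp_b := h1.memLp_b 1 le_rfl
      memLp_c := h2.memLp_ε _ (by norm_num)
      memLp_d := h2.memLp_ε _ (by norm_num)
      sq_a := (le_max_left _ _).trans (le_max_left _ _)
      sq_b := (le_max_right _ _).trans (le_max_left _ _)
      memLp4_a := h4.memLp_a 1 le_rfl
      memLp4_b := h4.memLp_b 1 le_rfl
      memLp4_c := h4.memLp_ε _ (by norm_num)
      memLp4_d := h4.memLp_ε _ (by norm_num)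
      indepFun := hX.indepFun_innov le_rfl
      var_c := ?_
      nondeg_c := h4.nondeg_even 1 le_rfl }⟩
  have e : ∫ ω, ((innov a b ε 1 ω).2.1 - ∫ ω', (innov a b ε 1 ω').2.1 ∂P) ^ 2 ∂P = σc ^ 2 := by
    rw [← hvc]
    simp only [innov]
    rw [hc]
  rw [e]
  exact h2.pos_c

theorem IsRCBAR.eq_path (hX : IsRCBAR P X a b ε) (ω : Ω) {k : ℕ} (hk : 1 ≤ k) :
    X k ω = path (fun j => innov a b ε j ω) (X 1 ω) k :=
  eq_flow_add_slope (x := fun k => X k ω) (U := fun j => innov a b ε j ω)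
    (fun k hk => hX.even k hk ω) (fun k hk => hX.odd k hk ω) hk

/-- `X 1` and the slope may be dependent, but both are in `L²`, so their product is integrable. This
is enough for the conditional expectations defining the true residuals. -/
theorem IsRCBAR.integrable [IsProbabilityMeasure P] (hX : IsRCBAR P X a b ε) {m : ℝ}
    (hU : IsContractive P (past (innov a b ε)) (innov a b ε) m) {k : ℕ} (hk : 1 ≤ k) :
    Integrable (X k) P := by
  have e : X k = fun ω => flow (fun j => innov a b ε j ω) 0 k
      + X 1 ω * slope (fun j => innov a b ε j ω) k := funext fun ω => hX.eq_path ω hk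
  rw [e]
  obtain ⟨C, hC⟩ := hU.exists_flow_bound 0
  exact ((hC k hk).1.integrable (by norm_num)).add (hX.ancestor.integrable_mul (hU.slope_bound hk).1)

theorem condExp_affine [IsProbabilityMeasure P] {m : MeasurableSpace Ω} {f g Y Z : Ω → ℝ}
    {c d : ℝ} (hY : Measurable[m] Y) (hf : Integrable f P) (hg : Integrable g P)
    (hZ : Integrable Z P) (he : ∀ ω, Z ω = f ω * Y ω + g ω) (hfc : P[f | m] =ᵐ[P] fun _ => c)
    (hgd : P[g | m] =ᵐ[P] fun _ => d) :
    ∀ᵐ ω ∂P, Z ω - (P[Z | m]) ω = (f ω - c) * Y ω + (g ω - d) := by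
  have e : Z = f * Y + g := funext he
  have hfY : Integrable (f * Y) P := by
    have := hZ.sub hg
    rwa [e, add_sub_cancel_right] at this
  rw [e]
  filter_upwards [condExp_add hfY hg m,
    condExp_mul_of_stronglyMeasurable_right hY.stronglyMeasurable hfY hf, hfc, hgd]
    with ω h1 h2 h3 h4
  simp only [Pi.add_apply, Pi.mul_apply] at h1 h2 ⊢
  rw [h1, h2, h3, h4]
  ring

theorem wlsSecond_congr {x ρ ρ' : ℕ → ℝ} (h : ∀ k, 1 ≤ k → ρ k = ρ' k) (n : ℕ) :
    wlsSecond x ρ n = wlsSecond x ρ' n := by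
  rw [wlsSecond, wlsSecond]
  congr 1
  refine Finset.sum_congr rfl fun k hk => ?_
  rw [h k (one_le_of_mem_treeBefore hk)]

theorem Vhat_zero (x : ℕ → ℝ) (k : ℕ) : Vhat x 0 k = VhatEven x k := by
  simp [Vhat, VhatEven, chi]

theorem Vhat_one (x : ℕ → ℝ) (k : ℕ) : Vhat x 1 k = VhatOdd x k := by
  simp [Vhat, VhatOdd, chi]

end Bifurcation

end RCBAR

/-! ### Assembly of the theorem. -/

theorem mainTheorem3 {Ω : Type*} [MeasurableSpace Ω] (P : Measure Ω) [IsProbabilityMeasure P]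
    (X a b ε : ℕ → Ω → ℝ) (a₀ b₀ c₀ d₀ σa σb σc σd ρab ρcd : ℝ)
    (hX : RCBAR.IsRCBAR P X a b ε)
    (hmean : RCBAR.CondMeans P X a b ε a₀ b₀ c₀ d₀)
    (h1 : RCBAR.H1 P a b)
    (h2 : RCBAR.H2 P X a b ε σa σb σc σd)
    (h3 : RCBAR.H3 P X a b ε a₀ b₀ c₀ d₀ σa σb σc σd ρab ρcd)
    (h4 : RCBAR.H4 P X a b ε a₀ b₀ c₀ d₀ σa σb σc σd ρab ρcd)
    (h5 : RCBAR.H5 P X a b ε a₀ b₀ c₀ d₀) :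
    ((∀ᵐ ω ∂P, Tendsto (fun n => RCBAR.etaHat (RCBAR.traj X ω) n) atTop
        (𝓝 ![σa ^ 2, σc ^ 2])) ∧
      (∀ᵐ ω ∂P, RCBAR.HasTreeRate fun n =>
        RCBAR.etaHat (RCBAR.traj X ω) n - RCBAR.etaOracle P X n ω)) ∧
    ((∀ᵐ ω ∂P, Tendsto (fun n => RCBAR.zetaHat (RCBAR.traj X ω) n) atTop
        (𝓝 ![σb ^ 2, σd ^ 2])) ∧
      (∀ᵐ ω ∂P, RCBAR.HasTreeRate fun n =>
        RCBAR.zetaHat (RCBAR.traj X ω) n - RCBAR.zetaOracle P X n ω)) ∧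
    ((∀ᵐ ω ∂P, Tendsto (fun n => RCBAR.nuHat (RCBAR.traj X ω) n) atTop
        (𝓝 ![ρab, ρcd])) ∧
      (∀ᵐ ω ∂P, RCBAR.HasTreeRate fun n =>
        RCBAR.nuHat (RCBAR.traj X ω) n - RCBAR.nuOracle P X n ω)) := by
  open RCBAR in
  have hm0 := hX.natFilt_le 0
  have hg0 := one_mem_generation_zero
  obtain ⟨m, hU⟩ := hX.exists_isNondegenerate hmean h1 h2 h4
  set U := innov a b ε with hUdef
  set θ : Matrix (Fin 2) (Fin 2) ℝ := !![a₀, b₀; c₀, d₀] with hθ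
  have ea : ∀ ω, ctrCoef θ 0 (U 1 ω) = a 1 ω - a₀ := fun ω => by
    simp [ctrCoef, hθ, hUdef, innov]
  have eb : ∀ ω, ctrCoef θ 1 (U 1 ω) = b 1 ω - b₀ := fun ω => by
    simp [ctrCoef, hθ, hUdef, innov]
  have ec : ∀ ω, ctrNoise θ 0 (U 1 ω) = ε (2 * 1) ω - c₀ := fun ω => by
    simp [ctrNoise, hθ, hUdef, innov]
  have ed : ∀ ω, ctrNoise θ 1 (U 1 ω) = ε (2 * 1 + 1) ω - d₀ := fun ω => by
    simp [ctrNoise, hθ, hUdef, innov]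
  have hcentre : ∀ {f : Ω → ℝ} {c : ℝ}, Integrable f P → P[f | natFilt X 0] =ᵐ[P] (fun _ => c) →
      ∫ ω, (f ω - c) ∂P = 0 := fun {f c} hf h => by
    rw [integral_sub hf (integrable_const c), integral_eq_of_condExp hm0 h]
    simp
  have hα : ∀ j, ∫ ω, ctrCoef θ j (U 1 ω) ∂P = 0 := by
    refine Fin.forall_fin_two.2 ⟨?_, ?_⟩
    · simp_rw [ea]
      exact hcentre (hmean.integrable_a 1 le_rfl) (hmean.mean_a 0 1 hg0)
    · simp_rw [eb]
      exact hcentre (hmean.integrable_b 1 le_rfl) (hmean.mean_b 0 1 hg0)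
  have hη : ∀ j, ∫ ω, ctrNoise θ j (U 1 ω) ∂P = 0 := by
    refine Fin.forall_fin_two.2 ⟨?_, ?_⟩
    · simp_rw [ec]
      exact hcentre (hmean.integrable_ε _ (by norm_num)) (hmean.mean_c 0 1 hg0)
    · simp_rw [ed]
      exact hcentre (hmean.integrable_ε _ (by norm_num)) (hmean.mean_d 0 1 hg0)
  have l00 : covLimit P (U 1) θ 0 0 = ![σa ^ 2, σc ^ 2] := by
    simp only [covLimit, ea, ec, ← pow_two]
    rw [integral_sq_of_condVar hm0 (hmean.mean_a 0 1 hg0) (h2.var_a 0 1 hg0),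
      integral_sq_of_condVar hm0 (hmean.mean_c 0 1 hg0) (h2.var_c 0 1 hg0)]
  have l11 : covLimit P (U 1) θ 1 1 = ![σb ^ 2, σd ^ 2] := by
    simp only [covLimit, eb, ed, ← pow_two]
    rw [integral_sq_of_condVar hm0 (hmean.mean_b 0 1 hg0) (h2.var_b 0 1 hg0),
      integral_sq_of_condVar hm0 (hmean.mean_d 0 1 hg0) (h2.var_d 0 1 hg0)]
  have l01 : covLimit P (U 1) θ 0 1 = ![ρab, ρcd] := by
    simp only [covLimit, ea, eb, ec, ed]
    rw [integral_eq_of_condExp hm0 (h3.cov_ab 0 1 hg0),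
      integral_eq_of_condExp hm0 (h3.cov_cd 0 1 hg0)]
  have hVe : ∀ᵐ ω ∂P, ∀ k, 1 ≤ k → VEven P X k ω = ctrCoef θ 0 (U k ω) * X k ω
      + ctrNoise θ 0 (U k ω) := by
    rw [ae_all_iff]
    intro k
    by_cases hk : 1 ≤ k
    · have hmem := mem_generation_genOf hk
      filter_upwards [condExp_affine (measurable_natFilt X hk) (hmean.integrable_a k hk)
        (hmean.integrable_ε _ (by omega)) (hX.integrable hU.toIsContractive (by omega))
        (hX.even k hk) (hmean.mean_a _ k hmem) (hmean.mean_c _ k hmem)] with ω hω _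
      rw [VEven, hω]
      simp [ctrCoef, ctrNoise, hθ, hUdef, innov]
    · exact ae_of_all _ fun ω h => absurd h hk
  have hVo : ∀ᵐ ω ∂P, ∀ k, 1 ≤ k → VOdd P X k ω = ctrCoef θ 1 (U k ω) * X k ω
      + ctrNoise θ 1 (U k ω) := by
    rw [ae_all_iff]
    intro k
    by_cases hk : 1 ≤ k
    · have hmem := mem_generation_genOf hk
      filter_upwards [condExp_affine (measurable_natFilt X hk) (hmean.integrable_b k hk)
        (hmean.integrable_ε _ (by omega)) (hX.integrable hU.toIsContractive (by omega))
        (hX.odd k hk) (hmean.mean_b _ k hmem) (hmean.mean_d _ k hmem)] with ω hω _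
      rw [VOdd, hω]
      simp [ctrCoef, ctrNoise, hθ, hUdef, innov]
    · exact ae_of_all _ fun ω h => absurd h hk
  have hreg : ∀ᵐ ω ∂P, IsRegularTrajectory (traj X ω) θ
        (fun j k => ctrCoef θ j (U k ω) * traj X ω k + ctrNoise θ j (U k ω)) ∧
      ∀ i j, ∀ p ≤ 2, SqLinBound fun l => ∑ k ∈ generation l, wt p (traj X ω k) *
        ((ctrCoef θ i (U k ω) * traj X ω k + ctrNoise θ i (U k ω))
          * (ctrCoef θ j (U k ω) * traj X ω k + ctrNoise θ j (U k ω))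
          - (covLimit P (U 1) θ i j 0 * traj X ω k ^ 2 + covLimit P (U 1) θ i j 1)) := by
    filter_upwards [hU.ae_isRegularTrajectory hα hη] with ω hω
    -- The event does not depend on the start, so the random start `X 1 ω` is admissible.
    refine hω (X 1 ω) (traj X ω) (fun k hk => hX.eq_path ω hk) fun k hk => ?_
    refine Fin.forall_fin_two.2 ⟨?_, ?_⟩
    · simp [chi, traj, hX.even k hk ω, ctrCoef, ctrNoise, hθ, hUdef, innov]
    · simp [chi, traj, hX.odd k hk ω, ctrCoef, ctrNoise, hθ, hUdef, innov]
  -- The pairs of children `(0, 0)`, `(1, 1)` and `(0, 1)` give the three estimators.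
  have key : ∀ᵐ ω ∂P,
      (∀ i j, Tendsto (fun n => wlsSecond (traj X ω)
        (fun k => Vhat (traj X ω) i k * Vhat (traj X ω) j k) n) atTop
        (𝓝 (covLimit P (U 1) θ i j))) ∧
      (∀ i j, HasTreeRate fun n => wlsSecond (traj X ω)
        (fun k => Vhat (traj X ω) i k * Vhat (traj X ω) j k) n
        - wlsSecond (traj X ω) (fun k => ![VEven P X k ω, VOdd P X k ω] i
          * ![VEven P X k ω, VOdd P X k ω] j) n) := by
    filter_upwards [hreg, hVe, hVo] with ω hω he ho
    refine ⟨fun i j => hω.1.tendsto_wlsSecond i j _ (hω.2 i j), fun i j => ?_⟩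
    have hV : ∀ k, 1 ≤ k → ∀ i, ![VEven P X k ω, VOdd P X k ω] i
        = ctrCoef θ i (U k ω) * traj X ω k + ctrNoise θ i (U k ω) := fun k hk =>
      Fin.forall_fin_two.2 ⟨he k hk, ho k hk⟩
    have e : ∀ n, wlsSecond (traj X ω) (fun k => ![VEven P X k ω, VOdd P X k ω] i
          * ![VEven P X k ω, VOdd P X k ω] j) n = _ := fun n =>
      wlsSecond_congr (fun k hk => by rw [hV k hk i, hV k hk j]) n
    simp_rw [e]
    exact hω.1.hasTreeRate i j
  refine ⟨⟨?_, ?_⟩, ⟨?_, ?_⟩, ⟨?_, ?_⟩⟩ <;> filter_upwards [key] with ω hω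
  · have := hω.1 0 0
    simp only [l00, Vhat_zero, ← pow_two] at this
    exact this
  · have := hω.2 0 0
    simp only [Vhat_zero, Matrix.cons_val_zero, ← pow_two] at this
    exact this
  · have := hω.1 1 1
    simp only [l11, Vhat_one, ← pow_two] at this
    exact this
  · have := hω.2 1 1
    simp only [Vhat_one, Matrix.cons_val_one, Matrix.cons_val_fin_one, ← pow_two] at this
    exact this
  · have := hω.1 0 1
    simp only [l01, Vhat_zero, Vhat_one] at this
    exact this
  · have := hω.2 0 1
    simp only [Vhat_zero, Vhat_one, Matrix.cons_val_zero, Matrix.cons_val_one,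
      Matrix.cons_val_fin_one] at this
    exact this
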